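/- Let $(\Sigma,h)$ be an $n$-dimensional Riemannian manifold (for instance a spacelike hypersurface of a Lorentzian manifold with its induced metric; Hausdorff, second countable, of class $C^3$ with $h$ of class $C^2$), with volume measure $\mu_h$. Let $p\in\Sigma$, let $r>0$ be strictly smaller than the injectivity radius of $(\Sigma,h)$ at $p$, let $B=B_\Sigma(p,r)=\exp_p\{v\in T_p\Sigma:\|v\|_h<r\}$ be the geodesic ball, and let $\hbar>0$. Fix an $h$-orthonormal frame $X_1,\dots,X_n$ of class $C^2$ on a neighbourhood of $\overline B$, and put $f_a=\operatorname{div}_h X_a$, $V=\tfrac12\sum_a X_a(f_a)+\tfrac14\sum_a f_a^2$. For $\psi\in H^1_0(B)$ (complex valued) with $\|\psi\|_{L^2(B,\mu_h)}=1$ let $$P_a\psi=-i\hbar\bigl(X_a\psi+\tfrac12 f_a\psi\bigr),\qquad \langle P_a\rangle=\langle\psi,P_a\psi\rangle_{L^2},$$ $$\mathrm{Var}_\psi(P)=\sum_{a=1}^n\bigl(\|P_a\psi\|_{L^2}^2-|\langle P_a\rangle|^2\bigr)+\hbar^2\int_B V|\psi|^2\,d\mu_h,\qquad \sigma_p(\psi)=\sqrt{\mathrm{Var}_\psi(P)},$$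 and let $$\lambda_1=\lambda_1(B;h)=\inf\Bigl\{\frac{\int_B\|\nabla^h u\|_h^2\,d\mu_h}{\int_B|u|^2\,d\mu_h}:0\ne u\in H^1_0(B)\Bigr\}$$ be the first Dirichlet eigenvalue of $-\Delta_h$ on $B$. Then $\mathrm{Var}_\psi(P)\ge 0$ and $$\sigma_p(\psi)\ \ge\ \hbar\sqrt{\lambda_1(B;h)}.$$ Equality holds if and only if $|\psi|$ is a first Dirichlet eigenfunction of $-\Delta_h$ on $B$ (that is, $|\psi|\in H^1_0(B)$ and $-\Delta_h|\psi|=\lambda_1|\psi|$ weakly) and the phase gradient $\nabla^h(\arg\psi)$ is $\nu$-a.e. constant, where $d\nu=|\psi|^2d\mu_h$; that is, there are constants $c_1,\dots,c_n\in\mathbb R$ with $X_a(\arg\psi):=\operatorname{Im}(X_a\psi/\psi)=c_a$ $\nu$-a.e. on $B$ for every $a$. -/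

import Mathlib

open Bundle Manifold MeasureTheory Filter
open scoped ContDiff Topology ENNReal ComplexConjugate

noncomputable section

namespace SliceUncertainty

section Geometry

variable {n : ℕ} {M : Type*} [TopologicalSpace M] [ChartedSpace (EuclideanSpace ℝ (Fin n)) M]

instance tangentSpace_finiteDimensional (x : M) : FiniteDimensional ℝ (TangentSpace (𝓡 n) x) :=
  inferInstanceAs (FiniteDimensional ℝ (EuclideanSpace ℝ (Fin n)))

/-- The `i`-th standard basis vector of `ℝⁿ`. -/
def stdVec (n : ℕ) (i : Fin n) : EuclideanSpace ℝ (Fin n) := EuclideanSpace.single i 1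

/-- The metric in the preferred chart at `x₀`: for a coordinate point `y` in the target of the chart
and coordinate vectors `v, w`, this is `h_{ij}(y) vⁱ wʲ`. -/
def coordMetric [RiemannianBundle (fun x : M => TangentSpace (𝓡 n) x)] (x₀ : M)
    (y v w : EuclideanSpace ℝ (Fin n)) : ℝ :=
  inner ℝ (mfderiv (𝓡 n) (𝓡 n) (chartAt (EuclideanSpace ℝ (Fin n)) x₀).symm y v)
    (mfderiv (𝓡 n) (𝓡 n) (chartAt (EuclideanSpace ℝ (Fin n)) x₀).symm y w)

/-- The volume density `√|h| = √(det h_{ij})` in the preferred chart at `x₀`. -/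
def density [RiemannianBundle (fun x : M => TangentSpace (𝓡 n) x)] (x₀ : M)
    (y : EuclideanSpace ℝ (Fin n)) : ℝ :=
  Real.sqrt (Matrix.det (Matrix.of fun i j : Fin n =>
    coordMetric x₀ y (stdVec n i) (stdVec n j)))

/-- The measure `√|h| dⁿy` of the preferred chart at `x₀`, transported to the chart domain in `M`. -/
def chartVolume [RiemannianBundle (fun x : M => TangentSpace (𝓡 n) x)] [MeasurableSpace M]
    (x₀ : M) : Measure M :=
  Measure.map (chartAt (EuclideanSpace ℝ (Fin n)) x₀).symm
    ((volume.restrict (chartAt (EuclideanSpace ℝ (Fin n)) x₀).target).withDensity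
      fun y => ENNReal.ofReal (density x₀ y))

/-- The Riemannian volume measure `μ_h`: the least measure that dominates `√|h| dⁿy` in every
preferred chart. (These chart measures agree on overlaps of charts, so on each chart domain
this measure *is* `√|h| dⁿy`.) -/
def riemVolume (n : ℕ) (M : Type*) [TopologicalSpace M]
    [ChartedSpace (EuclideanSpace ℝ (Fin n)) M]
    [RiemannianBundle (fun x : M => TangentSpace (𝓡 n) x)] [MeasurableSpace M] : Measure M :=
  ⨆ x₀ : M, chartVolume (n := n) x₀

/-- The coordinate vector `(X¹, …, Xⁿ)` of a vector field in the preferred chart at `x₀`, at the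
coordinate point `y`. -/
def coordField (X : ∀ x : M, TangentSpace (𝓡 n) x) (x₀ : M) (y : EuclideanSpace ℝ (Fin n)) :
    EuclideanSpace ℝ (Fin n) :=
  mfderiv (𝓡 n) (𝓡 n) (chartAt (EuclideanSpace ℝ (Fin n)) x₀)
    ((chartAt (EuclideanSpace ℝ (Fin n)) x₀).symm y)
    (X ((chartAt (EuclideanSpace ℝ (Fin n)) x₀).symm y))

/-- The divergence `div_h X = |h|^{-1/2} ∂ᵢ(|h|^{1/2} Xⁱ)` of a vector field, computed at `x` in the
preferred chart at `x`. -/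
def divergence [RiemannianBundle (fun x : M => TangentSpace (𝓡 n) x)]
    (X : ∀ x : M, TangentSpace (𝓡 n) x) (x : M) : ℝ :=
  (density x (chartAt (EuclideanSpace ℝ (Fin n)) x x))⁻¹ * ∑ i : Fin n,
    fderiv ℝ (fun y : EuclideanSpace ℝ (Fin n) => density x y * coordField X x y i)
      (chartAt (EuclideanSpace ℝ (Fin n)) x x) (stdVec n i)

/-- `γ` is a geodesic on the open set `s` of times: it is of class `C²` there and satisfies, in the
chart around each of its points, the geodesic equation in its Euler–Lagrange form
`d/dt (h_{ij} γ'ⁱ wʲ) = ½ wᵏ ∂ₖ h_{ij} γ'ⁱ γ'ʲ` for every constant coordinate vector `w`. -/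
def IsGeodesicOn [RiemannianBundle (fun x : M => TangentSpace (𝓡 n) x)]
    (γ : ℝ → M) (s : Set ℝ) : Prop :=
  ContMDiffOn 𝓘(ℝ, ℝ) (𝓡 n) 2 γ s ∧
  ∀ t ∈ s, ∀ w : EuclideanSpace ℝ (Fin n),
    let c : ℝ → EuclideanSpace ℝ (Fin n) :=
      fun τ => chartAt (EuclideanSpace ℝ (Fin n)) (γ t) (γ τ)
    HasDerivAt (fun τ => coordMetric (γ t) (c τ) (deriv c τ) w)
      ((1 / 2) * fderiv ℝ (fun y => coordMetric (γ t) y (deriv c t) (deriv c t)) (c t) w) t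

/-- `γ` is a geodesic, defined on an open interval containing `[0, 1]`, with `γ(0) = p` and
`γ'(0) = v`. -/
def IsGeodesicFrom [IsManifold (𝓡 n) 1 M] [RiemannianBundle (fun x : M => TangentSpace (𝓡 n) x)]
    (p : M) (v : TangentSpace (𝓡 n) p) (γ : ℝ → M) : Prop :=
  ∃ ε > 0, IsGeodesicOn (n := n) γ (Set.Ioo (-ε) (1 + ε)) ∧
    (⟨γ 0, mfderiv 𝓘(ℝ, ℝ) (𝓡 n) γ 0 (1 : ℝ)⟩ : TangentBundle (𝓡 n) M) = ⟨p, v⟩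

open Classical in
/-- The exponential map: `exp_p v = γ(1)` for the geodesic `γ` with `γ(0) = p`, `γ'(0) = v`,
whenever this geodesic exists up to time `1`. -/
def expMap [IsManifold (𝓡 n) 1 M] [RiemannianBundle (fun x : M => TangentSpace (𝓡 n) x)]
    (p : M) (v : TangentSpace (𝓡 n) p) : M :=
  if hv : ∃ γ : ℝ → M, IsGeodesicFrom (n := n) p v γ then hv.choose 1 else p

/-- `exp_p` is defined on the ball of radius `R` about `0` in `T_p M` and restricts there to a
diffeomorphism onto its (open) image. -/
def IsNormalRadius [IsManifold (𝓡 n) 1 M] [RiemannianBundle (fun x : M => TangentSpace (𝓡 n) x)]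
    (p : M) (R : ℝ) : Prop :=
  (∀ v ∈ Metric.ball (0 : TangentSpace (𝓡 n) p) R, ∃ γ : ℝ → M, IsGeodesicFrom (n := n) p v γ) ∧
  ∃ e : PartialDiffeomorph 𝓘(ℝ, TangentSpace (𝓡 n) p) (𝓡 n) (TangentSpace (𝓡 n) p) M 1,
    e.source = Metric.ball 0 R ∧ ∀ v ∈ Metric.ball (0 : TangentSpace (𝓡 n) p) R,
      e v = expMap (n := n) p v

/-- The injectivity radius at `p`. -/
def injRadius (n : ℕ) {M : Type*} [TopologicalSpace M]
    [ChartedSpace (EuclideanSpace ℝ (Fin n)) M] [IsManifold (𝓡 n) 1 M]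
    [RiemannianBundle (fun x : M => TangentSpace (𝓡 n) x)] (p : M) : ℝ≥0∞ :=
  ⨆ (R : ℝ) (_ : 0 < R ∧ IsNormalRadius (n := n) p R), ENNReal.ofReal R

/-- The geodesic ball `B(p, r) = exp_p {v ∈ T_p M : ‖v‖ < r}`. -/
def geodesicBall (n : ℕ) {M : Type*} [TopologicalSpace M]
    [ChartedSpace (EuclideanSpace ℝ (Fin n)) M] [IsManifold (𝓡 n) 1 M]
    [RiemannianBundle (fun x : M => TangentSpace (𝓡 n) x)] (p : M) (r : ℝ) : Set M :=
  expMap (n := n) p '' Metric.ball (0 : TangentSpace (𝓡 n) p) r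

/-- `X₁, …, Xₙ` is an `h`-orthonormal frame of class `C²` on the set `U`. -/
def IsOrthonormalFrameOn [IsManifold (𝓡 n) 1 M]
    [RiemannianBundle (fun x : M => TangentSpace (𝓡 n) x)]
    (X : Fin n → ∀ x : M, TangentSpace (𝓡 n) x) (U : Set M) : Prop :=
  (∀ a, ContMDiffOn (𝓡 n) (𝓡 n).tangent 2
      (fun x => (⟨x, X a x⟩ : TangentBundle (𝓡 n) M)) U) ∧
  ∀ x ∈ U, Orthonormal ℝ fun a => X a x

end Geometry

section Sobolev

variable {n : ℕ} {M : Type*} [TopologicalSpace M] [ChartedSpace (EuclideanSpace ℝ (Fin n)) M]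

/-- The classical differential `dφ_x : T_x M → ℂ` of a complex function. -/
def diff (n : ℕ) {M : Type*} [TopologicalSpace M] [ChartedSpace (EuclideanSpace ℝ (Fin n)) M]
    (φ : M → ℂ) (x : M) : TangentSpace (𝓡 n) x →L[ℝ] ℂ :=
  mfderiv (𝓡 n) 𝓘(ℝ, ℂ) φ x

/-- The (sesquilinear) inner product of complex covectors, `∑ₐ conj (α(eₐ)) β(eₐ)` for an
orthonormal basis `(eₐ)` of `T_x M`. -/
def covInner [RiemannianBundle (fun x : M => TangentSpace (𝓡 n) x)] {x : M}
    (α β : TangentSpace (𝓡 n) x →L[ℝ] ℂ) : ℂ :=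
  ∑ a, conj (α (stdOrthonormalBasis ℝ (TangentSpace (𝓡 n) x) a)) *
    β (stdOrthonormalBasis ℝ (TangentSpace (𝓡 n) x) a)

/-- The norm of a complex covector, `(∑ₐ |α(eₐ)|²)^{1/2}` for an orthonormal basis `(eₐ)`;
for `α = dψ_x` this is `‖∇ψ(x)‖_h`. -/
def covNorm [RiemannianBundle (fun x : M => TangentSpace (𝓡 n) x)] {x : M}
    (α : TangentSpace (𝓡 n) x →L[ℝ] ℂ) : ℝ :=
  Real.sqrt (∑ a, ‖α (stdOrthonormalBasis ℝ (TangentSpace (𝓡 n) x) a)‖ ^ 2)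

/-- Complex test functions on `Ω`: compactly supported inside `Ω`, of the class `C³` of the
manifold. -/
def IsTestFunction (n : ℕ) {M : Type*} [TopologicalSpace M]
    [ChartedSpace (EuclideanSpace ℝ (Fin n)) M] (Ω : Set M) (φ : M → ℂ) : Prop :=
  ContMDiff (𝓡 n) 𝓘(ℝ, ℂ) 3 φ ∧ HasCompactSupport φ ∧ tsupport φ ⊆ Ω

/-- `ψ ∈ H¹₀(Ω)` with weak differential `dψ`: the pair `(ψ, dψ)` is the limit in
`L²(Ω) × L²(Ω; T*)` of pairs `(φₖ, dφₖ)` with test functions `φₖ` on `Ω`. -/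
def MemH10 [RiemannianBundle (fun x : M => TangentSpace (𝓡 n) x)] [MeasurableSpace M]
    (Ω : Set M) (ψ : M → ℂ) (dψ : ∀ x : M, TangentSpace (𝓡 n) x →L[ℝ] ℂ) : Prop :=
  ∃ φ : ℕ → M → ℂ, (∀ k, IsTestFunction n Ω (φ k)) ∧
    (∀ k, MemLp (fun x => φ k x - ψ x) 2 ((riemVolume n M).restrict Ω)) ∧
    (∀ k, MemLp (fun x => covNorm (diff n (φ k) x - dψ x)) 2 ((riemVolume n M).restrict Ω)) ∧
    Tendsto (fun k => eLpNorm (fun x => φ k x - ψ x) 2 ((riemVolume n M).restrict Ω))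
      atTop (𝓝 0) ∧
    Tendsto (fun k => eLpNorm (fun x => covNorm (diff n (φ k) x - dψ x)) 2
      ((riemVolume n M).restrict Ω)) atTop (𝓝 0)

/-- The first Dirichlet eigenvalue `λ₁(Ω; h)` of `-Δ_h`: the infimum of the Rayleigh quotients of
the nonzero elements of `H¹₀(Ω)`. -/
def lambda1 (n : ℕ) {M : Type*} [TopologicalSpace M] [ChartedSpace (EuclideanSpace ℝ (Fin n)) M]
    [RiemannianBundle (fun x : M => TangentSpace (𝓡 n) x)] [MeasurableSpace M]
    (Ω : Set M) : ℝ :=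
  sInf {q : ℝ | ∃ (u : M → ℂ) (du : ∀ x : M, TangentSpace (𝓡 n) x →L[ℝ] ℂ),
    MemH10 Ω u du ∧ 0 < ∫ x in Ω, ‖u x‖ ^ 2 ∂(riemVolume n M) ∧
    q = (∫ x in Ω, covNorm (du x) ^ 2 ∂(riemVolume n M)) /
      ∫ x in Ω, ‖u x‖ ^ 2 ∂(riemVolume n M)}

/-- `u` is a Dirichlet eigenfunction of `-Δ_h` on `Ω` with eigenvalue `l`: a nonzero element of
`H¹₀(Ω)` with `-Δ_h u = l u` weakly, i.e. `∫ h(∇φ, ∇u) = l ∫ conj φ u` for all test functions. -/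
def IsDirichletEigenfunction (n : ℕ) {M : Type*} [TopologicalSpace M]
    [ChartedSpace (EuclideanSpace ℝ (Fin n)) M]
    [RiemannianBundle (fun x : M => TangentSpace (𝓡 n) x)] [MeasurableSpace M]
    (Ω : Set M) (l : ℝ) (u : M → ℂ) : Prop :=
  ∃ du : ∀ x : M, TangentSpace (𝓡 n) x →L[ℝ] ℂ,
    MemH10 Ω u du ∧ 0 < ∫ x in Ω, ‖u x‖ ^ 2 ∂(riemVolume n M) ∧
    ∀ φ : M → ℂ, IsTestFunction n Ω φ →
      ∫ x in Ω, covInner (diff n φ x) (du x) ∂(riemVolume n M) =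
        l * ∫ x in Ω, conj (φ x) * u x ∂(riemVolume n M)

end Sobolev

section Momentum

variable {n : ℕ} {M : Type*} [TopologicalSpace M] [ChartedSpace (EuclideanSpace ℝ (Fin n)) M]
  [RiemannianBundle (fun x : M => TangentSpace (𝓡 n) x)]

/-- The symmetrized momentum component `P_a ψ = -iħ (X_a ψ + ½ (div_h X_a) ψ)` belonging to the
vector field `Y = X_a`. -/
def momentum (hbar : ℝ) (Y : ∀ x : M, TangentSpace (𝓡 n) x) (ψ : M → ℂ)
    (dψ : ∀ x : M, TangentSpace (𝓡 n) x →L[ℝ] ℂ) (x : M) : ℂ :=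
  -Complex.I * hbar * (dψ x (Y x) + (1 / 2) * (divergence Y x : ℂ) * ψ x)

/-- The mean momentum `⟨P_a⟩ = ⟨ψ, P_a ψ⟩` in `L²(Ω)`. -/
def meanMomentum [MeasurableSpace M] (hbar : ℝ) (Ω : Set M)
    (Y : ∀ x : M, TangentSpace (𝓡 n) x) (ψ : M → ℂ)
    (dψ : ∀ x : M, TangentSpace (𝓡 n) x →L[ℝ] ℂ) : ℂ :=
  ∫ x in Ω, conj (ψ x) * momentum hbar Y ψ dψ x ∂(riemVolume n M)

/-- The naive variance `∑ₐ (⟨P_a²⟩ - ⟨P_a⟩²)`, where `⟨P_a²⟩` is the form `‖P_a ψ‖²` in `L²(Ω)`. -/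
def naiveVariance [MeasurableSpace M] (hbar : ℝ) (Ω : Set M)
    (X : Fin n → ∀ x : M, TangentSpace (𝓡 n) x) (ψ : M → ℂ)
    (dψ : ∀ x : M, TangentSpace (𝓡 n) x →L[ℝ] ℂ) : ℝ :=
  ∑ a, ((∫ x in Ω, ‖momentum hbar (X a) ψ dψ x‖ ^ 2 ∂(riemVolume n M)) -
    ‖meanMomentum hbar Ω (X a) ψ dψ‖ ^ 2)

/-- The geometric potential `V = ½ ∑ₐ X_a(f_a) + ¼ ∑ₐ f_a²` with `f_a = div_h X_a`. -/
def potential (X : Fin n → ∀ x : M, TangentSpace (𝓡 n) x) (x : M) : ℝ :=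
  (1 / 2) * ∑ a, (mfderiv (𝓡 n) 𝓘(ℝ, ℝ) (divergence (X a)) x (X a x) : ℝ) +
    (1 / 4) * ∑ a, divergence (X a) x ^ 2

/-- The geometric momentum variance: the naive variance plus `ħ² ⟨V⟩`. -/
def geomVariance [MeasurableSpace M] (hbar : ℝ) (Ω : Set M)
    (X : Fin n → ∀ x : M, TangentSpace (𝓡 n) x) (ψ : M → ℂ)
    (dψ : ∀ x : M, TangentSpace (𝓡 n) x →L[ℝ] ℂ) : ℝ :=
  naiveVariance hbar Ω X ψ dψ +
    hbar ^ 2 * ∫ x in Ω, potential X x * ‖ψ x‖ ^ 2 ∂(riemVolume n M)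

/-- The momentum standard deviation `σ_p(ψ)`. -/
def sigmaP [MeasurableSpace M] (hbar : ℝ) (Ω : Set M)
    (X : Fin n → ∀ x : M, TangentSpace (𝓡 n) x) (ψ : M → ℂ)
    (dψ : ∀ x : M, TangentSpace (𝓡 n) x →L[ℝ] ℂ) : ℝ :=
  Real.sqrt (geomVariance hbar Ω X ψ dψ)

/-- The probability measure `dν = |ψ|² dμ_h` on `Ω`. -/
def stateMeasure (n : ℕ) {M : Type*} [TopologicalSpace M]
    [ChartedSpace (EuclideanSpace ℝ (Fin n)) M]
    [RiemannianBundle (fun x : M => TangentSpace (𝓡 n) x)] [MeasurableSpace M]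
    (Ω : Set M) (ψ : M → ℂ) : Measure M :=
  ((riemVolume n M).restrict Ω).withDensity fun x => ENNReal.ofReal (‖ψ x‖ ^ 2)

end Momentum

/-- The differential `d(arg ψ) = Im (dψ / ψ)` of the phase at a point where `ψ ≠ 0`, applied to the
tangent vector `v`: if `ψ = u e^{iφ}` near `x` with `u > 0` and differentiable real `u, φ`,
then `dψ / ψ = du / u + i dφ`. -/
def phaseDeriv {n : ℕ} {M : Type*} [TopologicalSpace M]
    [ChartedSpace (EuclideanSpace ℝ (Fin n)) M] (ψ : M → ℂ)
    (dψ : ∀ x : M, TangentSpace (𝓡 n) x →L[ℝ] ℂ) (x : M) (v : TangentSpace (𝓡 n) x) : ℝ :=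
  (dψ x v / ψ x).im

end SliceUncertainty

end

/-! The variance, divided by `ħ²`, splits into two nonnegative pieces: the Dirichlet energy of
`|ψ|`, and the sum over `a` of the `ν`-variances of the phase derivatives `θ_a = Im (X_a ψ / ψ)`.
The first piece is at least `λ₁`, because `|ψ|` lies in `H¹₀` and has norm one. The second vanishes
exactly when every `θ_a` is `ν`-a.e. constant. The inequality and both halves of the equality case
follow from this.

The splitting has three ingredients. (i) Integrating `f_a X_a |ψ|²` by parts gives `‖X_a ψ + ½ f_a
ψ‖² = ‖X_a ψ‖² - ½ ∫ X_a(f_a) |ψ|² - ¼ ∫ f_a² |ψ|²`. Summed over `a`, the correction is exactly `-∫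
V |ψ|²`, so the geometric potential restores the plain energy (`Mem.integral_norm_sq_symmetrised`,
`Mem.variance_eq`). (ii) The term `½ f_a` cancels the real part of `⟨ψ, X_a ψ⟩`, so the mean
momentum is, up to sign and `ħ`, the number `m_a = ∫ Im (conj ψ · X_a ψ) = ∫ θ_a dν`
(`Mem.norm_integral_sq`). (iii) In polar form `|X_a ψ|² = (X_a |ψ|)² + θ_a² |ψ|²` almost everywhere.
On the zero set of `ψ` this needs that `dψ` vanishes a.e. there (`Mem.norm`,
`Mem.ae_eq_zero_of_eq_zero`, `Mem.variance_eq_add`).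

Equality in the energy bound makes `|ψ|` a minimiser of the Rayleigh quotient. Its first variation
is the weak eigenvalue equation, and conversely the equation tested against approximants of `|ψ|`
returns the energy (`Mem.isWeakEigen`, `IsWeakEigen.energy_eq`). Existence of a minimiser is never
needed.

All of this uses only a few formal properties of test functions and frame derivatives, collected in
`FrameCalculus`. The geometry serves to verify them. The ball is open with compact closure, so the
divergences and their derivatives are bounded on it. The divergence theorem is proved in one chart,
shown to be independent of the chart, and globalised with a partition of unity
(`integral_fieldDeriv_eq`). Finally, covector fields and their norms are translated into frame
components, which identifies `MemH10` and `lambda1` with their abstract counterparts. -/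

namespace SliceUncertainty

set_option linter.unusedSectionVars false

/-! ### Regularity of the metric, the density and vector fields in coordinates. -/

section Charts

variable {n : ℕ} {M : Type*} [TopologicalSpace M] [ChartedSpace (EuclideanSpace ℝ (Fin n)) M]

local notation "𝔼" => EuclideanSpace ℝ (Fin n)

theorem mfderiv_chart_symm_chart [IsManifold (𝓡 n) 1 M] (x₀ : M) {x : M}
    (hx : x ∈ (chartAt 𝔼 x₀).source) (v : TangentSpace (𝓡 n) x) :
    mfderiv (𝓡 n) (𝓡 n) (chartAt 𝔼 x₀).symm (chartAt 𝔼 x₀ x)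
      (mfderiv (𝓡 n) (𝓡 n) (chartAt 𝔼 x₀) x v) = v := by
  have := (mdifferentiable_chart (I := 𝓡 n) x₀).symm_comp_deriv hx
  exact congrArg (fun L => L v) this

theorem mfderiv_chart_chart_symm [IsManifold (𝓡 n) 1 M] (x₀ : M) {y : 𝔼}
    (hy : y ∈ (chartAt 𝔼 x₀).target) (v : 𝔼) :
    mfderiv (𝓡 n) (𝓡 n) (chartAt 𝔼 x₀) ((chartAt 𝔼 x₀).symm y)
      (mfderiv (𝓡 n) (𝓡 n) (chartAt 𝔼 x₀).symm y v) = v := by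
  have := (mdifferentiable_chart (I := 𝓡 n) x₀).comp_symm_deriv hy
  exact congrArg (fun L => L v) this

/-- The transition functions of the tangent bundle are derivatives of those of the manifold, so one
order is lost. This is where class `C³` allows a metric and a frame of class `C²`. -/
theorem contMDiffVectorBundle_two [IsManifold (𝓡 n) 3 M] :
    ContMDiffVectorBundle 2 𝔼 (TangentSpace (𝓡 n) : M → Type _) (𝓡 n) := by
  have : IsManifold (𝓡 n) (2 + 1) M := by
    have h : (2 + 1 : ℕ∞ω) = 3 := by norm_num
    rw [h]; infer_instance
  exact TangentBundle.contMDiffVectorBundle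

/-- The bridge from regularity of a section of the tangent bundle to regularity of its coordinate
functions. -/
theorem trivializationAt_apply_snd [IsManifold (𝓡 n) 1 M] (x₀ : M) {x : M}
    (hx : x ∈ (chartAt 𝔼 x₀).source) (v : TangentSpace (𝓡 n) x) :
    (trivializationAt 𝔼 (TangentSpace (𝓡 n)) x₀ ⟨x, v⟩).2 =
      mfderiv (𝓡 n) (𝓡 n) (chartAt 𝔼 x₀) x v := by
  have h := TangentBundle.continuousLinearMapAt_trivializationAt (I := 𝓡 n) hx
  have h2 : x ∈ (trivializationAt 𝔼 (TangentSpace (𝓡 n)) x₀).baseSet := by simpa using hx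
  have h3 := congrArg (fun L => L v) h
  simp only [Trivialization.continuousLinearMapAt_apply,
    Trivialization.linearMapAt_apply, if_pos h2] at h3
  rw [h3]
  rfl

/-- In the trivialization over the chart this field is the constant `v`. -/
theorem contMDiffOn_chartField [IsManifold (𝓡 n) 3 M] (x₀ : M) (v : 𝔼) :
    ContMDiffOn (𝓡 n) (𝓡 n).tangent 2
      (fun x => (⟨x, mfderiv (𝓡 n) (𝓡 n) (chartAt 𝔼 x₀).symm (chartAt 𝔼 x₀ x) v⟩ :
        TangentBundle (𝓡 n) M)) (chartAt 𝔼 x₀).source := by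
  have := contMDiffVectorBundle_two (n := n) (M := M)
  have hb : (trivializationAt 𝔼 (TangentSpace (𝓡 n)) x₀).baseSet = (chartAt 𝔼 x₀).source := by
    simp
  rw [← hb]
  refine ((trivializationAt 𝔼 (TangentSpace (𝓡 n) : M → Type _)
    x₀).contMDiffOn_section_baseSet_iff).2 ?_
  refine (contMDiffOn_const (c := v)).congr fun x hx => ?_
  rw [hb] at hx
  refine (trivializationAt_apply_snd x₀ hx _).trans ?_
  have := mfderiv_chart_chart_symm x₀ ((chartAt 𝔼 x₀).map_source hx) v
  rwa [(chartAt 𝔼 x₀).left_inv hx] at this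

theorem contDiffOn_chart_symm_comp {F : Type*} [NormedAddCommGroup F] [NormedSpace ℝ F]
    {k : ℕ∞ω} [IsManifold (𝓡 n) k M] (x₀ : M) {g : M → F} {s : Set M}
    (hg : ContMDiffOn (𝓡 n) 𝓘(ℝ, F) k g s) :
    ContDiffOn ℝ k (fun y => g ((chartAt 𝔼 x₀).symm y))
      ((chartAt 𝔼 x₀).target ∩ (chartAt 𝔼 x₀).symm ⁻¹' s) := by
  rw [← contMDiffOn_iff_contDiffOn]
  have h : ContMDiffOn (𝓡 n) (𝓡 n) k (chartAt 𝔼 x₀).symm (chartAt 𝔼 x₀).target :=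
    contMDiffOn_chart_symm
  exact hg.comp (h.mono Set.inter_subset_left) fun y hy => hy.2

theorem contDiffOn_coordField [IsManifold (𝓡 n) 3 M] {X : ∀ x : M, TangentSpace (𝓡 n) x}
    {U : Set M} (hU : IsOpen U)
    (hX : ContMDiffOn (𝓡 n) (𝓡 n).tangent 2 (fun x => (⟨x, X x⟩ : TangentBundle (𝓡 n) M)) U)
    (x₀ : M) :
    ContDiffOn ℝ 2 (coordField X x₀)
      ((chartAt 𝔼 x₀).target ∩ (chartAt 𝔼 x₀).symm ⁻¹' U) := by
  have := contMDiffVectorBundle_two (n := n) (M := M)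
  have hb : (trivializationAt 𝔼 (TangentSpace (𝓡 n)) x₀).baseSet = (chartAt 𝔼 x₀).source := by
    simp
  have h1 := ((trivializationAt 𝔼 (TangentSpace (𝓡 n) : M → Type _)
    x₀).contMDiffOn_section_iff (a := (chartAt 𝔼 x₀).source ∩ U) (s := X) (IB := 𝓡 n) (n := 2)
      ((chartAt 𝔼 x₀).open_source.inter hU) (by rw [hb]; exact Set.inter_subset_left)).1
      (hX.mono Set.inter_subset_right)
  have : IsManifold (𝓡 n) 2 M := inferInstance
  have h2 := contDiffOn_chart_symm_comp x₀ h1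
  refine (h2.mono fun y hy => ⟨hy.1, (chartAt 𝔼 x₀).map_target hy.1, hy.2⟩).congr fun y hy => ?_
  exact (trivializationAt_apply_snd x₀ ((chartAt 𝔼 x₀).map_target hy.1) _).symm

variable [RiemannianBundle (fun x : M => TangentSpace (𝓡 n) x)]

theorem contDiffOn_coordMetric [IsManifold (𝓡 n) 3 M]
    [IsContMDiffRiemannianBundle (𝓡 n) 2 𝔼 (fun x : M => TangentSpace (𝓡 n) x)]
    (x₀ : M) (v w : 𝔼) :
    ContDiffOn ℝ 2 (fun y => coordMetric x₀ y v w) (chartAt 𝔼 x₀).target := by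
  have h1 := (contMDiffOn_chartField x₀ v).inner_bundle (contMDiffOn_chartField x₀ w)
  have : IsManifold (𝓡 n) 2 M := inferInstance
  have h2 := contDiffOn_chart_symm_comp x₀ h1
  refine (h2.mono fun y hy => ⟨hy, (chartAt 𝔼 x₀).map_target hy⟩).congr fun y hy => ?_
  -- The point `chartAt x₀ ((chartAt x₀).symm y)` equals `y` only propositionally, and the types of
  -- the derivatives depend on it. Generalising it to `z` permits substitution.
  have key : ∀ z, z = y →
      inner ℝ (show TangentSpace (𝓡 n) ((chartAt 𝔼 x₀).symm y) from
        mfderiv (𝓡 n) (𝓡 n) (chartAt 𝔼 x₀).symm z v)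
        (show TangentSpace (𝓡 n) ((chartAt 𝔼 x₀).symm y) from
        mfderiv (𝓡 n) (𝓡 n) (chartAt 𝔼 x₀).symm z w) = coordMetric x₀ y v w := by
    rintro _ rfl
    rfl
  exact (key _ ((chartAt 𝔼 x₀).right_inv hy)).symm

/-- The matrix is the Gram matrix of the coordinate vectors, which are independent because the
derivative of a chart is injective. -/
theorem det_coordMetric_pos [IsManifold (𝓡 n) 1 M] (x₀ : M) {y : 𝔼}
    (hy : y ∈ (chartAt 𝔼 x₀).target) :
    0 < Matrix.det (Matrix.of fun i j : Fin n =>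
      coordMetric x₀ y (stdVec n i) (stdVec n j)) := by
  let L : 𝔼 →ₗ[ℝ] TangentSpace (𝓡 n) ((chartAt 𝔼 x₀).symm y) :=
    (mfderiv (𝓡 n) (𝓡 n) (chartAt 𝔼 x₀).symm y).toLinearMap
  have hL : Function.Injective L := Function.LeftInverse.injective
    (g := fun v => mfderiv (𝓡 n) (𝓡 n) (chartAt 𝔼 x₀) ((chartAt 𝔼 x₀).symm y) v)
    fun v => mfderiv_chart_chart_symm x₀ hy v
  have hli : LinearIndependent ℝ fun i : Fin n => L (stdVec n i) := by
    have h0 : LinearIndependent ℝ fun i : Fin n => stdVec n i := by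
      have e : (fun i : Fin n => stdVec n i) = (EuclideanSpace.basisFun (Fin n) ℝ).toBasis := by
        funext i
        simp [stdVec]
      rw [e]
      exact (EuclideanSpace.basisFun (Fin n) ℝ).toBasis.linearIndependent
    exact h0.map' L (LinearMap.ker_eq_bot.2 hL)
  exact (Matrix.posDef_gram_of_linearIndependent hli).det_pos

theorem density_pos [IsManifold (𝓡 n) 1 M] (x₀ : M) {y : 𝔼}
    (hy : y ∈ (chartAt 𝔼 x₀).target) : 0 < density x₀ y :=
  Real.sqrt_pos.2 (det_coordMetric_pos x₀ hy)

theorem contDiffOn_density [IsManifold (𝓡 n) 3 M]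
    [IsContMDiffRiemannianBundle (𝓡 n) 2 𝔼 (fun x : M => TangentSpace (𝓡 n) x)]
    (x₀ : M) : ContDiffOn ℝ 2 (density x₀) (chartAt 𝔼 x₀).target := by
  refine ContDiffOn.sqrt ?_ fun y hy => (det_coordMetric_pos x₀ hy).ne'
  simp only [Matrix.det_apply, Matrix.of_apply]
  refine ContDiffOn.sum fun σ _ => ContDiffOn.const_smul _ ?_
  exact contDiffOn_prod fun i _ => contDiffOn_coordMetric x₀ _ _

end Charts

/-! ### The Riemannian volume: agreement of the chart measures and transport of integrals. -/

section Volume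

variable {n : ℕ} {M : Type*} [TopologicalSpace M] [ChartedSpace (EuclideanSpace ℝ (Fin n)) M]

local notation "𝔼" => EuclideanSpace ℝ (Fin n)

/-- The derivative at `y` of the transition map from the preferred chart at `x₁` to the preferred
chart at `x₀`. -/
noncomputable def transitionDeriv (x₀ x₁ : M) (y : EuclideanSpace ℝ (Fin n)) :
    EuclideanSpace ℝ (Fin n) →L[ℝ] EuclideanSpace ℝ (Fin n) :=
  (show EuclideanSpace ℝ (Fin n) →L[ℝ] EuclideanSpace ℝ (Fin n) from
    mfderiv (𝓡 n) (𝓡 n) (chartAt (EuclideanSpace ℝ (Fin n)) x₀)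
      ((chartAt (EuclideanSpace ℝ (Fin n)) x₁).symm y)).comp
  (show EuclideanSpace ℝ (Fin n) →L[ℝ] EuclideanSpace ℝ (Fin n) from
    mfderiv (𝓡 n) (𝓡 n) (chartAt (EuclideanSpace ℝ (Fin n)) x₁).symm y)

theorem hasFDerivAt_transition [IsManifold (𝓡 n) 1 M] (x₀ x₁ : M) {y : 𝔼}
    (hy : y ∈ (chartAt 𝔼 x₁).target) (hy' : (chartAt 𝔼 x₁).symm y ∈ (chartAt 𝔼 x₀).source) :
    HasFDerivAt (fun z => chartAt 𝔼 x₀ ((chartAt 𝔼 x₁).symm z)) (transitionDeriv x₀ x₁ y) y := by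
  have h1 := ((mdifferentiable_chart (I := 𝓡 n) x₀).mdifferentiableAt hy').hasMFDerivAt
  have h2 := ((mdifferentiable_chart (I := 𝓡 n) x₁).mdifferentiableAt_symm hy).hasMFDerivAt
  exact (h1.comp y h2).hasFDerivAt

variable [RiemannianBundle (fun x : M => TangentSpace (𝓡 n) x)]

/-- The coordinate metric as a bilinear form. -/
noncomputable def coordMetricForm (x₀ : M) (y : EuclideanSpace ℝ (Fin n)) :
    LinearMap.BilinForm ℝ (EuclideanSpace ℝ (Fin n)) :=
  LinearMap.mk₂ ℝ (coordMetric x₀ y)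
    (fun v v' w => by simp only [coordMetric]; exact
      (congrArg (fun z => inner ℝ z _) (map_add _ v v')).trans (inner_add_left _ _ _))
    (fun c v w => by simp only [coordMetric]; exact
      (congrArg (fun z => inner ℝ z _) (map_smul _ c v)).trans (real_inner_smul_left _ _ _))
    (fun v w w' => by simp only [coordMetric]; exact
      (congrArg (fun z => inner ℝ _ z) (map_add _ w w')).trans (inner_add_right _ _ _))
    (fun c v w => by simp only [coordMetric]; exact
      (congrArg (fun z => inner ℝ _ z) (map_smul _ c w)).trans (real_inner_smul_right _ _ _))

theorem density_eq (x₀ : M) (y : 𝔼) :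
    density x₀ y = Real.sqrt (LinearMap.BilinForm.toMatrix
      (EuclideanSpace.basisFun (Fin n) ℝ).toBasis (coordMetricForm x₀ y)).det := by
  unfold density
  congr 2

theorem coordMetric_transition [IsManifold (𝓡 n) 1 M] (x₀ x₁ : M) {y : 𝔼}
    (hy' : (chartAt 𝔼 x₁).symm y ∈ (chartAt 𝔼 x₀).source) (v w : 𝔼) :
    coordMetric x₁ y v w = coordMetric x₀ (chartAt 𝔼 x₀ ((chartAt 𝔼 x₁).symm y))
      (transitionDeriv x₀ x₁ y v) (transitionDeriv x₀ x₁ y w) := by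
  -- The inner product depends on the base point, and the two base points agree only
  -- propositionally.
  have key : ∀ (x' x : M), x' = x → ∀ u u' : 𝔼,
      inner ℝ (show TangentSpace (𝓡 n) x from u) (show TangentSpace (𝓡 n) x from u') =
      inner ℝ (show TangentSpace (𝓡 n) x' from u) (show TangentSpace (𝓡 n) x' from u') := by
    rintro _ _ rfl _ _
    rfl
  have h : ∀ v : 𝔼, (show 𝔼 from mfderiv (𝓡 n) (𝓡 n) (chartAt 𝔼 x₀).symm
      (chartAt 𝔼 x₀ ((chartAt 𝔼 x₁).symm y)) (transitionDeriv x₀ x₁ y v)) =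
      mfderiv (𝓡 n) (𝓡 n) (chartAt 𝔼 x₁).symm y v := fun v =>
    mfderiv_chart_symm_chart x₀ hy' (mfderiv (𝓡 n) (𝓡 n) (chartAt 𝔼 x₁).symm y v)
  have e := key _ _ ((chartAt 𝔼 x₀).left_inv hy')
    (mfderiv (𝓡 n) (𝓡 n) (chartAt 𝔼 x₁).symm y v) (mfderiv (𝓡 n) (𝓡 n) (chartAt 𝔼 x₁).symm y w)
  refine e.trans ?_
  rw [← h v, ← h w]
  rfl

/-- Gram matrices transform as `Aᵀ G A`, so the determinant picks up `(det A)²` and its root picks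
up `|det A|`. -/
theorem density_transition [IsManifold (𝓡 n) 1 M] (x₀ x₁ : M) {y : 𝔼}
    (hy' : (chartAt 𝔼 x₁).symm y ∈ (chartAt 𝔼 x₀).source) :
    density x₁ y = |(transitionDeriv x₀ x₁ y).det| *
      density x₀ (chartAt 𝔼 x₀ ((chartAt 𝔼 x₁).symm y)) := by
  set b := (EuclideanSpace.basisFun (Fin n) ℝ).toBasis
  have h : coordMetricForm x₁ y =
      (coordMetricForm x₀ (chartAt 𝔼 x₀ ((chartAt 𝔼 x₁).symm y))).comp
        (transitionDeriv x₀ x₁ y).toLinearMap (transitionDeriv x₀ x₁ y).toLinearMap := by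
    refine LinearMap.ext₂ fun v w => ?_
    exact coordMetric_transition x₀ x₁ hy' v w
  rw [density_eq, density_eq, h, LinearMap.BilinForm.toMatrix_comp b b, Matrix.det_mul,
    Matrix.det_mul, Matrix.det_transpose, LinearMap.det_toMatrix, mul_right_comm,
    Real.sqrt_mul (mul_self_nonneg _), Real.sqrt_mul_self_eq_abs]

variable [MeasurableSpace M] [BorelSpace M]

theorem aemeasurable_chart_symm (x₀ : M) :
    AEMeasurable (chartAt 𝔼 x₀).symm (volume.restrict (chartAt 𝔼 x₀).target) :=
  (chartAt 𝔼 x₀).continuousOn_symm.aemeasurable (chartAt 𝔼 x₀).open_target.measurableSet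

theorem chartVolume_apply (x₀ : M) {A : Set M} (hA : MeasurableSet A) :
    chartVolume (n := n) x₀ A =
      ∫⁻ y in (chartAt 𝔼 x₀).target ∩ (chartAt 𝔼 x₀).symm ⁻¹' A,
        ENNReal.ofReal (density x₀ y) := by
  rw [chartVolume, Measure.map_apply_of_aemeasurable ((aemeasurable_chart_symm x₀).mono_ac
    (withDensity_absolutelyContinuous _ _)) hA, withDensity_apply',
    Measure.restrict_restrict' (chartAt 𝔼 x₀).open_target.measurableSet, Set.inter_comm]

/-- The inverse chart is continuous only on its target, so measurability is obtained on the subtype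
and pushed forward. -/
theorem measurableSet_target_inter_preimage (x₀ : M) {A : Set M} (hA : MeasurableSet A) :
    MeasurableSet ((chartAt 𝔼 x₀).target ∩ (chartAt 𝔼 x₀).symm ⁻¹' A) := by
  have h := (continuousOn_iff_continuous_domRestrict.1
    (chartAt 𝔼 x₀).continuousOn_symm).measurable hA
  have := (MeasurableEmbedding.subtype_coe
    (chartAt 𝔼 x₀).open_target.measurableSet).measurableSet_image.2 h
  convert this using 1
  ext y
  simp [and_comm]

/-- Change of variables along the transition map: its Jacobian is precisely the factor in
`density_transition`. -/
theorem chartVolume_eq_of_subset [IsManifold (𝓡 n) 1 M] (x₀ x₁ : M) {A : Set M}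
    (hA : MeasurableSet A) (h₀ : A ⊆ (chartAt 𝔼 x₀).source) (h₁ : A ⊆ (chartAt 𝔼 x₁).source) :
    chartVolume (n := n) x₁ A = chartVolume (n := n) x₀ A := by
  rw [chartVolume_apply x₁ hA, chartVolume_apply x₀ hA]
  have himg : (chartAt 𝔼 x₀).target ∩ (chartAt 𝔼 x₀).symm ⁻¹' A =
      (fun z => chartAt 𝔼 x₀ ((chartAt 𝔼 x₁).symm z)) ''
        ((chartAt 𝔼 x₁).target ∩ (chartAt 𝔼 x₁).symm ⁻¹' A) := by
    ext z
    constructor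
    · rintro ⟨hz, hzA⟩
      refine ⟨chartAt 𝔼 x₁ ((chartAt 𝔼 x₀).symm z), ⟨(chartAt 𝔼 x₁).map_source (h₁ hzA), ?_⟩, ?_⟩
      · simpa [(chartAt 𝔼 x₁).left_inv (h₁ hzA)] using hzA
      · simp only [(chartAt 𝔼 x₁).left_inv (h₁ hzA), (chartAt 𝔼 x₀).right_inv hz]
    · rintro ⟨y, ⟨hy, hyA⟩, rfl⟩
      refine ⟨(chartAt 𝔼 x₀).map_source (h₀ hyA), ?_⟩
      simpa [(chartAt 𝔼 x₀).left_inv (h₀ hyA)] using hyA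
  rw [himg, lintegral_image_eq_lintegral_abs_det_fderiv_mul volume
    (measurableSet_target_inter_preimage x₁ hA)
    (fun y hy => (hasFDerivAt_transition x₀ x₁ hy.1 (h₀ hy.2)).hasFDerivWithinAt)]
  · refine setLIntegral_congr_fun (measurableSet_target_inter_preimage x₁ hA) fun y hy => ?_
    rw [← ENNReal.ofReal_mul (abs_nonneg _), density_transition x₀ x₁ (h₀ hy.2)]
  · rintro y ⟨hy, hyA⟩ z ⟨hz, hzA⟩ h
    have := (chartAt 𝔼 x₀).injOn (h₀ hyA) (h₀ hzA) h
    exact (chartAt 𝔼 x₁).symm.injOn hy hz this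

theorem chartVolume_compl_source (x₀ : M) {A : Set M} (hA : MeasurableSet A)
    (h : Disjoint A (chartAt 𝔼 x₀).source) : chartVolume (n := n) x₀ A = 0 := by
  rw [chartVolume_apply x₀ hA]
  have : (chartAt 𝔼 x₀).target ∩ (chartAt 𝔼 x₀).symm ⁻¹' A = ∅ := by
    ext y
    simp only [Set.mem_inter_iff, Set.mem_preimage, Set.mem_empty_iff_false, iff_false, not_and]
    exact fun hy hyA => Set.disjoint_left.1 h hyA ((chartAt 𝔼 x₀).map_target hy)
  simp [this]

/-- A supremum of measures is not computed set by set, so the upper bound has to come from one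
measure that dominates every chart measure. -/
theorem riemVolume_apply_of_subset [IsManifold (𝓡 n) 1 M] (x₀ : M) {A : Set M}
    (hA : MeasurableSet A) (h₀ : A ⊆ (chartAt 𝔼 x₀).source) :
    riemVolume n M A = chartVolume (n := n) x₀ A := by
  have hs : MeasurableSet (chartAt 𝔼 x₀).source := (chartAt 𝔼 x₀).open_source.measurableSet
  refine le_antisymm ?_ (le_iSup (fun x : M => chartVolume (n := n) x) x₀ A)
  -- The dominating measure. Inside the chart at `x₀`, another chart measure either agrees with that
  -- of `x₀` or lives off its own source and is zero. Outside, `riemVolume` dominates it by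
  -- definition.
  have hle : riemVolume n M ≤ chartVolume (n := n) x₀ +
      (riemVolume n M).restrict (chartAt 𝔼 x₀).sourceᶜ := by
    refine iSup_le fun x => Measure.le_iff.2 fun T hT => ?_
    rw [← measure_inter_add_sdiff T hs, Measure.add_apply, Measure.restrict_apply hT]
    refine add_le_add ?_ (le_iSup (fun x : M => chartVolume (n := n) x) x _)
    have hx : MeasurableSet (chartAt 𝔼 x).source := (chartAt 𝔼 x).open_source.measurableSet
    rw [← measure_inter_add_sdiff (T ∩ _) hx,
      chartVolume_compl_source x ((hT.inter hs).diff hx) Set.disjoint_sdiff_left, add_zero,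
      chartVolume_eq_of_subset x₀ x ((hT.inter hs).inter hx)
        (fun z hz => hz.1.2) Set.inter_subset_right]
    exact measure_mono fun z hz => hz.1.1
  refine (hle A).trans ?_
  rw [Measure.add_apply, Measure.restrict_apply hA,
    show A ∩ (chartAt 𝔼 x₀).sourceᶜ = ∅ from Set.sdiff_eq_empty.2 h₀]
  simp

variable [IsManifold (𝓡 n) 3 M]
  [IsContMDiffRiemannianBundle (𝓡 n) 2 (EuclideanSpace ℝ (Fin n))
    (fun x : M => TangentSpace (𝓡 n) x)]

theorem aemeasurable_density (x₀ : M) :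
    AEMeasurable (fun y => ENNReal.ofReal (density x₀ y))
      (volume.restrict (chartAt 𝔼 x₀).target) :=
  ((contDiffOn_density x₀).continuousOn.aemeasurable
    (chartAt 𝔼 x₀).open_target.measurableSet).ennreal_ofReal

instance isLocallyFiniteMeasure_riemVolume : IsLocallyFiniteMeasure (riemVolume n M) := by
  refine ⟨fun x => ?_⟩
  obtain ⟨K, hK, hxK, hKt⟩ := exists_compact_subset (chartAt 𝔼 x).open_target
    (mem_chart_target 𝔼 x)
  let O : Set M := (chartAt 𝔼 x).source ∩ chartAt 𝔼 x ⁻¹' interior K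
  have hO : IsOpen O := (chartAt 𝔼 x).isOpen_inter_preimage isOpen_interior
  refine ⟨O, hO.mem_nhds ⟨mem_chart_source 𝔼 x, hxK⟩, ?_⟩
  rw [riemVolume_apply_of_subset x hO.measurableSet Set.inter_subset_left,
    chartVolume_apply x hO.measurableSet]
  have hsub : (chartAt 𝔼 x).target ∩ (chartAt 𝔼 x).symm ⁻¹' O ⊆ K := by
    rintro y ⟨hy, -, hyK⟩
    rw [Set.mem_preimage, (chartAt 𝔼 x).right_inv hy] at hyK
    exact interior_subset hyK
  refine (lintegral_mono_set hsub).trans_lt ?_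
  obtain ⟨C, hC⟩ := hK.exists_bound_of_continuousOn ((contDiffOn_density x).continuousOn.mono hKt)
  calc ∫⁻ y in K, ENNReal.ofReal (density x y) ≤ ∫⁻ _ in K, ENNReal.ofReal C := by
        refine setLIntegral_mono measurable_const fun y hy => ENNReal.ofReal_le_ofReal ?_
        exact (le_abs_self _).trans (hC y hy)
    _ < ⊤ := by
        rw [setLIntegral_const]
        exact ENNReal.mul_lt_top ENNReal.ofReal_lt_top hK.measure_lt_top

/-- A nonempty open set contains, in a chart, a nonempty open set of positive Lebesgue measure on
which the density is positive. This is used to separate continuous functions by their integrals. -/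
instance isOpenPosMeasure_riemVolume : (riemVolume n M).IsOpenPosMeasure := by
  refine ⟨fun O hO ⟨x, hx⟩ h0 => ?_⟩
  have hO' : IsOpen (O ∩ (chartAt 𝔼 x).source) := hO.inter (chartAt 𝔼 x).open_source
  have h1 : riemVolume n M (O ∩ (chartAt 𝔼 x).source) = 0 :=
    measure_mono_null Set.inter_subset_left h0
  rw [riemVolume_apply_of_subset x hO'.measurableSet Set.inter_subset_right,
    chartVolume_apply x hO'.measurableSet] at h1
  have hopen : IsOpen ((chartAt 𝔼 x).target ∩ (chartAt 𝔼 x).symm ⁻¹'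
    (O ∩ (chartAt 𝔼 x).source)) := (chartAt 𝔼 x).symm.isOpen_inter_preimage hO'
  rw [setLIntegral_eq_zero_iff' hopen.measurableSet
    ((aemeasurable_density x).mono_measure (Measure.restrict_mono Set.inter_subset_left le_rfl))]
    at h1
  have h2 : volume ((chartAt 𝔼 x).target ∩ (chartAt 𝔼 x).symm ⁻¹'
      (O ∩ (chartAt 𝔼 x).source)) = 0 := by
    refine measure_mono_null (fun y hy => ?_) (ae_iff.1 h1)
    simp only [Set.mem_ofPred_eq, Classical.not_imp]
    exact ⟨hy, (ENNReal.ofReal_pos.2 (density_pos x hy.1)).ne'⟩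
  refine (hopen.measure_pos volume ⟨chartAt 𝔼 x x, mem_chart_target 𝔼 x, ?_⟩).ne' h2
  simp [hx]

/-- Integrals, integrability and almost-everywhere statements are carried to coordinates through
this equality of measures. -/
theorem riemVolume_restrict_eq_map (x₀ : M) {A : Set M} (hA : MeasurableSet A)
    (h₀ : A ⊆ (chartAt 𝔼 x₀).source) :
    (riemVolume n M).restrict A =
      Measure.map (chartAt 𝔼 x₀).symm
        ((volume.restrict ((chartAt 𝔼 x₀).target ∩ (chartAt 𝔼 x₀).symm ⁻¹' A)).withDensity
          fun y => ENNReal.ofReal (density x₀ y)) := by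
  ext T hT
  have hac : AEMeasurable (chartAt 𝔼 x₀).symm
      ((volume.restrict ((chartAt 𝔼 x₀).target ∩ (chartAt 𝔼 x₀).symm ⁻¹' A)).withDensity
          fun y => ENNReal.ofReal (density x₀ y)) :=
    ((aemeasurable_chart_symm x₀).mono_measure
      (Measure.restrict_mono Set.inter_subset_left le_rfl)).mono_ac
      (withDensity_absolutelyContinuous _ _)
  rw [Measure.restrict_apply hT, riemVolume_apply_of_subset x₀ (hT.inter hA)
    (Set.inter_subset_right.trans h₀), chartVolume_apply x₀ (hT.inter hA),
    Measure.map_apply_of_aemeasurable hac hT, withDensity_apply',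
    Measure.restrict_restrict' (measurableSet_target_inter_preimage x₀ hA)]
  congr 2
  ext y
  simp only [Set.mem_inter_iff, Set.mem_preimage]
  tauto

variable {G : Type*} [NormedAddCommGroup G] [NormedSpace ℝ G]

theorem setIntegral_riemVolume_chart (x₀ : M) {A : Set M} (hA : MeasurableSet A)
    (h₀ : A ⊆ (chartAt 𝔼 x₀).source) {F : M → G}
    (hF : AEStronglyMeasurable F ((riemVolume n M).restrict A)) :
    ∫ x in A, F x ∂(riemVolume n M) =
      ∫ y in (chartAt 𝔼 x₀).target ∩ (chartAt 𝔼 x₀).symm ⁻¹' A,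
        density x₀ y • F ((chartAt 𝔼 x₀).symm y) := by
  have hac : AEMeasurable (chartAt 𝔼 x₀).symm
      ((volume.restrict ((chartAt 𝔼 x₀).target ∩ (chartAt 𝔼 x₀).symm ⁻¹' A)).withDensity
          fun y => ENNReal.ofReal (density x₀ y)) :=
    ((aemeasurable_chart_symm x₀).mono_measure
      (Measure.restrict_mono Set.inter_subset_left le_rfl)).mono_ac
      (withDensity_absolutelyContinuous _ _)
  rw [riemVolume_restrict_eq_map x₀ hA h₀] at hF ⊢
  rw [integral_map hac hF, integral_withDensity_eq_integral_toReal_smul₀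
    ((aemeasurable_density x₀).mono_measure (Measure.restrict_mono Set.inter_subset_left le_rfl))
    (by simp)]
  refine setIntegral_congr_fun (measurableSet_target_inter_preimage x₀ hA) fun y hy => ?_
  simp only [ENNReal.toReal_ofReal (density_pos x₀ hy.1).le]

theorem integrableOn_riemVolume_chart (x₀ : M) {A : Set M} (hA : MeasurableSet A)
    (h₀ : A ⊆ (chartAt 𝔼 x₀).source) {F : M → G}
    (hF : IntegrableOn F A (riemVolume n M)) :
    IntegrableOn (fun y => density x₀ y • F ((chartAt 𝔼 x₀).symm y))
      ((chartAt 𝔼 x₀).target ∩ (chartAt 𝔼 x₀).symm ⁻¹' A) := by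
  have hac : AEMeasurable (chartAt 𝔼 x₀).symm
      ((volume.restrict ((chartAt 𝔼 x₀).target ∩ (chartAt 𝔼 x₀).symm ⁻¹' A)).withDensity
          fun y => ENNReal.ofReal (density x₀ y)) :=
    ((aemeasurable_chart_symm x₀).mono_measure
      (Measure.restrict_mono Set.inter_subset_left le_rfl)).mono_ac
      (withDensity_absolutelyContinuous _ _)
  rw [IntegrableOn, riemVolume_restrict_eq_map x₀ hA h₀] at hF
  have h1 := (integrable_map_measure hF.1 hac).1 hF
  rw [integrable_withDensity_iff_integrable_smul₀'
    ((aemeasurable_density x₀).mono_measure (Measure.restrict_mono Set.inter_subset_left le_rfl))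
    (by simp)] at h1
  refine h1.congr (ae_restrict_of_forall_mem (measurableSet_target_inter_preimage x₀ hA)
    fun y hy => ?_)
  simp only [ENNReal.toReal_ofReal (density_pos x₀ hy.1).le, Function.comp]

theorem ae_restrict_riemVolume_of_chart (x₀ : M) {A : Set M} (hA : MeasurableSet A)
    (h₀ : A ⊆ (chartAt 𝔼 x₀).source) {P : M → Prop} (hP : NullMeasurableSet {x | ¬ P x}
      ((riemVolume n M).restrict A))
    (h : ∀ᵐ y ∂(volume : Measure 𝔼),
      y ∈ (chartAt 𝔼 x₀).target ∩ (chartAt 𝔼 x₀).symm ⁻¹' A → P ((chartAt 𝔼 x₀).symm y)) :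
    ∀ᵐ x ∂((riemVolume n M).restrict A), P x := by
  have hac : AEMeasurable (chartAt 𝔼 x₀).symm
      ((volume.restrict ((chartAt 𝔼 x₀).target ∩ (chartAt 𝔼 x₀).symm ⁻¹' A)).withDensity
          fun y => ENNReal.ofReal (density x₀ y)) :=
    ((aemeasurable_chart_symm x₀).mono_measure
      (Measure.restrict_mono Set.inter_subset_left le_rfl)).mono_ac
      (withDensity_absolutelyContinuous _ _)
  rw [riemVolume_restrict_eq_map x₀ hA h₀] at hP ⊢
  rw [ae_iff, Measure.map_apply₀ hac hP]
  refine withDensity_absolutelyContinuous _ _ ?_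
  exact ae_iff.1 ((ae_restrict_iff' (measurableSet_target_inter_preimage x₀ hA)).2 h)

end Volume

/-! ### Moving functions with compact support between the manifold and a chart; derivatives along a
field. -/

section Localization

variable {n : ℕ} {M : Type*} [TopologicalSpace M] [ChartedSpace (EuclideanSpace ℝ (Fin n)) M]
  {F : Type*} [NormedAddCommGroup F] [NormedSpace ℝ F]

local notation "𝔼" => EuclideanSpace ℝ (Fin n)

/-- The representative of a function in the preferred chart at `x₀`, extended by zero. -/
noncomputable def toChart (x₀ : M) (g : M → F) : EuclideanSpace ℝ (Fin n) → F :=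
  (chartAt (EuclideanSpace ℝ (Fin n)) x₀).target.indicator
    fun y => g ((chartAt (EuclideanSpace ℝ (Fin n)) x₀).symm y)

/-- The function on the manifold with a given representative in the preferred chart at `x₀`,
extended by zero. -/
noncomputable def ofChart (x₀ : M) (u : EuclideanSpace ℝ (Fin n) → F) : M → F :=
  (chartAt (EuclideanSpace ℝ (Fin n)) x₀).source.indicator
    fun x => u (chartAt (EuclideanSpace ℝ (Fin n)) x₀ x)

theorem toChart_of_mem (x₀ : M) (g : M → F) {y : 𝔼} (hy : y ∈ (chartAt 𝔼 x₀).target) :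
    toChart x₀ g y = g ((chartAt 𝔼 x₀).symm y) := Set.indicator_of_mem hy _

theorem ofChart_of_mem (x₀ : M) (u : 𝔼 → F) {x : M} (hx : x ∈ (chartAt 𝔼 x₀).source) :
    ofChart x₀ u x = u (chartAt 𝔼 x₀ x) := Set.indicator_of_mem hx _

theorem tsupport_toChart_subset_image (x₀ : M) {g : M → F} (hg : HasCompactSupport g)
    (hs : tsupport g ⊆ (chartAt 𝔼 x₀).source) :
    IsCompact (chartAt 𝔼 x₀ '' tsupport g) ∧
      tsupport (toChart (n := n) x₀ g) ⊆ chartAt 𝔼 x₀ '' tsupport g := by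
  have hK : IsCompact (chartAt 𝔼 x₀ '' tsupport g) :=
    hg.isCompact.image_of_continuousOn ((chartAt 𝔼 x₀).continuousOn.mono hs)
  refine ⟨hK, closure_minimal (fun y hy => ?_) hK.isClosed⟩
  have hyt : y ∈ (chartAt 𝔼 x₀).target := Set.support_indicator_subset hy
  rw [Function.mem_support, toChart_of_mem x₀ g hyt] at hy
  exact ⟨_, subset_tsupport _ hy, (chartAt 𝔼 x₀).right_inv hyt⟩

theorem hasCompactSupport_toChart (x₀ : M) {g : M → F} (hg : HasCompactSupport g)
    (hs : tsupport g ⊆ (chartAt 𝔼 x₀).source) : HasCompactSupport (toChart (n := n) x₀ g) :=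
  (tsupport_toChart_subset_image x₀ hg hs).1.of_isClosed_subset (isClosed_tsupport _)
    (tsupport_toChart_subset_image x₀ hg hs).2

theorem tsupport_toChart_subset (x₀ : M) {g : M → F} (hg : HasCompactSupport g) {A : Set M}
    (hs : tsupport g ⊆ (chartAt 𝔼 x₀).source ∩ A) :
    tsupport (toChart (n := n) x₀ g) ⊆ (chartAt 𝔼 x₀).target ∩ (chartAt 𝔼 x₀).symm ⁻¹' A := by
  have hs' := hs.trans Set.inter_subset_left
  refine (tsupport_toChart_subset_image x₀ hg hs').2.trans ?_
  rintro _ ⟨x, hx, rfl⟩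
  refine ⟨(chartAt 𝔼 x₀).map_source (hs' hx), ?_⟩
  rw [Set.mem_preimage, (chartAt 𝔼 x₀).left_inv (hs' hx)]
  exact (hs hx).2

/-- Smoothness of an extension by zero need only be checked on the topological support, which lies
in the open chart target. -/
theorem contDiff_toChart {k : ℕ∞ω} [IsManifold (𝓡 n) k M] (x₀ : M) {g : M → F}
    (hgk : ContMDiff (𝓡 n) 𝓘(ℝ, F) k g) (hg : HasCompactSupport g)
    (hs : tsupport g ⊆ (chartAt 𝔼 x₀).source) : ContDiff ℝ k (toChart (n := n) x₀ g) := by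
  rw [← contMDiff_iff_contDiff]
  refine contMDiff_of_tsupport fun y hy => ?_
  obtain ⟨x, hx, rfl⟩ := (tsupport_toChart_subset_image x₀ hg hs).2 hy
  have h1 := contDiffOn_chart_symm_comp x₀ hgk.contMDiffOn (s := Set.univ)
  have ht : chartAt 𝔼 x₀ x ∈ (chartAt 𝔼 x₀).target := (chartAt 𝔼 x₀).map_source (hs hx)
  have hn := (chartAt 𝔼 x₀).open_target.mem_nhds ht
  have h2 := (h1.mono fun z hz => ⟨hz, trivial⟩).contDiffAt hn
  refine (h2.congr_of_eventuallyEq ?_).contMDiffAt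
  filter_upwards [hn] with z hz using toChart_of_mem x₀ g hz

/-- The Hausdorff property is what makes the compact image closed, so that it contains the closure
of the support. -/
theorem tsupport_ofChart_subset_image [T2Space M] (x₀ : M) {u : 𝔼 → F} (hu : HasCompactSupport u)
    (hs : tsupport u ⊆ (chartAt 𝔼 x₀).target) :
    IsCompact ((chartAt 𝔼 x₀).symm '' tsupport u) ∧
      tsupport (ofChart x₀ u) ⊆ (chartAt 𝔼 x₀).symm '' tsupport u := by
  have hK : IsCompact ((chartAt 𝔼 x₀).symm '' tsupport u) :=
    hu.isCompact.image_of_continuousOn ((chartAt 𝔼 x₀).continuousOn_symm.mono hs)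
  refine ⟨hK, closure_minimal (fun x hx => ?_) hK.isClosed⟩
  have hxt : x ∈ (chartAt 𝔼 x₀).source := Set.support_indicator_subset hx
  rw [Function.mem_support, ofChart_of_mem x₀ u hxt] at hx
  exact ⟨_, subset_tsupport _ hx, (chartAt 𝔼 x₀).left_inv hxt⟩

theorem hasCompactSupport_ofChart [T2Space M] (x₀ : M) {u : 𝔼 → F} (hu : HasCompactSupport u)
    (hs : tsupport u ⊆ (chartAt 𝔼 x₀).target) : HasCompactSupport (ofChart x₀ u) :=
  (tsupport_ofChart_subset_image x₀ hu hs).1.of_isClosed_subset (isClosed_tsupport _)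
    (tsupport_ofChart_subset_image x₀ hu hs).2

theorem tsupport_ofChart_subset [T2Space M] (x₀ : M) {u : 𝔼 → F} (hu : HasCompactSupport u)
    {A : Set M} (hs : tsupport u ⊆ (chartAt 𝔼 x₀).target ∩ (chartAt 𝔼 x₀).symm ⁻¹' A) :
    tsupport (ofChart x₀ u) ⊆ (chartAt 𝔼 x₀).source ∩ A := by
  refine (tsupport_ofChart_subset_image x₀ hu (hs.trans Set.inter_subset_left)).2.trans ?_
  rintro _ ⟨y, hy, rfl⟩
  exact ⟨(chartAt 𝔼 x₀).map_target (hs hy).1, (hs hy).2⟩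

theorem contMDiff_ofChart [T2Space M] {k : ℕ∞ω} [IsManifold (𝓡 n) k M] (x₀ : M) {u : 𝔼 → F}
    (huk : ContDiff ℝ k u) (hu : HasCompactSupport u)
    (hs : tsupport u ⊆ (chartAt 𝔼 x₀).target) :
    ContMDiff (𝓡 n) 𝓘(ℝ, F) k (ofChart x₀ u) := by
  refine contMDiff_of_tsupport fun x hx => ?_
  obtain ⟨y, hy, rfl⟩ := (tsupport_ofChart_subset_image x₀ hu hs).2 hx
  have ht : (chartAt 𝔼 x₀).symm y ∈ (chartAt 𝔼 x₀).source := (chartAt 𝔼 x₀).map_target (hs hy)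
  have hn := (chartAt 𝔼 x₀).open_source.mem_nhds ht
  have h : ContMDiffOn (𝓡 n) (𝓡 n) k (chartAt 𝔼 x₀) (chartAt 𝔼 x₀).source := contMDiffOn_chart
  have h2 := huk.contMDiff.comp_contMDiffOn h
  refine (h2.contMDiffAt hn).congr_of_eventuallyEq ?_
  filter_upwards [hn] with z hz using ofChart_of_mem x₀ u hz

/-- The derivative `X g` of a function along a vector field. -/
noncomputable def fieldDeriv (X : ∀ x : M, TangentSpace (𝓡 n) x) (g : M → F) (x : M) : F :=
  mfderiv (𝓡 n) 𝓘(ℝ, F) g x (X x)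

/-- The chain rule that turns `X g` into `Xⁱ ∂ᵢ g`. Every later rule for `fieldDeriv` is reduced to
ordinary calculus through it. -/
theorem fderiv_chart_symm_comp_coordField [IsManifold (𝓡 n) 1 M] (x₀ : M) {g : M → F}
    (X : ∀ x : M, TangentSpace (𝓡 n) x) {y : 𝔼} (hy : y ∈ (chartAt 𝔼 x₀).target)
    (hg : MDifferentiableAt (𝓡 n) 𝓘(ℝ, F) g ((chartAt 𝔼 x₀).symm y)) :
    fderiv ℝ (fun z => g ((chartAt 𝔼 x₀).symm z)) y (coordField X x₀ y) =
      fieldDeriv X g ((chartAt 𝔼 x₀).symm y) := by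
  have h2 := ((mdifferentiable_chart (I := 𝓡 n) x₀).mdifferentiableAt_symm hy).hasMFDerivAt
  let Lg : 𝔼 →L[ℝ] F := mfderiv (𝓡 n) 𝓘(ℝ, F) g ((chartAt 𝔼 x₀).symm y)
  let Ls : 𝔼 →L[ℝ] 𝔼 := mfderiv (𝓡 n) (𝓡 n) (chartAt 𝔼 x₀).symm y
  have h3 : HasFDerivAt (fun z => g ((chartAt 𝔼 x₀).symm z)) (Lg.comp Ls) y :=
    (hg.hasMFDerivAt.comp y h2).hasFDerivAt
  have key : ∀ z, z = y → ∀ w : 𝔼, (show 𝔼 from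
      mfderiv (𝓡 n) (𝓡 n) (chartAt 𝔼 x₀).symm z w) =
      mfderiv (𝓡 n) (𝓡 n) (chartAt 𝔼 x₀).symm y w := by
    rintro _ rfl _
    rfl
  have h4 : (show 𝔼 from mfderiv (𝓡 n) (𝓡 n) (chartAt 𝔼 x₀).symm y (coordField X x₀ y)) =
      X ((chartAt 𝔼 x₀).symm y) :=
    (key _ ((chartAt 𝔼 x₀).right_inv hy) _).symm.trans
      (mfderiv_chart_symm_chart x₀ ((chartAt 𝔼 x₀).map_target hy) _)
  have h5 := DFunLike.congr_fun h3.fderiv (coordField X x₀ y)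
  refine h5.trans ?_
  exact congrArg (fun v => mfderiv (𝓡 n) 𝓘(ℝ, F) g ((chartAt 𝔼 x₀).symm y) v) h4

theorem continuousOn_of_chart {h : M → F} {W : Set M} (hW : IsOpen W)
    (hc : ∀ x₀ : M, ContinuousOn (fun y : 𝔼 => h ((chartAt 𝔼 x₀).symm y))
      ((chartAt 𝔼 x₀).target ∩ (chartAt 𝔼 x₀).symm ⁻¹' W)) : ContinuousOn h W := by
  intro x hx
  have hs := (chartAt 𝔼 x).open_source.mem_nhds (mem_chart_source 𝔼 x)
  have hxs := mem_chart_source 𝔼 x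
  have ht : chartAt 𝔼 x x ∈ (chartAt 𝔼 x).target ∩ (chartAt 𝔼 x).symm ⁻¹' W :=
    ⟨mem_chart_target 𝔼 x, by rwa [Set.mem_preimage, (chartAt 𝔼 x).left_inv hxs]⟩
  have h1 := (hc x).continuousAt (((chartAt 𝔼 x).symm.isOpen_inter_preimage hW).mem_nhds ht)
  have h2 : ContinuousAt (fun z => h ((chartAt 𝔼 x).symm (chartAt 𝔼 x z))) x :=
    ContinuousAt.comp (f := chartAt 𝔼 x) h1 ((chartAt 𝔼 x).continuousAt hxs)
  refine (h2.congr ?_).continuousWithinAt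
  filter_upwards [hs] with z hz
  rw [(chartAt 𝔼 x).left_inv hz]

variable [IsManifold (𝓡 n) 3 M]

theorem continuousOn_fieldDeriv {X : ∀ x : M, TangentSpace (𝓡 n) x} {U W : Set M}
    (hU : IsOpen U) (hW : IsOpen W)
    (hX : ContMDiffOn (𝓡 n) (𝓡 n).tangent 2 (fun x => (⟨x, X x⟩ : TangentBundle (𝓡 n) M)) U)
    {g : M → F} (hg : ContMDiffOn (𝓡 n) 𝓘(ℝ, F) 1 g W) (hWU : W ⊆ U) :
    ContinuousOn (fun x => fieldDeriv X g x) W := by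
  refine continuousOn_of_chart (n := n) hW fun x₀ => ?_
  have hopen : IsOpen ((chartAt 𝔼 x₀).target ∩ (chartAt 𝔼 x₀).symm ⁻¹' W) :=
    (chartAt 𝔼 x₀).symm.isOpen_inter_preimage hW
  have h1 := (contDiffOn_chart_symm_comp x₀ hg).continuousOn_fderiv_of_isOpen hopen le_rfl
  have h2 := (contDiffOn_coordField hU hX x₀).continuousOn.mono
    (Set.inter_subset_inter_right (chartAt 𝔼 x₀).target (Set.preimage_mono hWU))
  refine (h1.clm_apply h2).congr fun y hy => ?_
  refine (fderiv_chart_symm_comp_coordField x₀ X hy.1 ?_).symm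
  exact ((hg.contMDiffAt (hW.mem_nhds hy.2)).mdifferentiableAt one_ne_zero)

end Localization

/-! ### The divergence theorem in a single chart. -/

section Calculus

/-- The coefficient may be arbitrary off `T`: the product is continuous because continuity is needed
only on the topological support of `h`. -/
theorem integrable_smul_of_continuousOn {E F : Type*} [TopologicalSpace E] [MeasurableSpace E]
    [OpensMeasurableSpace E] {μ : Measure E} [IsFiniteMeasureOnCompacts μ]
    [NormedAddCommGroup F] [NormedSpace ℝ F]
    {T : Set E} (hT : IsOpen T) {f : E → ℝ} (hf : ContinuousOn f T) {h : E → F}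
    (hh : Continuous h) (hc : HasCompactSupport h) (hs : tsupport h ⊆ T) :
    Integrable (fun x => f x • h x) μ := by
  refine Continuous.integrable_of_hasCompactSupport ?_ hc.smul_left
  refine continuous_of_tsupport fun x hx => ?_
  have hx' : x ∈ T := hs (tsupport_smul_subset_right f h hx)
  exact (hf.continuousAt (hT.mem_nhds hx')).smul hh.continuousAt

end Calculus

section IntegrationByParts

variable {n : ℕ} {M : Type*} [TopologicalSpace M] [ChartedSpace (EuclideanSpace ℝ (Fin n)) M]
  {F : Type*} [NormedAddCommGroup F] [NormedSpace ℝ F]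

local notation "𝔼" => EuclideanSpace ℝ (Fin n)

variable [RiemannianBundle (fun x : M => TangentSpace (𝓡 n) x)]

/-- The divergence of a vector field computed in the preferred chart at `x₀`. -/
noncomputable def chartDivergence (X : ∀ x : M, TangentSpace (𝓡 n) x) (x₀ : M)
    (y : EuclideanSpace ℝ (Fin n)) : ℝ :=
  (density x₀ y)⁻¹ * ∑ i : Fin n,
    fderiv ℝ (fun z : EuclideanSpace ℝ (Fin n) => density x₀ z * coordField X x₀ z i)
      y (stdVec n i)

variable [IsManifold (𝓡 n) 3 M]
  [IsContMDiffRiemannianBundle (𝓡 n) 2 (EuclideanSpace ℝ (Fin n))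
    (fun x : M => TangentSpace (𝓡 n) x)]
  {X : ∀ x : M, TangentSpace (𝓡 n) x} {U : Set M}

theorem contDiffOn_density_mul_coordField (hU : IsOpen U)
    (hX : ContMDiffOn (𝓡 n) (𝓡 n).tangent 2 (fun x => (⟨x, X x⟩ : TangentBundle (𝓡 n) M)) U)
    (x₀ : M) (i : Fin n) :
    ContDiffOn ℝ 2 (fun z : 𝔼 => density x₀ z * coordField X x₀ z i)
      ((chartAt 𝔼 x₀).target ∩ (chartAt 𝔼 x₀).symm ⁻¹' U) :=
  ((contDiffOn_density x₀).mono Set.inter_subset_left).mul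
    ((contDiffOn_euclidean.1 (contDiffOn_coordField hU hX x₀)) i)

theorem contDiffOn_chartDivergence (hU : IsOpen U)
    (hX : ContMDiffOn (𝓡 n) (𝓡 n).tangent 2 (fun x => (⟨x, X x⟩ : TangentBundle (𝓡 n) M)) U)
    (x₀ : M) :
    ContDiffOn ℝ 1 (chartDivergence X x₀)
      ((chartAt 𝔼 x₀).target ∩ (chartAt 𝔼 x₀).symm ⁻¹' U) := by
  have hopen : IsOpen ((chartAt 𝔼 x₀).target ∩ (chartAt 𝔼 x₀).symm ⁻¹' U) :=
    (chartAt 𝔼 x₀).symm.isOpen_inter_preimage hU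
  refine ContDiffOn.mul ?_ (ContDiffOn.sum fun i _ => ?_)
  · exact (((contDiffOn_density x₀).mono Set.inter_subset_left).of_le one_le_two).inv
      fun y hy => (density_pos x₀ hy.1).ne'
  · exact ((contDiffOn_density_mul_coordField hU hX x₀ i).fderiv_of_isOpen hopen
      (by norm_num [one_add_one_eq_two])).clm_apply contDiffOn_const

variable [MeasurableSpace M] [BorelSpace M]

/-- In coordinates this is `∫ √|h| Xⁱ ∂ᵢu = -∫ ∂ᵢ(√|h| Xⁱ) u`, flat integration by parts in each
direction. The fixed chart at `x₀` is essential here, since `divergence` uses a different chart at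
every point. -/
theorem integral_fieldDeriv_eq_of_tsupport_subset_chart [SecondCountableTopology M]
    (hU : IsOpen U)
    (hX : ContMDiffOn (𝓡 n) (𝓡 n).tangent 2 (fun x => (⟨x, X x⟩ : TangentBundle (𝓡 n) M)) U)
    (x₀ : M) {g : M → F} (hg : ContMDiff (𝓡 n) 𝓘(ℝ, F) 1 g) (hc : HasCompactSupport g)
    (hs : tsupport g ⊆ (chartAt 𝔼 x₀).source ∩ U) :
    ∫ x, fieldDeriv X g x ∂(riemVolume n M) =
      - ∫ x, chartDivergence X x₀ (chartAt 𝔼 x₀ x) • g x ∂(riemVolume n M) := by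
  set A := (chartAt 𝔼 x₀).source ∩ U with hAdef
  have hA : IsOpen A := (chartAt 𝔼 x₀).open_source.inter hU
  set T := (chartAt 𝔼 x₀).target ∩ (chartAt 𝔼 x₀).symm ⁻¹' A with hTdef
  have hT : IsOpen T := (chartAt 𝔼 x₀).symm.isOpen_inter_preimage hA
  have hTU : T ⊆ (chartAt 𝔼 x₀).target ∩ (chartAt 𝔼 x₀).symm ⁻¹' U := fun y hy =>
    ⟨hy.1, hy.2.2⟩
  have : IsManifold (𝓡 n) 1 M := inferInstance
  have hgs : tsupport g ⊆ (chartAt 𝔼 x₀).source := hs.trans Set.inter_subset_left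
  set u := toChart (n := n) x₀ g with hu
  have huc : HasCompactSupport u := hasCompactSupport_toChart x₀ hc hgs
  have hu1 : ContDiff ℝ 1 u := contDiff_toChart x₀ hg hc hgs
  have huT : tsupport u ⊆ T := tsupport_toChart_subset x₀ hc (fun x hx => ⟨hgs hx, hs hx⟩)
  have hLout : ∀ x, x ∉ A → fieldDeriv X g x = 0 := by
    intro x hx
    have hx' : x ∉ tsupport g := fun h => hx (hs h)
    have h0 : g =ᶠ[𝓝 x] fun _ => 0 := notMem_tsupport_iff_eventuallyEq.1 hx'
    have h1 : HasMFDerivAt (𝓡 n) 𝓘(ℝ, F) g x 0 :=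
      (hasMFDerivAt_const (0 : F) x).congr_of_eventuallyEq h0
    rw [fieldDeriv, h1.mfderiv]
    rfl
  have hRout : ∀ x, x ∉ A → chartDivergence X x₀ (chartAt 𝔼 x₀ x) • g x = 0 := by
    intro x hx
    have hx' : x ∉ tsupport g := fun h => hx (hs h)
    rw [image_eq_zero_of_notMem_tsupport hx', smul_zero]
  have hLc : ContinuousOn (fun x => fieldDeriv X g x) A :=
    continuousOn_fieldDeriv hU hA hX hg.contMDiffOn Set.inter_subset_right
  have hRc : ContinuousOn (fun x => chartDivergence X x₀ (chartAt 𝔼 x₀ x) • g x) A := by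
    refine ContinuousOn.smul ?_ hg.continuous.continuousOn
    refine (contDiffOn_chartDivergence hU hX x₀).continuousOn.comp
      ((chartAt 𝔼 x₀).continuousOn.mono Set.inter_subset_left) fun x hx => ?_
    exact ⟨(chartAt 𝔼 x₀).map_source hx.1, by
      rw [Set.mem_preimage, (chartAt 𝔼 x₀).left_inv hx.1]; exact hx.2⟩
  rw [← setIntegral_eq_integral_of_forall_compl_eq_zero hLout,
    ← setIntegral_eq_integral_of_forall_compl_eq_zero hRout,
    setIntegral_riemVolume_chart x₀ hA.measurableSet Set.inter_subset_left
      (hLc.aestronglyMeasurable hA.measurableSet),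
    setIntegral_riemVolume_chart x₀ hA.measurableSet Set.inter_subset_left
      (hRc.aestronglyMeasurable hA.measurableSet)]
  have hL : ∀ y ∈ T, density x₀ y • fieldDeriv X g ((chartAt 𝔼 x₀).symm y) =
      ∑ i, (density x₀ y * coordField X x₀ y i) • fderiv ℝ u y (stdVec n i) := by
    intro y hy
    rw [← fderiv_chart_symm_comp_coordField x₀ X hy.1 (hg.mdifferentiableAt one_ne_zero)]
    have he : u =ᶠ[𝓝 y] fun z => g ((chartAt 𝔼 x₀).symm z) := by
      filter_upwards [(chartAt 𝔼 x₀).open_target.mem_nhds hy.1] with z hz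
      exact toChart_of_mem x₀ g hz
    rw [← he.fderiv_eq]
    have hw : coordField X x₀ y = ∑ i, coordField X x₀ y i • stdVec n i := by
      have := (EuclideanSpace.basisFun (Fin n) ℝ).sum_repr (coordField X x₀ y)
      simpa [stdVec] using this.symm
    conv_lhs => rw [hw]
    rw [map_sum, Finset.smul_sum]
    simp only [map_smul, smul_smul]
  -- The volume density cancels the factor `|h|^{-1/2}` of the divergence.
  have hR : ∀ y ∈ T, density x₀ y • (chartDivergence X x₀
      (chartAt 𝔼 x₀ ((chartAt 𝔼 x₀).symm y)) • g ((chartAt 𝔼 x₀).symm y)) =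
      ∑ i, (fderiv ℝ (fun z : 𝔼 => density x₀ z * coordField X x₀ z i) y (stdVec n i)) • u y := by
    intro y hy
    rw [(chartAt 𝔼 x₀).right_inv hy.1, smul_smul, chartDivergence, ← mul_assoc,
      mul_inv_cancel₀ (density_pos x₀ hy.1).ne', one_mul, Finset.sum_smul, hu,
      toChart_of_mem x₀ g hy.1]
  have hdu : Continuous (fderiv ℝ u) := hu1.continuous_fderiv one_ne_zero
  have hdT : ∀ i, tsupport (fun y => fderiv ℝ u y (stdVec n i)) ⊆ T := fun i =>
    (tsupport_fderiv_apply_subset ℝ (stdVec n i)).trans huT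
  have hρ : ∀ i, ContDiffOn ℝ 2 (fun z : 𝔼 => density x₀ z * coordField X x₀ z i) T := fun i =>
    (contDiffOn_density_mul_coordField hU hX x₀ i).mono hTU
  rw [setIntegral_congr_fun hT.measurableSet hL, setIntegral_congr_fun hT.measurableSet hR,
    setIntegral_eq_integral_of_forall_compl_eq_zero (fun y hy => Finset.sum_eq_zero fun i _ => by
      rw [image_eq_zero_of_notMem_tsupport (f := fun y => fderiv ℝ u y (stdVec n i))
        fun h => hy (hdT i h), smul_zero]),
    setIntegral_eq_integral_of_forall_compl_eq_zero (fun y hy => Finset.sum_eq_zero fun i _ => by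
      rw [image_eq_zero_of_notMem_tsupport fun h => hy (huT h), smul_zero])]
  have i1 : ∀ i, Integrable (fun y =>
      (density x₀ y * coordField X x₀ y i) • fderiv ℝ u y (stdVec n i)) := fun i =>
    integrable_smul_of_continuousOn hT (hρ i).continuousOn (hdu.clm_apply continuous_const)
      (huc.fderiv_apply ℝ _) (hdT i)
  have i2 : ∀ i, Integrable (fun y => (fderiv ℝ
      (fun z : 𝔼 => density x₀ z * coordField X x₀ z i) y (stdVec n i)) • u y) := fun i =>
    integrable_smul_of_continuousOn hT
      (((hρ i).continuousOn_fderiv_of_isOpen hT one_le_two).clm_apply continuousOn_const)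
      hu1.continuous huc huT
  rw [integral_finsetSum _ fun i _ => i1 i, integral_finsetSum _ fun i _ => i2 i,
    ← Finset.sum_neg_distrib]
  refine Finset.sum_congr rfl fun i _ => ?_
  -- The coefficient `√|h| Xⁱ` is known to be differentiable only on `T`; the Euclidean formula asks
  -- for this only on the topological support of `u`.
  refine integral_smul_fderiv_eq_neg_fderiv_smul_of_integrable (i2 i) (i1 i)
    (integrable_smul_of_continuousOn hT (hρ i).continuousOn hu1.continuous huc huT)
    (fun y hy => ?_) fun y _ => (hu1.differentiable one_ne_zero) y
  exact ((hρ i).contDiffAt (hT.mem_nhds (huT hy))).differentiableAt two_ne_zero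

end IntegrationByParts

/-! ### Sum, chain and product rules for the derivative along a field. -/

section FieldDeriv

variable {n : ℕ} {M : Type*} [TopologicalSpace M] [ChartedSpace (EuclideanSpace ℝ (Fin n)) M]
  {F : Type*} [NormedAddCommGroup F] [NormedSpace ℝ F]
  {G : Type*} [NormedAddCommGroup G] [NormedSpace ℝ G]
  {X : ∀ x : M, TangentSpace (𝓡 n) x}

local notation "𝔼" => EuclideanSpace ℝ (Fin n)

theorem fieldDeriv_eq_zero_of_notMem_tsupport {g : M → F} {x : M} (hx : x ∉ tsupport g) :
    fieldDeriv X g x = 0 := by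
  have h0 : g =ᶠ[𝓝 x] fun _ => 0 := notMem_tsupport_iff_eventuallyEq.1 hx
  have h1 : HasMFDerivAt (𝓡 n) 𝓘(ℝ, F) g x 0 :=
    (hasMFDerivAt_const (0 : F) x).congr_of_eventuallyEq h0
  rw [fieldDeriv, h1.mfderiv]
  rfl

theorem tsupport_fieldDeriv_subset (g : M → F) : tsupport (fieldDeriv X g) ⊆ tsupport g := by
  refine closure_minimal (fun z hz => ?_) (isClosed_tsupport g)
  by_contra h
  exact hz (fieldDeriv_eq_zero_of_notMem_tsupport h)

variable [IsManifold (𝓡 n) 1 M]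

theorem differentiableAt_comp_chart_symm {g : M → F} {x : M}
    (hg : MDifferentiableAt (𝓡 n) 𝓘(ℝ, F) g x) :
    DifferentiableAt ℝ (fun y => g ((chartAt 𝔼 x).symm y)) (chartAt 𝔼 x x) := by
  have h2 := (mdifferentiable_chart (I := 𝓡 n) x).mdifferentiableAt_symm (mem_chart_target 𝔼 x)
  have hx := (chartAt 𝔼 x).left_inv (mem_chart_source 𝔼 x)
  have hg' : MDifferentiableAt (𝓡 n) 𝓘(ℝ, F) g ((chartAt 𝔼 x).symm (chartAt 𝔼 x x)) := by
    rwa [hx]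
  exact (hg'.comp _ h2).differentiableAt

theorem fieldDeriv_eq_fderiv {g : M → F} {x : M} (hg : MDifferentiableAt (𝓡 n) 𝓘(ℝ, F) g x) :
    fieldDeriv X g x = fderiv ℝ (fun y => g ((chartAt 𝔼 x).symm y)) (chartAt 𝔼 x x)
      (coordField X x (chartAt 𝔼 x x)) := by
  have hx := (chartAt 𝔼 x).left_inv (mem_chart_source 𝔼 x)
  rw [fderiv_chart_symm_comp_coordField x X (mem_chart_target 𝔼 x) (by rwa [hx]), hx]

theorem fieldDeriv_sum {ι : Type*} {s : Finset ι} {g : ι → M → F} {x : M}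
    (hg : ∀ i ∈ s, MDifferentiableAt (𝓡 n) 𝓘(ℝ, F) (g i) x)
    (hs : MDifferentiableAt (𝓡 n) 𝓘(ℝ, F) (fun z => ∑ i ∈ s, g i z) x) :
    fieldDeriv X (fun z => ∑ i ∈ s, g i z) x = ∑ i ∈ s, fieldDeriv X (g i) x := by
  rw [fieldDeriv_eq_fderiv hs,
    fderiv_fun_sum fun i hi => differentiableAt_comp_chart_symm (hg i hi),
    sum_apply]
  exact Finset.sum_congr rfl fun i hi => (fieldDeriv_eq_fderiv (hg i hi)).symm

theorem fieldDeriv_add {g h : M → F} {x : M} (hg : MDifferentiableAt (𝓡 n) 𝓘(ℝ, F) g x)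
    (hh : MDifferentiableAt (𝓡 n) 𝓘(ℝ, F) h x) :
    fieldDeriv X (fun z => g z + h z) x = fieldDeriv X g x + fieldDeriv X h x := by
  have hs : MDifferentiableAt (𝓡 n) 𝓘(ℝ, F) (fun z => g z + h z) x := hg.add hh
  rw [fieldDeriv_eq_fderiv hs, fderiv_fun_add (differentiableAt_comp_chart_symm hg)
    (differentiableAt_comp_chart_symm hh), fieldDeriv_eq_fderiv hg, fieldDeriv_eq_fderiv hh]
  rfl

theorem fieldDeriv_comp {L : F → G} {g : M → F} {x : M}
    (hL : DifferentiableAt ℝ L (g x)) (hg : MDifferentiableAt (𝓡 n) 𝓘(ℝ, F) g x) :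
    fieldDeriv X (fun z => L (g z)) x = fderiv ℝ L (g x) (fieldDeriv X g x) := by
  have hx := (chartAt 𝔼 x).left_inv (mem_chart_source 𝔼 x)
  have hs : MDifferentiableAt (𝓡 n) 𝓘(ℝ, G) (fun z => L (g z)) x :=
    hL.mdifferentiableAt.comp x hg
  rw [fieldDeriv_eq_fderiv hs, fieldDeriv_eq_fderiv hg]
  have h := fderiv_comp (f := fun y => g ((chartAt 𝔼 x).symm y)) (g := L) (chartAt 𝔼 x x)
    (by rwa [hx]) (differentiableAt_comp_chart_symm hg)
  rw [hx] at h
  exact DFunLike.congr_fun h _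

theorem fieldDeriv_mul {𝔸 : Type*} [NormedCommRing 𝔸] [NormedAlgebra ℝ 𝔸]
    {f g : M → 𝔸} {x : M} (hf : MDifferentiableAt (𝓡 n) 𝓘(ℝ, 𝔸) f x)
    (hg : MDifferentiableAt (𝓡 n) 𝓘(ℝ, 𝔸) g x) :
    fieldDeriv X (fun z => f z * g z) x =
      f x * fieldDeriv X g x + fieldDeriv X f x * g x := by
  have hx := (chartAt 𝔼 x).left_inv (mem_chart_source 𝔼 x)
  have hs : MDifferentiableAt (𝓡 n) 𝓘(ℝ, 𝔸) (fun z => f z * g z) x := hf.mul hg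
  rw [fieldDeriv_eq_fderiv hs, fderiv_fun_mul (differentiableAt_comp_chart_symm hf)
    (differentiableAt_comp_chart_symm hg), fieldDeriv_eq_fderiv hf, fieldDeriv_eq_fderiv hg, hx]
  simp only [add_apply, smul_apply, smul_eq_mul]
  rw [mul_comm (g x)]

end FieldDeriv

/-! ### Bump functions, and continuous functions determined by their integrals. -/

section Bump

variable {n : ℕ} {M : Type*} [TopologicalSpace M] [T2Space M]
  [ChartedSpace (EuclideanSpace ℝ (Fin n)) M] [IsManifold (𝓡 n) 3 M]

local notation "𝔼" => EuclideanSpace ℝ (Fin n)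

theorem exists_contMDiff_bump {O : Set M} (hO : IsOpen O) {x : M} (hx : x ∈ O) :
    ∃ ρ : M → ℝ, ContMDiff (𝓡 n) 𝓘(ℝ, ℝ) 3 ρ ∧ HasCompactSupport ρ ∧
      tsupport ρ ⊆ (chartAt 𝔼 x).source ∩ O ∧ (∀ z, 0 ≤ ρ z) ∧ ρ x = 1 := by
  have hxs := mem_chart_source 𝔼 x
  have hn : (chartAt 𝔼 x).target ∩ (chartAt 𝔼 x).symm ⁻¹' O ∈ 𝓝 (chartAt 𝔼 x x) := by
    refine ((chartAt 𝔼 x).symm.isOpen_inter_preimage hO).mem_nhds ⟨mem_chart_target 𝔼 x, ?_⟩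
    rwa [Set.mem_preimage, (chartAt 𝔼 x).left_inv hxs]
  obtain ⟨f, hfs, hfc, hf, hfr, hf1⟩ := exists_contDiff_tsupport_subset (n := 3) hn
  refine ⟨ofChart x f, contMDiff_ofChart x hf hfc (hfs.trans Set.inter_subset_left),
    hasCompactSupport_ofChart x hfc (hfs.trans Set.inter_subset_left),
    tsupport_ofChart_subset x hfc hfs, fun z => ?_, ?_⟩
  · exact Set.indicator_nonneg (fun z _ => (hfr ⟨_, rfl⟩).1) z
  · rw [ofChart_of_mem x f hxs, hf1]

/-- If the values differed at `x`, a bump supported where the difference keeps its sign would detect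
it. -/
theorem eq_of_integral_contMDiff_three_smul_eq [MeasurableSpace M] [BorelSpace M]
    {μ : Measure M} [IsFiniteMeasureOnCompacts μ] [μ.IsOpenPosMeasure]
    {O : Set M} (hO : IsOpen O) {c₁ c₂ : M → ℝ} (h₁ : ContinuousOn c₁ O) (h₂ : ContinuousOn c₂ O)
    (h : ∀ g : M → ℝ, ContMDiff (𝓡 n) 𝓘(ℝ, ℝ) 3 g → HasCompactSupport g → tsupport g ⊆ O →
      ∫ x, c₁ x • g x ∂μ = ∫ x, c₂ x • g x ∂μ) {x : M}
    (hx : x ∈ O) : c₁ x = c₂ x := by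
  by_contra hne
  -- The constant factor carries the sign of the difference at `x`, which makes `w x` a positive
  -- square and avoids a case distinction.
  set w : M → ℝ := fun z => (c₁ x - c₂ x) * (c₁ z - c₂ z) with hw
  have hwx : 0 < w x := mul_self_pos.2 (sub_ne_zero.2 hne)
  have hwc : ContinuousOn w O := continuousOn_const.mul (h₁.sub h₂)
  have hO' : IsOpen (O ∩ w ⁻¹' Set.Ioi 0) := hwc.isOpen_inter_preimage hO isOpen_Ioi
  obtain ⟨ρ, hρ, hρc, hρs, hρ0, hρ1⟩ := exists_contMDiff_bump (n := n) hO' (x := x) ⟨hx, hwx⟩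
  have hρs' : tsupport ρ ⊆ O := fun z hz => (hρs hz).2.1
  have i1 := integrable_smul_of_continuousOn (μ := μ) hO h₁ hρ.continuous hρc hρs'
  have i2 := integrable_smul_of_continuousOn (μ := μ) hO h₂ hρ.continuous hρc hρs'
  have hzero : ∫ z, w z • ρ z ∂μ = 0 := by
    have e : ∀ z, w z • ρ z = (c₁ x - c₂ x) * (c₁ z • ρ z - c₂ z • ρ z) := fun z => by
      simp only [hw, smul_eq_mul]
      ring
    simp_rw [e]
    rw [integral_const_mul, integral_sub i1 i2, h ρ hρ hρc hρs', sub_self, mul_zero]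
  have hcont : Continuous fun z => w z • ρ z := by
    refine continuous_of_tsupport fun z hz => ?_
    have hz' : z ∈ O := hρs' (tsupport_smul_subset_right _ ρ hz)
    exact (hwc.continuousAt (hO.mem_nhds hz')).smul hρ.continuous.continuousAt
  have hnonneg : ∀ z, 0 ≤ w z • ρ z := by
    intro z
    by_cases hz : z ∈ tsupport ρ
    · have h1 : w z ∈ Set.Ioi 0 := (hρs hz).2.2
      exact smul_nonneg (le_of_lt h1) (hρ0 z)
    · rw [image_eq_zero_of_notMem_tsupport hz, smul_zero]
  have hsupp : HasCompactSupport (w • ρ) := hρc.smul_left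
  have hne : w x • ρ x ≠ 0 := by
    rw [hρ1, smul_eq_mul, mul_one]
    exact hwx.ne'
  have hpos : 0 < ∫ z, w z • ρ z ∂μ :=
    hcont.integral_pos_of_hasCompactSupport_nonneg_nonzero hsupp hnonneg hne
  exact hpos.ne' hzero

end Bump

/-! ### Chart independence of the divergence, the global divergence theorem, and the fundamental
lemma. -/

section Divergence

variable {n : ℕ} {M : Type*} [TopologicalSpace M] [T2Space M] [SecondCountableTopology M]
  [ChartedSpace (EuclideanSpace ℝ (Fin n)) M] [IsManifold (𝓡 n) 3 M]
  [RiemannianBundle (fun x : M => TangentSpace (𝓡 n) x)]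
  [IsContMDiffRiemannianBundle (𝓡 n) 2 (EuclideanSpace ℝ (Fin n))
    (fun x : M => TangentSpace (𝓡 n) x)]
  {F : Type*} [NormedAddCommGroup F] [NormedSpace ℝ F]
  {X : ∀ x : M, TangentSpace (𝓡 n) x} {U : Set M}

local notation "𝔼" => EuclideanSpace ℝ (Fin n)

theorem contMDiffOn_chartDivergence_chart (hU : IsOpen U)
    (hX : ContMDiffOn (𝓡 n) (𝓡 n).tangent 2 (fun x => (⟨x, X x⟩ : TangentBundle (𝓡 n) M)) U)
    (x₀ : M) :
    ContMDiffOn (𝓡 n) 𝓘(ℝ, ℝ) 1 (fun x => chartDivergence X x₀ (chartAt 𝔼 x₀ x))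
      ((chartAt 𝔼 x₀).source ∩ U) := by
  have : IsManifold (𝓡 n) 1 M := inferInstance
  have h : ContMDiffOn (𝓡 n) (𝓡 n) 1 (chartAt 𝔼 x₀) (chartAt 𝔼 x₀).source := contMDiffOn_chart
  refine (contDiffOn_chartDivergence hU hX x₀).contMDiffOn.comp
    (h.mono Set.inter_subset_left) fun x hx => ⟨(chartAt 𝔼 x₀).map_source hx.1, ?_⟩
  rw [Set.mem_preimage, (chartAt 𝔼 x₀).left_inv hx.1]
  exact hx.2

/-- By duality rather than by transforming second derivatives: on the overlap both expressions are
adjoint to the same derivation `X` with respect to the same measure, and a continuous function is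
determined by its pairings with test functions. -/
theorem divergence_eq_chartDivergence_of_mem [MeasurableSpace M] [BorelSpace M] (hU : IsOpen U)
    (hX : ContMDiffOn (𝓡 n) (𝓡 n).tangent 2 (fun x => (⟨x, X x⟩ : TangentBundle (𝓡 n) M)) U)
    (x₀ : M) {x : M} (hx : x ∈ (chartAt 𝔼 x₀).source) (hxU : x ∈ U) :
    divergence X x = chartDivergence X x₀ (chartAt 𝔼 x₀ x) := by
  have hO : IsOpen ((chartAt 𝔼 x).source ∩ (chartAt 𝔼 x₀).source ∩ U) :=
    ((chartAt 𝔼 x).open_source.inter (chartAt 𝔼 x₀).open_source).inter hU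
  refine eq_of_integral_contMDiff_three_smul_eq (n := n) (μ := riemVolume n M) hO
    (c₁ := fun z => chartDivergence X x (chartAt 𝔼 x z))
    (c₂ := fun z => chartDivergence X x₀ (chartAt 𝔼 x₀ z))
    ((contMDiffOn_chartDivergence_chart hU hX x).continuousOn.mono fun z hz => ⟨hz.1.1, hz.2⟩)
    ((contMDiffOn_chartDivergence_chart hU hX x₀).continuousOn.mono fun z hz => ⟨hz.1.2, hz.2⟩)
    (fun ρ hρ hρc hρs => ?_) ⟨⟨mem_chart_source 𝔼 x, hx⟩, hxU⟩
  have hρ' : ContMDiff (𝓡 n) 𝓘(ℝ, ℝ) 1 ρ := hρ.of_le (by norm_num)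
  have e1 := integral_fieldDeriv_eq_of_tsupport_subset_chart hU hX x hρ' hρc
    fun z hz => ⟨(hρs hz).1.1, (hρs hz).2⟩
  have e2 := integral_fieldDeriv_eq_of_tsupport_subset_chart hU hX x₀ hρ' hρc
    fun z hz => ⟨(hρs hz).1.2, (hρs hz).2⟩
  exact neg_injective (e1.symm.trans e2)

variable [MeasurableSpace M] [BorelSpace M]

/-- Near each point the moving chart in `divergence` can be replaced by a fixed one. -/
theorem contMDiffOn_divergence (hU : IsOpen U)
    (hX : ContMDiffOn (𝓡 n) (𝓡 n).tangent 2 (fun x => (⟨x, X x⟩ : TangentBundle (𝓡 n) M)) U) :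
    ContMDiffOn (𝓡 n) 𝓘(ℝ, ℝ) 1 (divergence X) U := by
  intro x hx
  have hn := ((chartAt 𝔼 x).open_source.inter hU).mem_nhds ⟨mem_chart_source 𝔼 x, hx⟩
  have h := (contMDiffOn_chartDivergence_chart hU hX x).contMDiffAt hn
  refine (h.congr_of_eventuallyEq ?_).contMDiffWithinAt
  filter_upwards [hn] with z hz using divergence_eq_chartDivergence_of_mem hU hX x hz.1 hz.2

theorem continuous_fieldDeriv (hU : IsOpen U)
    (hX : ContMDiffOn (𝓡 n) (𝓡 n).tangent 2 (fun x => (⟨x, X x⟩ : TangentBundle (𝓡 n) M)) U)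
    {g : M → F} (hg : ContMDiff (𝓡 n) 𝓘(ℝ, F) 1 g) (hs : tsupport g ⊆ U) :
    Continuous (fieldDeriv X g) := by
  have h := continuousOn_fieldDeriv hU hU hX hg.contMDiffOn subset_rfl
  refine continuous_of_tsupport fun x hx => ?_
  exact h.continuousAt (hU.mem_nhds (hs (tsupport_fieldDeriv_subset g hx)))

theorem hasCompactSupport_fieldDeriv {g : M → F} (hc : HasCompactSupport g) :
    HasCompactSupport (fieldDeriv X g) :=
  hc.of_isClosed_subset (isClosed_tsupport _) (tsupport_fieldDeriv_subset g)

/-- A finite partition of unity on the compact support of `g` reduces this to functions supported in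
one chart. -/
theorem integral_fieldDeriv_eq (hU : IsOpen U)
    (hX : ContMDiffOn (𝓡 n) (𝓡 n).tangent 2 (fun x => (⟨x, X x⟩ : TangentBundle (𝓡 n) M)) U)
    {g : M → F} (hg : ContMDiff (𝓡 n) 𝓘(ℝ, F) 1 g) (hc : HasCompactSupport g)
    (hs : tsupport g ⊆ U) :
    ∫ x, fieldDeriv X g x ∂(riemVolume n M) =
      - ∫ x, divergence X x • g x ∂(riemVolume n M) := by
  have : IsManifold (𝓡 n) 1 M := inferInstance
  choose! ρ hρ hρc hρs hρ0 hρ1 using fun x : M => fun hx : x ∈ U =>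
    exists_contMDiff_bump (n := n) hU hx
  -- The cover consists of the sets where the bumps are positive, so that their finite sum `S` can
  -- be divided by on the support of `g`.
  obtain ⟨t, htK, htc⟩ := hc.isCompact.elim_nhds_subcover (fun x => {z | 0 < ρ x z}) fun x hx =>
    (isOpen_lt continuous_const (hρ x (hs hx)).continuous).mem_nhds
      (by simp [hρ1 x (hs hx)])
  have htU : ∀ x ∈ t, x ∈ U := fun x hx => hs (htK x hx)
  set S : M → ℝ := fun z => ∑ x ∈ t, ρ x z with hS
  have hSpos : ∀ z ∈ tsupport g, S z ≠ 0 := by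
    intro z hz
    obtain ⟨x, hx, hxz⟩ := Set.mem_iUnion₂.1 (htc hz)
    exact (Finset.sum_pos' (fun i hi => hρ0 i (htU i hi) z) ⟨x, hx, hxz⟩).ne'
  have hρ' : ∀ x ∈ t, ContMDiff (𝓡 n) 𝓘(ℝ, ℝ) 1 (ρ x) := fun x hx =>
    (hρ x (htU x hx)).of_le (by norm_num)
  have hSd : ContMDiff (𝓡 n) 𝓘(ℝ, ℝ) 1 S := contMDiff_finsetSum hρ'
  -- Zeros of `S` are harmless: they lie off the topological support of `g`, where each piece
  -- vanishes.
  set h : M → M → F := fun x z => ((S z)⁻¹ * ρ x z) • g z with hh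
  have hsub1 : ∀ x, tsupport (h x) ⊆ tsupport g := fun x => tsupport_smul_subset_right _ g
  have hsub2 : ∀ x, tsupport (h x) ⊆ tsupport (ρ x) := fun x =>
    (tsupport_smul_subset_left _ g).trans (tsupport_mul_subset_right)
  have hd : ∀ x ∈ t, ContMDiff (𝓡 n) 𝓘(ℝ, F) 1 (h x) := by
    intro x hx
    refine contMDiff_of_tsupport fun z hz => ?_
    exact ((hSd.contMDiffAt.inv₀ (hSpos z (hsub1 x hz))).mul (hρ' x hx).contMDiffAt).smul
      hg.contMDiffAt
  have hhc : ∀ x, HasCompactSupport (h x) := fun x =>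
    hc.of_isClosed_subset (isClosed_tsupport _) (hsub1 x)
  have hsum : g = fun z => ∑ x ∈ t, h x z := by
    funext z
    by_cases hz : z ∈ tsupport g
    · simp only [hh, ← Finset.sum_smul, ← Finset.mul_sum]
      rw [inv_mul_cancel₀ (hSpos z hz), one_smul]
    · simp [hh, image_eq_zero_of_notMem_tsupport hz]
  have hdsum : ContMDiff (𝓡 n) 𝓘(ℝ, F) 1 (fun z => ∑ x ∈ t, h x z) := by rwa [← hsum]
  have hdivc : ContinuousOn (divergence X) U := (contMDiffOn_divergence hU hX).continuousOn
  have e1 : ∀ z, fieldDeriv X g z = ∑ x ∈ t, fieldDeriv X (h x) z := by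
    intro z
    conv_lhs => rw [hsum]
    exact fieldDeriv_sum (fun x hx => (hd x hx).mdifferentiableAt one_ne_zero)
      (hdsum.mdifferentiableAt one_ne_zero)
  have e2 : ∀ z, divergence X z • g z = ∑ x ∈ t, divergence X z • h x z := by
    intro z
    conv_lhs => rw [hsum]
    rw [Finset.smul_sum]
  simp_rw [e1, e2]
  rw [integral_finsetSum, integral_finsetSum, ← Finset.sum_neg_distrib]
  rotate_left
  · exact fun x hx => integrable_smul_of_continuousOn hU hdivc (hd x hx).continuous (hhc x)
      ((hsub1 x).trans hs)
  · exact fun x hx => (continuous_fieldDeriv hU hX (hd x hx)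
      ((hsub1 x).trans hs)).integrable_of_hasCompactSupport
      (hasCompactSupport_fieldDeriv (hhc x))
  refine Finset.sum_congr rfl fun x hx => ?_
  rw [integral_fieldDeriv_eq_of_tsupport_subset_chart hU hX x (hd x hx) (hhc x)
    ((hsub2 x).trans (hρs x (htU x hx)))]
  congr 1
  refine integral_congr_ae (Eventually.of_forall fun z => ?_)
  by_cases hz : z ∈ tsupport (h x)
  · have hz' := hρs x (htU x hx) (hsub2 x hz)
    simp only [divergence_eq_chartDivergence_of_mem hU hX x hz'.1 hz'.2]
  · simp [image_eq_zero_of_notMem_tsupport hz]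

/-- The Euclidean fundamental lemma, applied to density times `α` in each of countably many charts;
second countability provides the countable cover. -/
theorem ae_eq_zero_of_integral_contMDiff_three_smul_eq_zero [CompleteSpace F] {B : Set M}
    (hB : IsOpen B) {α : M → F} (hα : IntegrableOn α B (riemVolume n M))
    (h : ∀ g : M → ℝ, ContMDiff (𝓡 n) 𝓘(ℝ, ℝ) 3 g → HasCompactSupport g → tsupport g ⊆ B →
      ∫ x in B, g x • α x ∂(riemVolume n M) = 0) :
    ∀ᵐ x ∂((riemVolume n M).restrict B), α x = 0 := by
  obtain ⟨s, hsc, hs⟩ := TopologicalSpace.countable_cover_nhds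
    (f := fun x : M => (chartAt 𝔼 x).source)
    fun x => (chartAt 𝔼 x).open_source.mem_nhds (mem_chart_source 𝔼 x)
  have hBs : B = ⋃ x ∈ s, ((chartAt 𝔼 x).source ∩ B) := by
    rw [← Set.iUnion₂_inter, hs, Set.univ_inter]
  rw [hBs, ae_restrict_biUnion_iff _ hsc]
  intro x₀ _
  set A := (chartAt 𝔼 x₀).source ∩ B with hAdef
  have hA : IsOpen A := (chartAt 𝔼 x₀).open_source.inter hB
  have hαA : IntegrableOn α A (riemVolume n M) := hα.mono_set Set.inter_subset_right
  have hT : IsOpen ((chartAt 𝔼 x₀).target ∩ (chartAt 𝔼 x₀).symm ⁻¹' A) :=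
    (chartAt 𝔼 x₀).symm.isOpen_inter_preimage hA
  refine ae_restrict_riemVolume_of_chart x₀ hA.measurableSet Set.inter_subset_left
    (hαA.aestronglyMeasurable.nullMeasurableSet_eq_fun aestronglyMeasurable_const).compl ?_
  have hae := hT.ae_eq_zero_of_integral_contDiff_smul_eq_zero
    (integrableOn_riemVolume_chart x₀ hA.measurableSet Set.inter_subset_left
      hαA).locallyIntegrableOn ?_
  · filter_upwards [hae] with y hy hyT
    exact (smul_eq_zero.1 (hy hyT)).resolve_left (density_pos x₀ hyT.1).ne'
  · intro u hu huc hus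
    have hus' := hus.trans Set.inter_subset_left
    -- Smooth Euclidean test functions become only `C³` on the manifold, which is the class against
    -- which `α` is tested.
    have hg : ContMDiff (𝓡 n) 𝓘(ℝ, ℝ) 3 (ofChart x₀ u) :=
      contMDiff_ofChart x₀ (by exact_mod_cast contDiff_infty.1 hu 3) huc hus'
    have hgs : tsupport (ofChart x₀ u) ⊆ A := fun z hz => (tsupport_ofChart_subset x₀ huc hus hz).2
    have hm : AEStronglyMeasurable (fun x => ofChart x₀ u x • α x)
        ((riemVolume n M).restrict A) :=
      hg.continuous.aestronglyMeasurable.smul hαA.aestronglyMeasurable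
    have h0 := h _ hg (hasCompactSupport_ofChart x₀ huc hus') (hgs.trans Set.inter_subset_right)
    rw [setIntegral_eq_of_subset_of_forall_sdiff_eq_zero hB.measurableSet
      (Set.inter_subset_right : A ⊆ B) (fun x hx => by
        rw [image_eq_zero_of_notMem_tsupport fun hx' => hx.2 (hgs hx'), zero_smul]),
      setIntegral_riemVolume_chart x₀ hA.measurableSet Set.inter_subset_left
        hm] at h0
    rw [← setIntegral_eq_integral_of_forall_compl_eq_zero (s := (chartAt 𝔼 x₀).target ∩
      (chartAt 𝔼 x₀).symm ⁻¹' A) (fun y hy => by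
        rw [image_eq_zero_of_notMem_tsupport fun hy' => hy (hus hy'), zero_smul]), ← h0]
    refine setIntegral_congr_fun hT.measurableSet fun y hy => ?_
    rw [ofChart_of_mem x₀ u ((chartAt 𝔼 x₀).map_target hy.1), (chartAt 𝔼 x₀).right_inv hy.1,
      smul_comm]

end Divergence

/-! ### Topology of the geodesic ball. -/

section Ball

variable {n : ℕ} {M : Type*} [TopologicalSpace M] [ChartedSpace (EuclideanSpace ℝ (Fin n)) M]
  [IsManifold (𝓡 n) 1 M] [RiemannianBundle (fun x : M => TangentSpace (𝓡 n) x)]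

/-- The strict inequality gives a normal radius `R > r`. The exponential map is a diffeomorphism on
the ball of radius `R`, so it maps the open `r`-ball to an open set and the closed `r`-ball to a
compact one. -/
theorem isOpen_geodesicBall_and_isCompact_closure [T2Space M] {p : M} {r : ℝ}
    (hinj : ENNReal.ofReal r < injRadius n p) :
    IsOpen (geodesicBall n p r) ∧ IsCompact (closure (geodesicBall n p r)) := by
  simp only [injRadius, lt_iSup_iff] at hinj
  obtain ⟨R, ⟨hR, -, e, hes, hee⟩, hrR⟩ := hinj
  have hrR' : r < R := (ENNReal.ofReal_lt_ofReal_iff hR).1 hrR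
  have hsub : Metric.ball (0 : TangentSpace (𝓡 n) p) r ⊆ e.source := by
    rw [hes]
    exact Metric.ball_subset_ball hrR'.le
  have hball : geodesicBall n p r = e '' Metric.ball (0 : TangentSpace (𝓡 n) p) r :=
    Set.image_congr fun v hv => (hee v (Metric.ball_subset_ball hrR'.le hv)).symm
  constructor
  · rw [hball]
    exact e.toOpenPartialHomeomorph.isOpen_image_of_subset_source Metric.isOpen_ball hsub
  · have : ProperSpace (TangentSpace (𝓡 n) p) := FiniteDimensional.proper ℝ _
    have hK : IsCompact (e '' Metric.closedBall (0 : TangentSpace (𝓡 n) p) r) := by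
      refine (isCompact_closedBall _ _).image_of_continuousOn ?_
      refine e.contMDiffOn_toFun.continuousOn.mono ?_
      rw [hes]
      exact Metric.closedBall_subset_ball hrR'
    refine hK.of_isClosed_subset isClosed_closure (closure_minimal ?_ hK.isClosed)
    rw [hball]
    exact Set.image_mono Metric.ball_subset_closedBall

end Ball

/-! ### Covectors in an orthonormal frame. -/

section Covectors

/-- Expanding `b` in `c` produces the coefficients `∑ᵢ ⟨c_j, b_i⟩⟨b_i, c_k⟩ = δ_{jk}`. Thus
`covInner` and `covNorm`, defined by a chosen basis, can be computed in the given frame. -/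
theorem sum_conj_mul_orthonormalBasis {V ι κ : Type*} [NormedAddCommGroup V]
    [InnerProductSpace ℝ V] [Fintype ι] [Fintype κ] (b : OrthonormalBasis ι ℝ V)
    (c : OrthonormalBasis κ ℝ V) (α β : V →L[ℝ] ℂ) :
    ∑ i, conj (α (b i)) * β (b i) = ∑ j, conj (α (c j)) * β (c j) := by
  classical
  have hexp : ∀ (γ : V →L[ℝ] ℂ) i, γ (b i) = ∑ j, (inner ℝ (c j) (b i) : ℂ) * γ (c j) := by
    intro γ i
    conv_lhs => rw [← c.sum_repr (b i)]
    rw [map_sum]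
    refine Finset.sum_congr rfl fun j _ => ?_
    rw [map_smul, c.repr_apply_apply, Complex.real_smul]
  calc ∑ i, conj (α (b i)) * β (b i)
      = ∑ i, ∑ j, ∑ k, ((inner ℝ (c j) (b i) * inner ℝ (b i) (c k) : ℝ) : ℂ) *
          (conj (α (c j)) * β (c k)) := by
        refine Finset.sum_congr rfl fun i _ => ?_
        rw [hexp α i, hexp β i, map_sum, Finset.sum_mul_sum]
        refine Finset.sum_congr rfl fun j _ => Finset.sum_congr rfl fun k _ => ?_
        rw [map_mul, Complex.conj_ofReal, real_inner_comm (c k) (b i)]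
        push_cast
        ring
    _ = ∑ j, ∑ k, ((∑ i, inner ℝ (c j) (b i) * inner ℝ (b i) (c k) : ℝ) : ℂ) *
          (conj (α (c j)) * β (c k)) := by
        rw [Finset.sum_comm]
        refine Finset.sum_congr rfl fun j _ => ?_
        rw [Finset.sum_comm]
        refine Finset.sum_congr rfl fun k _ => ?_
        rw [Complex.ofReal_sum, Finset.sum_mul]
    _ = ∑ j, conj (α (c j)) * β (c j) := by
        refine Finset.sum_congr rfl fun j _ => ?_
        have h : ∀ j k, ∑ i, inner ℝ (c j) (b i) * inner ℝ (b i) (c k) =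
            if j = k then (1 : ℝ) else 0 := fun j k =>
          (b.sum_inner_mul_inner (c j) (c k)).trans (orthonormal_iff_ite.1 c.orthonormal j k)
        rw [Finset.sum_eq_single j (fun k _ hk => by rw [h j k, if_neg (Ne.symm hk)]; simp)
          (fun hj => absurd (Finset.mem_univ j) hj), h j j, if_pos rfl]
        simp

variable {n : ℕ} {M : Type*} [TopologicalSpace M] [ChartedSpace (EuclideanSpace ℝ (Fin n)) M]
  [RiemannianBundle (fun x : M => TangentSpace (𝓡 n) x)] {x : M}

theorem exists_orthonormalBasis_eq {v : Fin n → TangentSpace (𝓡 n) x} (hv : Orthonormal ℝ v) :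
    ∃ b : OrthonormalBasis (Fin n) ℝ (TangentSpace (𝓡 n) x), ∀ a, b a = v a := by
  have hfin : Module.finrank ℝ (TangentSpace (𝓡 n) x) = n :=
    finrank_euclideanSpace_fin (𝕜 := ℝ) (n := n)
  have hspan : Submodule.span ℝ (Set.range v) = ⊤ :=
    hv.linearIndependent.span_eq_top_of_card_eq_finrank' (by rw [Fintype.card_fin, hfin])
  exact ⟨OrthonormalBasis.mk hv hspan.ge, fun a => by simp⟩

theorem covInner_eq_sum {v : Fin n → TangentSpace (𝓡 n) x} (hv : Orthonormal ℝ v)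
    (α β : TangentSpace (𝓡 n) x →L[ℝ] ℂ) :
    covInner α β = ∑ a, conj (α (v a)) * β (v a) := by
  obtain ⟨b, hb⟩ := exists_orthonormalBasis_eq hv
  simp_rw [← hb]
  exact sum_conj_mul_orthonormalBasis _ b α β

theorem covNorm_sq_eq_sum {v : Fin n → TangentSpace (𝓡 n) x} (hv : Orthonormal ℝ v)
    (α : TangentSpace (𝓡 n) x →L[ℝ] ℂ) : covNorm α ^ 2 = ∑ a, ‖α (v a)‖ ^ 2 := by
  have h := covInner_eq_sum hv α α
  rw [covNorm, Real.sq_sqrt (Finset.sum_nonneg fun _ _ => sq_nonneg _)]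
  unfold covInner at h
  simp_rw [← Complex.normSq_eq_conj_mul_self, ← Complex.ofReal_sum, Complex.ofReal_inj,
    Complex.normSq_eq_norm_sq] at h
  exact h

/-- The complex covector field with prescribed values on a frame. -/
noncomputable def frameCovector (X : Fin n → ∀ x : M, TangentSpace (𝓡 n) x)
    (c : Fin n → M → ℂ) (x : M) : TangentSpace (𝓡 n) x →L[ℝ] ℂ :=
  ∑ a, (innerSL ℝ (X a x)).smulRight (c a x)

theorem frameCovector_apply {X : Fin n → ∀ x : M, TangentSpace (𝓡 n) x}
    (hX : Orthonormal ℝ fun a => X a x) (c : Fin n → M → ℂ) (a : Fin n) :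
    frameCovector X c x (X a x) = c a x := by
  have h := orthonormal_iff_ite.1 hX
  simp only [frameCovector, sum_apply, ContinuousLinearMap.smulRight_apply, innerSL_apply_apply]
  rw [Finset.sum_congr rfl fun b _ => by rw [h b a]]
  simp

end Covectors

/-! ### Convergence in `L²`. -/

section SquareIntegrable

variable {Ω : Type*} [MeasurableSpace Ω] {μ : Measure Ω}

theorem integrable_conj_mul {f g : Ω → ℂ} (hf : MemLp f 2 μ) (hg : MemLp g 2 μ) :
    Integrable (fun x => conj (f x) * g x) μ :=
  MemLp.integrable_mul hf.star hg

theorem integrable_norm_sq {f : Ω → ℂ} (hf : MemLp f 2 μ) : Integrable (fun x => ‖f x‖ ^ 2) μ :=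
  (memLp_two_iff_integrable_sq_norm hf.1).1 hf

theorem integral_conj_mul_self (f : Ω → ℂ) :
    ∫ x, conj (f x) * f x ∂μ = ((∫ x, ‖f x‖ ^ 2 ∂μ : ℝ) : ℂ) := by
  rw [← integral_complex_ofReal]
  refine integral_congr_ae (Eventually.of_forall fun x => ?_)
  simp only [← Complex.normSq_eq_conj_mul_self, Complex.normSq_eq_norm_sq]

theorem inner_toLp {f g : Ω → ℂ} (hf : MemLp f 2 μ) (hg : MemLp g 2 μ) :
    inner ℂ (hf.toLp f) (hg.toLp g) = ∫ x, conj (f x) * g x ∂μ := by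
  rw [L2.inner_def]
  refine integral_congr_ae ?_
  filter_upwards [hf.coeFn_toLp, hg.coeFn_toLp] with x h1 h2
  rw [h1, h2, RCLike.inner_apply, mul_comm]

theorem tendsto_integral_conj_mul {f g : ℕ → Ω → ℂ} {f₀ g₀ : Ω → ℂ}
    (hf : ∀ k, MemLp (f k) 2 μ) (hg : ∀ k, MemLp (g k) 2 μ) (hf₀ : MemLp f₀ 2 μ)
    (hg₀ : MemLp g₀ 2 μ)
    (tf : Tendsto (fun k => eLpNorm (fun x => f k x - f₀ x) 2 μ) atTop (𝓝 0))
    (tg : Tendsto (fun k => eLpNorm (fun x => g k x - g₀ x) 2 μ) atTop (𝓝 0)) :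
    Tendsto (fun k => ∫ x, conj (f k x) * g k x ∂μ) atTop (𝓝 (∫ x, conj (f₀ x) * g₀ x ∂μ)) := by
  have t1 := (Lp.tendsto_Lp_iff_tendsto_eLpNorm'' f hf f₀ hf₀).2 tf
  have t2 := (Lp.tendsto_Lp_iff_tendsto_eLpNorm'' g hg g₀ hg₀).2 tg
  have := t1.inner (𝕜 := ℂ) t2
  simpa only [inner_toLp] using this

theorem tendsto_eLpNorm_sub_self (f : Ω → ℂ) :
    Tendsto (fun _ : ℕ => eLpNorm (fun x => f x - f x) 2 μ) atTop (𝓝 0) := by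
  simp

theorem tendsto_eLpNorm_of_norm_le_mul {f g : ℕ → Ω → ℂ} {K : ℝ}
    (h : ∀ k, ∀ᵐ x ∂μ, ‖f k x‖ ≤ K * ‖g k x‖)
    (hg : Tendsto (fun k => eLpNorm (g k) 2 μ) atTop (𝓝 0)) :
    Tendsto (fun k => eLpNorm (f k) 2 μ) atTop (𝓝 0) := by
  have h1 : Tendsto (fun k => ENNReal.ofReal K * eLpNorm (g k) 2 μ) atTop (𝓝 0) := by
    have := ENNReal.Tendsto.const_mul (a := ENNReal.ofReal K) hg (Or.inr ENNReal.ofReal_ne_top)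
    rwa [mul_zero] at this
  exact tendsto_of_tendsto_of_tendsto_of_le_of_le tendsto_const_nhds h1 (fun _ => zero_le)
    fun k => eLpNorm_le_mul_eLpNorm_of_ae_le_mul (h k) 2

theorem tendsto_eLpNorm_add {f g : ℕ → Ω → ℂ} (hf : ∀ k, AEStronglyMeasurable (f k) μ)
    (hg : ∀ k, AEStronglyMeasurable (g k) μ)
    (tf : Tendsto (fun k => eLpNorm (f k) 2 μ) atTop (𝓝 0))
    (tg : Tendsto (fun k => eLpNorm (g k) 2 μ) atTop (𝓝 0)) :
    Tendsto (fun k => eLpNorm (fun x => f k x + g k x) 2 μ) atTop (𝓝 0) := by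
  have h1 := tf.add tg
  rw [add_zero] at h1
  exact tendsto_of_tendsto_of_tendsto_of_le_of_le tendsto_const_nhds h1 (fun _ => zero_le)
    fun k => eLpNorm_add_le (hf k) (hg k) one_le_two

/-- Dominated convergence in `L²`: the limit inherits the bound `K‖G‖`, so the differences are
dominated by `2K‖G‖`. -/
theorem memLp_and_tendsto_eLpNorm_of_dominated {f : ℕ → Ω → ℂ} {f₀ G : Ω → ℂ} {K : ℝ}
    (hG : MemLp G 2 μ) (hf : ∀ k, AEStronglyMeasurable (f k) μ)
    (hb : ∀ k, ∀ᵐ x ∂μ, ‖f k x‖ ≤ K * ‖G x‖)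
    (hlim : ∀ᵐ x ∂μ, Tendsto (fun k => f k x) atTop (𝓝 (f₀ x))) :
    MemLp f₀ 2 μ ∧ Tendsto (fun k => eLpNorm (fun x => f k x - f₀ x) 2 μ) atTop (𝓝 0) := by
  have hf₀ : AEStronglyMeasurable f₀ μ := aestronglyMeasurable_of_tendsto_ae _ hf hlim
  have hb₀ : ∀ᵐ x ∂μ, ‖f₀ x‖ ≤ K * ‖G x‖ := by
    filter_upwards [hlim, ae_all_iff.2 hb] with x hx hbx
    exact le_of_tendsto hx.norm (Eventually.of_forall hbx)
  refine ⟨hG.of_le_mul hf₀ hb₀, ?_⟩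
  have hbd : MemLp (fun x => ((2 * K : ℝ) : ℂ) * G x) 2 μ := hG.const_mul _
  have hfin := lintegral_rpow_enorm_lt_top_of_eLpNorm_lt_top two_ne_zero ENNReal.ofNat_ne_top
    hbd.eLpNorm_lt_top
  have hle : ∀ k, ∀ᵐ x ∂μ, ‖f k x - f₀ x‖ₑ ^ (2 : ℝ≥0∞).toReal ≤
      ‖((2 * K : ℝ) : ℂ) * G x‖ₑ ^ (2 : ℝ≥0∞).toReal := by
    intro k
    filter_upwards [hb k, hb₀] with x h1 h2
    refine ENNReal.rpow_le_rpow ?_ ENNReal.toReal_nonneg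
    rw [enorm_le_iff_norm_le]
    refine (norm_sub_le _ _).trans ?_
    rw [norm_mul, Complex.norm_real, Real.norm_eq_abs]
    have : 2 * K * ‖G x‖ ≤ |2 * K| * ‖G x‖ :=
      mul_le_mul_of_nonneg_right (le_abs_self _) (norm_nonneg _)
    linarith
  have hlint := tendsto_lintegral_of_dominated_convergence' (μ := μ)
    (F := fun k x => ‖f k x - f₀ x‖ₑ ^ (2 : ℝ≥0∞).toReal) (f := fun _ => 0) _
    (fun k => ((hf k).sub hf₀).enorm.pow_const _) hle hfin.ne ?_
  · simp only [lintegral_zero] at hlint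
    have h2 := hlint.ennrpow_const (1 / (2 : ℝ≥0∞).toReal)
    rw [ENNReal.zero_rpow_of_pos (by norm_num)] at h2
    simpa only [eLpNorm_eq_lintegral_rpow_enorm_toReal two_ne_zero ENNReal.ofNat_ne_top] using h2
  · filter_upwards [hlim] with x hx
    have h1 : Tendsto (fun k => ‖f k x - f₀ x‖ₑ) atTop (𝓝 0) := by
      have := (hx.sub_const (f₀ x)).enorm
      simpa using this
    have h2 := h1.ennrpow_const (2 : ℝ≥0∞).toReal
    rwa [ENNReal.zero_rpow_of_pos (by norm_num)] at h2

theorem exists_subseq_tendsto_ae {E : Type*} [NormedAddCommGroup E] {f : ℕ → Ω → E} {f₀ : Ω → E}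
    (hf : ∀ k, MemLp (f k) 2 μ)
    (hf₀ : MemLp f₀ 2 μ)
    (tf : Tendsto (fun k => eLpNorm (fun x => f k x - f₀ x) 2 μ) atTop (𝓝 0)) :
    ∃ ns : ℕ → ℕ, StrictMono ns ∧ ∀ᵐ x ∂μ, Tendsto (fun k => f (ns k) x) atTop (𝓝 (f₀ x)) :=
  (tendstoInMeasure_of_tendsto_eLpNorm two_ne_zero (fun k => (hf k).1) hf₀.1
    tf).exists_seq_tendsto_ae

theorem memLp_bounded_mul {w : Ω → ℝ} {K : ℝ} (hw : AEStronglyMeasurable w μ)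
    (hK : ∀ᵐ x ∂μ, |w x| ≤ K) {f : Ω → ℂ} (hf : MemLp f 2 μ) :
    MemLp (fun x => (w x : ℂ) * f x) 2 μ := by
  refine hf.of_le_mul (c := K)
    ((Complex.continuous_ofReal.comp_aestronglyMeasurable hw).mul hf.1) ?_
  filter_upwards [hK] with x hx
  rw [norm_mul, Complex.norm_real]
  exact mul_le_mul_of_nonneg_right hx (norm_nonneg _)

theorem tendsto_bounded_mul {w : Ω → ℝ} {K : ℝ} (hK : ∀ᵐ x ∂μ, |w x| ≤ K)
    {f : ℕ → Ω → ℂ} {f₀ : Ω → ℂ}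
    (tf : Tendsto (fun k => eLpNorm (fun x => f k x - f₀ x) 2 μ) atTop (𝓝 0)) :
    Tendsto (fun k => eLpNorm (fun x => (w x : ℂ) * f k x - (w x : ℂ) * f₀ x) 2 μ)
      atTop (𝓝 0) := by
  refine tendsto_eLpNorm_of_norm_le_mul (K := K) (fun k => ?_) tf
  filter_upwards [hK] with x hx
  rw [← mul_sub, norm_mul, Complex.norm_real]
  exact mul_le_mul_of_nonneg_right hx (norm_nonneg _)

end SquareIntegrable

/-! ### An abstract first-order calculus and its `H¹₀` closure. -/

/-- Test functions with first-order derivations `D a` on a measure space which integrate by parts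
against bounded divergences `div a`, whose derivatives are `ddiv a`. -/
structure FrameCalculus {Ω : Type*} [MeasurableSpace Ω] (μ : Measure Ω) (ι : Type*) where
  test : Set (Ω → ℂ)
  D : ι → (Ω → ℂ) → Ω → ℂ
  div : ι → Ω → ℝ
  ddiv : ι → Ω → ℝ
  bound : ℝ
  memLp_test : ∀ φ ∈ test, MemLp φ 2 μ
  memLp_D : ∀ φ ∈ test, ∀ a, MemLp (D a φ) 2 μ
  add_mem : ∀ φ ∈ test, ∀ χ ∈ test, (fun x => φ x + χ x) ∈ test
  D_add : ∀ φ ∈ test, ∀ χ ∈ test, ∀ a, D a (fun x => φ x + χ x) = fun x => D a φ x + D a χ x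
  comp_mem : ∀ F : ℂ → ℂ, ContDiff ℝ ∞ F → F 0 = 0 → ∀ φ ∈ test, (fun x => F (φ x)) ∈ test
  D_comp : ∀ F : ℂ → ℂ, ContDiff ℝ ∞ F → F 0 = 0 → ∀ φ ∈ test, ∀ a,
    D a (fun x => F (φ x)) = fun x => fderiv ℝ F (φ x) (D a φ x)
  aestronglyMeasurable_div : ∀ a, AEStronglyMeasurable (div a) μ
  aestronglyMeasurable_ddiv : ∀ a, AEStronglyMeasurable (ddiv a) μ
  abs_div_le : ∀ a, ∀ᵐ x ∂μ, |div a x| ≤ bound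
  abs_ddiv_le : ∀ a, ∀ᵐ x ∂μ, |ddiv a x| ≤ bound
  integral_conj_mul_D : ∀ φ ∈ test, ∀ χ ∈ test, ∀ a, ∫ x, conj (χ x) * D a φ x ∂μ =
    -∫ x, conj (D a χ x + div a x * χ x) * φ x ∂μ
  two_mul_re_integral_div : ∀ φ ∈ test, ∀ a,
    2 * (∫ x, conj ((div a x : ℂ) * φ x) * D a φ x ∂μ).re =
      -(∫ x, conj (φ x) * (((ddiv a x + div a x ^ 2 : ℝ) : ℂ) * φ x) ∂μ).re
  separating : ∀ α : Ω → ℂ, MemLp α 2 μ → (∀ χ ∈ test, ∫ x, conj (χ x) * α x ∂μ = 0) →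
    ∀ᵐ x ∂μ, α x = 0

namespace FrameCalculus

variable {Ω : Type*} [MeasurableSpace Ω] {μ : Measure Ω} {ι : Type*} (C : FrameCalculus μ ι)

/-- `(u, U)` is an `L²`-limit of test functions together with their derivatives. -/
def Mem (u : Ω → ℂ) (U : ι → Ω → ℂ) : Prop :=
  MemLp u 2 μ ∧ (∀ a, MemLp (U a) 2 μ) ∧ ∃ φ : ℕ → Ω → ℂ, (∀ k, φ k ∈ C.test) ∧
    Tendsto (fun k => eLpNorm (fun x => φ k x - u x) 2 μ) atTop (𝓝 0) ∧
    ∀ a, Tendsto (fun k => eLpNorm (fun x => C.D a (φ k) x - U a x) 2 μ) atTop (𝓝 0)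

variable {C} {u v : Ω → ℂ} {U W : ι → Ω → ℂ}

theorem contDiff_const_mul (c : ℂ) : ContDiff ℝ ∞ fun z : ℂ => c * z :=
  contDiff_const.mul contDiff_id

/-- Multiplication by a scalar is a smooth map fixing the origin, so closure under composition
already contains it. -/
theorem smul_mem (c : ℂ) {φ : Ω → ℂ} (hφ : φ ∈ C.test) : (fun x => c * φ x) ∈ C.test :=
  C.comp_mem (fun z => c * z) (contDiff_const_mul c) (mul_zero c) φ hφ

theorem D_smul (c : ℂ) {φ : Ω → ℂ} (hφ : φ ∈ C.test) (a : ι) :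
    C.D a (fun x => c * φ x) = fun x => c * C.D a φ x := by
  rw [C.D_comp (fun z => c * z) (contDiff_const_mul c) (mul_zero c) φ hφ a]
  funext x
  rw [fderiv_const_mul differentiableAt_fun_id]
  simp

theorem mem_test {φ : Ω → ℂ} (hφ : φ ∈ C.test) : C.Mem φ fun a => C.D a φ :=
  ⟨C.memLp_test φ hφ, C.memLp_D φ hφ, fun _ => φ, fun _ => hφ, tendsto_eLpNorm_sub_self φ,
    fun a => tendsto_eLpNorm_sub_self (C.D a φ)⟩

theorem Mem.add (hu : C.Mem u U) (hv : C.Mem v W) :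
    C.Mem (fun x => u x + v x) fun a x => U a x + W a x := by
  obtain ⟨hu1, hU1, φ, hφ, t1, t2⟩ := hu
  obtain ⟨hv1, hW1, χ, hχ, s1, s2⟩ := hv
  refine ⟨hu1.add hv1, fun a => (hU1 a).add (hW1 a), fun k x => φ k x + χ k x,
    fun k => C.add_mem _ (hφ k) _ (hχ k), ?_, fun a => ?_⟩
  · convert tendsto_eLpNorm_add (fun k => ((C.memLp_test _ (hφ k)).sub hu1).1)
      (fun k => ((C.memLp_test _ (hχ k)).sub hv1).1) t1 s1 using 5
    simp only [Pi.sub_apply]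
    ring
  · convert tendsto_eLpNorm_add (fun k => ((C.memLp_D _ (hφ k) a).sub (hU1 a)).1)
      (fun k => ((C.memLp_D _ (hχ k) a).sub (hW1 a)).1) (t2 a) (s2 a) using 5 with k x
    rw [C.D_add _ (hφ k) _ (hχ k)]
    simp only [Pi.sub_apply]
    ring

theorem Mem.const_mul (c : ℂ) (hu : C.Mem u U) :
    C.Mem (fun x => c * u x) fun a x => c * U a x := by
  obtain ⟨hu1, hU1, φ, hφ, t1, t2⟩ := hu
  refine ⟨hu1.const_mul c, fun a => (hU1 a).const_mul c, fun k x => c * φ k x,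
    fun k => smul_mem c (hφ k), ?_, fun a => ?_⟩
  · refine tendsto_eLpNorm_of_norm_le_mul (K := ‖c‖) (fun k => Eventually.of_forall fun x => ?_) t1
    rw [← mul_sub, norm_mul]
  · refine tendsto_eLpNorm_of_norm_le_mul (K := ‖c‖) (fun k => Eventually.of_forall fun x => ?_)
      (t2 a)
    rw [D_smul c (hφ k), ← mul_sub, norm_mul]

theorem Mem.sub (hu : C.Mem u U) (hv : C.Mem v W) :
    C.Mem (fun x => u x - v x) fun a x => U a x - W a x := by
  simpa only [neg_one_mul, ← sub_eq_add_neg] using hu.add (hv.const_mul (-1))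

/-- Closability of the derivations: integration by parts passes to the limit and leaves only `u` on
the other side, so `U a` is orthogonal to every test function. -/
theorem Mem.ae_eq_zero (hu : C.Mem u U) (h0 : ∀ᵐ x ∂μ, u x = 0) (a : ι) :
    ∀ᵐ x ∂μ, U a x = 0 := by
  obtain ⟨hu1, hU1, φ, hφ, t1, t2⟩ := hu
  refine C.separating _ (hU1 a) fun χ hχ => ?_
  have hg : MemLp (fun x => C.D a χ x + C.div a x * χ x) 2 μ :=
    (C.memLp_D χ hχ a).add (memLp_bounded_mul (C.aestronglyMeasurable_div a) (C.abs_div_le a)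
      (C.memLp_test χ hχ))
  have l1 := tendsto_integral_conj_mul (fun _ => C.memLp_test χ hχ)
    (fun k => C.memLp_D _ (hφ k) a) (C.memLp_test χ hχ) (hU1 a) (tendsto_eLpNorm_sub_self χ) (t2 a)
  have l2 := (tendsto_integral_conj_mul (fun _ => hg) (fun k => C.memLp_test _ (hφ k)) hg hu1
    (tendsto_eLpNorm_sub_self _) t1).neg
  have l3 : Tendsto (fun k => ∫ x, conj (χ x) * C.D a (φ k) x ∂μ) atTop
      (𝓝 (-∫ x, conj (C.D a χ x + C.div a x * χ x) * u x ∂μ)) := by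
    refine l2.congr fun k => ?_
    rw [C.integral_conj_mul_D _ (hφ k) χ hχ a]
  rw [tendsto_nhds_unique l1 l3, neg_eq_zero]
  refine integral_eq_zero_of_ae ?_
  filter_upwards [h0] with x hx
  simp [hx]

theorem Mem.unique (hu : C.Mem u U) (hv : C.Mem v W) (h : u =ᵐ[μ] v) (a : ι) :
    ∀ᵐ x ∂μ, U a x = W a x := by
  filter_upwards [(hu.sub hv).ae_eq_zero (by filter_upwards [h] with x hx; simp [hx]) a] with x hx
  exact sub_eq_zero.1 hx

theorem norm_sub_le_of_norm_fderiv_le {F : ℂ → ℂ} (hF : ContDiff ℝ ∞ F) {K : ℝ}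
    (hK : ∀ z, ‖fderiv ℝ F z‖ ≤ K) (z w : ℂ) : ‖F z - F w‖ ≤ K * ‖z - w‖ :=
  Convex.norm_image_sub_le_of_norm_fderiv_le (𝕜 := ℝ)
    (fun x _ => (hF.differentiable (by simp)) x) (fun x _ => hK x) convex_univ trivial trivial

theorem aestronglyMeasurable_fderiv_apply {F : ℂ → ℂ} (hF : ContDiff ℝ ∞ F) {f g : Ω → ℂ}
    (hf : AEStronglyMeasurable f μ) (hg : AEStronglyMeasurable g μ) :
    AEStronglyMeasurable (fun x => fderiv ℝ F (f x) (g x)) μ := by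
  have h1 : Continuous fun p : ℂ × ℂ => fderiv ℝ F p.1 p.2 :=
    ((hF.continuous_fderiv (by simp)).comp continuous_fst).clm_apply continuous_snd
  exact h1.comp_aestronglyMeasurable (hf.prodMk hg)

/-- The chain rule passes to limits because the derivative of `F` is bounded: this controls the
error in the derivatives and dominates the error in the coefficient. -/
theorem Mem.comp (hu : C.Mem u U) {F : ℂ → ℂ} (hF : ContDiff ℝ ∞ F) (hF0 : F 0 = 0) {K : ℝ}
    (hK : ∀ z, ‖fderiv ℝ F z‖ ≤ K) :
    C.Mem (fun x => F (u x)) fun a x => fderiv ℝ F (u x) (U a x) := by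
  obtain ⟨hu1, hU1, φ', hφ', t1', t2'⟩ := hu
  -- Pointwise convergence along a subsequence is needed for the coefficient `fderiv ℝ F (φ k x)` to
  -- converge.
  obtain ⟨ns, hns, hae⟩ := exists_subseq_tendsto_ae (fun k => C.memLp_test _ (hφ' k)) hu1 t1'
  set φ : ℕ → Ω → ℂ := fun k => φ' (ns k) with hφdef
  have hφ : ∀ k, φ k ∈ C.test := fun k => hφ' _
  have t1 : Tendsto (fun k => eLpNorm (fun x => φ k x - u x) 2 μ) atTop (𝓝 0) :=
    t1'.comp hns.tendsto_atTop
  have t2 : ∀ a, Tendsto (fun k => eLpNorm (fun x => C.D a (φ k) x - U a x) 2 μ) atTop (𝓝 0) :=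
    fun a => (t2' a).comp hns.tendsto_atTop
  have hle : ∀ z w, ‖fderiv ℝ F z w‖ ≤ K * ‖w‖ := fun z w =>
    (ContinuousLinearMap.le_opNorm _ _).trans
      (mul_le_mul_of_nonneg_right (hK z) (norm_nonneg _))
  refine ⟨?_, fun a => ?_, fun k x => F (φ k x), fun k => C.comp_mem F hF hF0 _ (hφ k), ?_,
    fun a => ?_⟩
  · refine hu1.of_le_mul (hF.continuous.comp_aestronglyMeasurable hu1.1)
      (Eventually.of_forall fun x => ?_) (c := K)
    simpa [hF0] using norm_sub_le_of_norm_fderiv_le hF hK (u x) 0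
  · exact (hU1 a).of_le_mul (aestronglyMeasurable_fderiv_apply hF hu1.1 (hU1 a).1)
      (Eventually.of_forall fun x => hle _ _) (c := K)
  · exact tendsto_eLpNorm_of_norm_le_mul (fun k => Eventually.of_forall fun x =>
      norm_sub_le_of_norm_fderiv_le hF hK _ _) t1
  -- With `F'` for the real derivative, the error splits as `F'(φ_k)(Dφ_k - U) + (F'(φ_k) -
  -- F'(u))U`. The first term tends to zero by the bound on `F'`, the second by dominated
  -- convergence.
  · have m1 : ∀ k, AEStronglyMeasurable (fun x => fderiv ℝ F (φ k x) (C.D a (φ k) x - U a x)) μ :=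
      fun k => aestronglyMeasurable_fderiv_apply hF (C.memLp_test _ (hφ k)).1
        ((C.memLp_D _ (hφ k) a).sub (hU1 a)).1
    have m2 : ∀ k, AEStronglyMeasurable (fun x => fderiv ℝ F (φ k x) (U a x)) μ :=
      fun k => aestronglyMeasurable_fderiv_apply hF (C.memLp_test _ (hφ k)).1 (hU1 a).1
    have s1 : Tendsto (fun k => eLpNorm
        (fun x => fderiv ℝ F (φ k x) (C.D a (φ k) x - U a x)) 2 μ) atTop (𝓝 0) :=
      tendsto_eLpNorm_of_norm_le_mul (fun k => Eventually.of_forall fun x => hle _ _) (t2 a)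
    have s2 := (memLp_and_tendsto_eLpNorm_of_dominated (hU1 a) m2
      (fun k => Eventually.of_forall fun x => hle _ _)
      (f₀ := fun x => fderiv ℝ F (u x) (U a x)) (by
        filter_upwards [hae] with x hx
        exact ((((hF.continuous_fderiv (by simp)).clm_apply continuous_const).tendsto _).comp hx
          : Tendsto _ _ (𝓝 (fderiv ℝ F (u x) (U a x)))))).2
    have s3 := tendsto_eLpNorm_add m1 (fun k => (m2 k).sub
      (aestronglyMeasurable_fderiv_apply hF hu1.1 (hU1 a).1)) s1 s2
    convert s3 using 5 with k x
    rw [C.D_comp F hF hF0 _ (hφ k)]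
    simp only [map_sub, Pi.sub_apply]
    ring

/-- A diagonal argument. With finitely many derivations one test function approximates all
components at once to within `1/(j+1)`. -/
theorem Mem.of_tendsto [Finite ι] {w : ℕ → Ω → ℂ} {Z : ℕ → ι → Ω → ℂ}
    (hw : ∀ j, C.Mem (w j) (Z j))
    (hu : MemLp u 2 μ) (hU : ∀ a, MemLp (U a) 2 μ)
    (t1 : Tendsto (fun j => eLpNorm (fun x => w j x - u x) 2 μ) atTop (𝓝 0))
    (t2 : ∀ a, Tendsto (fun j => eLpNorm (fun x => Z j a x - U a x) 2 μ) atTop (𝓝 0)) :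
    C.Mem u U := by
  have hex : ∀ j : ℕ, ∃ φ ∈ C.test,
      eLpNorm (fun x => φ x - w j x) 2 μ < ((j : ℝ≥0∞) + 1)⁻¹ ∧
      ∀ a, eLpNorm (fun x => C.D a φ x - Z j a x) 2 μ < ((j : ℝ≥0∞) + 1)⁻¹ := by
    intro j
    obtain ⟨-, -, φ, hφ, s1, s2⟩ := hw j
    have hpos : (0 : ℝ≥0∞) < ((j : ℝ≥0∞) + 1)⁻¹ := by
      simp [ENNReal.inv_pos]
    have e1 := s1.eventually_lt_const hpos
    have e2 := eventually_all.2 fun a => (s2 a).eventually_lt_const hpos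
    obtain ⟨k, hk1, hk2⟩ := (e1.and e2).exists
    exact ⟨φ k, hφ k, hk1, hk2⟩
  choose φ hφ h1 h2 using hex
  have hinv : Tendsto (fun j : ℕ => ((j : ℝ≥0∞) + 1)⁻¹) atTop (𝓝 0) := by
    have := (tendsto_add_atTop_iff_nat 1).2 ENNReal.tendsto_inv_nat_nhds_zero
    simpa using this
  have s1 : Tendsto (fun j => eLpNorm (fun x => φ j x - w j x) 2 μ) atTop (𝓝 0) :=
    tendsto_of_tendsto_of_tendsto_of_le_of_le tendsto_const_nhds hinv (fun _ => zero_le)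
      fun j => (h1 j).le
  have s2 : ∀ a, Tendsto (fun j => eLpNorm (fun x => C.D a (φ j) x - Z j a x) 2 μ)
      atTop (𝓝 0) := fun a =>
    tendsto_of_tendsto_of_tendsto_of_le_of_le tendsto_const_nhds hinv (fun _ => zero_le)
      fun j => (h2 j a).le
  refine ⟨hu, hU, φ, hφ, ?_, fun a => ?_⟩
  · convert tendsto_eLpNorm_add (fun j => ((C.memLp_test _ (hφ j)).sub (hw j).1).1)
      (fun j => ((hw j).1.sub hu).1) s1 t1 using 5
    simp
  · convert tendsto_eLpNorm_add (fun j => ((C.memLp_D _ (hφ j) a).sub ((hw j).2.1 a)).1)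
      (fun j => (((hw j).2.1 a).sub (hU a)).1) (s2 a) (t2 a) using 5
    simp

/-- Only pointwise limits and a uniform derivative bound are required, so `G` need not be
differentiable and `L` may be discontinuous in its first argument. Both later uses, the modulus and
the zero set, exploit this. -/
theorem Mem.comp_limit [Finite ι] (hu : C.Mem u U) {F : ℕ → ℂ → ℂ} (hF : ∀ j, ContDiff ℝ ∞ (F j))
    (hF0 : ∀ j, F j 0 = 0) {K : ℝ} (hK : ∀ j z, ‖fderiv ℝ (F j) z‖ ≤ K) {G : ℂ → ℂ}
    {L : ℂ → ℂ → ℂ} (hG : ∀ z, Tendsto (fun j => F j z) atTop (𝓝 (G z)))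
    (hL : ∀ z w, Tendsto (fun j => fderiv ℝ (F j) z w) atTop (𝓝 (L z w))) :
    C.Mem (fun x => G (u x)) fun a x => L (u x) (U a x) := by
  have hmem := fun j => hu.comp (hF j) (hF0 j) (hK j)
  have h1 := memLp_and_tendsto_eLpNorm_of_dominated hu.1 (fun j => (hmem j).1.1) (K := K)
    (fun j => Eventually.of_forall fun x => by
      simpa [hF0] using norm_sub_le_of_norm_fderiv_le (hF j) (hK j) (u x) 0)
    (Eventually.of_forall fun x => hG (u x))
  have h2 := fun a => memLp_and_tendsto_eLpNorm_of_dominated (hu.2.1 a)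
    (fun j => ((hmem j).2.1 a).1) (K := K)
    (fun j => Eventually.of_forall fun x => (ContinuousLinearMap.le_opNorm _ _).trans
      (mul_le_mul_of_nonneg_right (hK j (u x)) (norm_nonneg _)))
    (Eventually.of_forall fun x => hL (u x) (U a x))
  exact Mem.of_tendsto hmem h1.1 (fun a => (h2 a).1) h1.2 fun a => (h2 a).2

end FrameCalculus

/-! ### The modulus and the zero set of an `H¹₀` function; integration by parts in `H¹₀`. -/

/-- A smooth approximation of the modulus which vanishes at the origin. -/
noncomputable def smoothNorm (t : ℝ) (z : ℂ) : ℂ := ((√(‖z‖ ^ 2 + t) - √t : ℝ) : ℂ)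

theorem contDiff_smoothNorm {t : ℝ} (ht : 0 < t) : ContDiff ℝ ∞ (smoothNorm t) := by
  refine Complex.ofRealCLM.contDiff.comp ?_
  refine (ContDiff.sqrt ((contDiff_norm_sq ℝ).add contDiff_const) fun z => ?_).sub contDiff_const
  positivity

theorem fderiv_smoothNorm {t : ℝ} (ht : 0 < t) (z w : ℂ) :
    fderiv ℝ (smoothNorm t) z w = ((inner ℝ z w / √(‖z‖ ^ 2 + t) : ℝ) : ℂ) := by
  have hpos : ‖z‖ ^ 2 + t ≠ 0 := by positivity
  have h1 := ((((hasStrictFDerivAt_norm_sq z).hasFDerivAt).add_const t).sqrt hpos).sub_const √t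
  have h2 := Complex.ofRealCLM.hasFDerivAt.comp z h1
  have h3 : fderiv ℝ (smoothNorm t) z = _ := h2.fderiv
  rw [h3]
  have hs : √(‖z‖ ^ 2 + t) ≠ 0 := (Real.sqrt_pos.2 (by positivity)).ne'
  simp only [ContinuousLinearMap.comp_apply, smul_apply, innerSL_apply_apply,
    Complex.ofRealCLM_apply, smul_eq_mul, nsmul_eq_mul]
  congr 1
  field_simp
  norm_num

theorem norm_fderiv_smoothNorm_le {t : ℝ} (ht : 0 < t) (z : ℂ) :
    ‖fderiv ℝ (smoothNorm t) z‖ ≤ 1 := by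
  refine ContinuousLinearMap.opNorm_le_bound _ zero_le_one fun w => ?_
  rw [fderiv_smoothNorm ht, Complex.norm_real, norm_div, one_mul,
    Real.norm_of_nonneg (Real.sqrt_nonneg _), div_le_iff₀ (Real.sqrt_pos.2 (by positivity))]
  have h1 : ‖z‖ ≤ √(‖z‖ ^ 2 + t) := Real.le_sqrt_of_sq_le (by linarith)
  calc ‖inner ℝ z w‖ ≤ ‖z‖ * ‖w‖ := norm_inner_le_norm _ _
    _ ≤ ‖w‖ * √(‖z‖ ^ 2 + t) := by rw [mul_comm]; gcongr

/-- A smooth cut-off of the identity of `ℂ` to a neighbourhood of the origin. -/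
noncomputable def smoothSpike (t : ℝ) (z : ℂ) : ℂ := (t / (t + ‖z‖ ^ 2)) • z

theorem contDiff_smoothSpike {t : ℝ} (ht : 0 < t) : ContDiff ℝ ∞ (smoothSpike t) := by
  refine ContDiff.smul (contDiff_const.div (contDiff_const.add (contDiff_norm_sq ℝ)) fun z => ?_)
    contDiff_id
  positivity

theorem fderiv_smoothSpike {t : ℝ} (ht : 0 < t) (z w : ℂ) :
    fderiv ℝ (smoothSpike t) z w =
      (t / (t + ‖z‖ ^ 2)) • w - (2 * t * inner ℝ z w / (t + ‖z‖ ^ 2) ^ 2) • z := by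
  have hpos : t + ‖z‖ ^ 2 ≠ 0 := by positivity
  have h1 := (hasDerivAt_inv hpos).comp_hasFDerivAt z
    (((hasStrictFDerivAt_norm_sq z).hasFDerivAt).const_add t)
  have h2 := (h1.const_mul t).smul (hasFDerivAt_id z)
  have h3 : smoothSpike t =
      (fun y => t * ((fun y => y⁻¹) ∘ fun x : ℂ => t + ‖x‖ ^ 2) y) • (id : ℂ → ℂ) := rfl
  rw [h3, h2.fderiv]
  simp only [add_apply, smul_apply, innerSL_apply_apply, Function.comp_apply,
    ContinuousLinearMap.smulRight_apply, smul_eq_mul, nsmul_eq_mul,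
    ContinuousLinearMap.coe_id', id, div_eq_mul_inv, sub_eq_add_neg, ← neg_smul]
  congr 2
  push_cast
  ring

/-- What matters is uniformity in `t`. The maps tend to zero pointwise as `t → 0`, while their
derivatives at the origin remain the identity. -/
theorem norm_fderiv_smoothSpike_le {t : ℝ} (ht : 0 < t) (z : ℂ) :
    ‖fderiv ℝ (smoothSpike t) z‖ ≤ 3 := by
  refine ContinuousLinearMap.opNorm_le_bound _ (by norm_num) fun w => ?_
  have hs : 0 < t + ‖z‖ ^ 2 := by positivity
  rw [fderiv_smoothSpike ht]
  have h1 : ‖(t / (t + ‖z‖ ^ 2)) • w‖ ≤ ‖w‖ := by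
    rw [norm_smul, Real.norm_of_nonneg (by positivity)]
    refine mul_le_of_le_one_left (norm_nonneg _) ?_
    rw [div_le_one hs]
    nlinarith [sq_nonneg ‖z‖]
  -- Cauchy–Schwarz together with `t‖z‖² ≤ (t + ‖z‖²)²`; the constant `3` is this `2` plus the `1`
  -- of the first term.
  have h2 : ‖(2 * t * inner ℝ z w / (t + ‖z‖ ^ 2) ^ 2) • z‖ ≤ 2 * ‖w‖ := by
    rw [norm_smul, norm_div, norm_mul, Real.norm_of_nonneg (by positivity : 0 ≤ 2 * t),
      Real.norm_of_nonneg (by positivity : 0 ≤ (t + ‖z‖ ^ 2) ^ 2), div_mul_eq_mul_div,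
      div_le_iff₀ (by positivity)]
    calc 2 * t * ‖inner ℝ z w‖ * ‖z‖ ≤ 2 * t * (‖z‖ * ‖w‖) * ‖z‖ := by
          gcongr
          exact norm_inner_le_norm _ _
      _ = 2 * ‖w‖ * (t * ‖z‖ ^ 2) := by ring
      _ ≤ 2 * ‖w‖ * (t + ‖z‖ ^ 2) ^ 2 := by
          gcongr
          nlinarith [sq_nonneg (‖z‖ ^ 2), mul_nonneg ht.le (sq_nonneg ‖z‖), sq_nonneg t]
  calc _ ≤ _ := norm_sub_le _ _
    _ ≤ 3 * ‖w‖ := by linarith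

namespace FrameCalculus

variable {Ω : Type*} [MeasurableSpace Ω] {μ : Measure Ω} {ι : Type*} {C : FrameCalculus μ ι}
  {u v : Ω → ℂ} {U W : ι → Ω → ℂ}

/-- The modulus of an `H¹₀` function is again in `H¹₀`. -/
theorem Mem.norm [Finite ι] (hu : C.Mem u U) :
    C.Mem (fun x => ((‖u x‖ : ℝ) : ℂ)) fun a x => ((inner ℝ (u x) (U a x) / ‖u x‖ : ℝ) : ℂ) := by
  have ht : ∀ j : ℕ, (0 : ℝ) < 1 / ((j : ℝ) + 1) := fun j => by positivity
  have hlim : Tendsto (fun j : ℕ => 1 / ((j : ℝ) + 1)) atTop (𝓝 0) :=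
    tendsto_one_div_add_atTop_nhds_zero_nat
  have hsq : ∀ z : ℂ, Tendsto (fun j : ℕ => √(‖z‖ ^ 2 + 1 / ((j : ℝ) + 1))) atTop (𝓝 ‖z‖) := by
    intro z
    have := (hlim.const_add (‖z‖ ^ 2)).sqrt
    rwa [add_zero, Real.sqrt_sq (norm_nonneg _)] at this
  refine hu.comp_limit (F := fun j => smoothNorm (1 / ((j : ℝ) + 1)))
    (G := fun z => ((‖z‖ : ℝ) : ℂ)) (L := fun z w => ((inner ℝ z w / ‖z‖ : ℝ) : ℂ))
    (fun j => contDiff_smoothNorm (ht j)) (fun j => by simp [smoothNorm])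
    (fun j z => norm_fderiv_smoothNorm_le (ht j) z) (fun z => ?_) fun z w => ?_
  · have := ((hsq z).sub hlim.sqrt)
    rw [Real.sqrt_zero, sub_zero] at this
    exact (Complex.continuous_ofReal.tendsto _).comp this
  · simp only [fderiv_smoothNorm (ht _)]
    refine (Complex.continuous_ofReal.tendsto _).comp ?_
    -- At `z = 0` every approximating derivative is zero, which matches the convention `0 / 0 = 0`
    -- in the limit.
    rcases eq_or_ne z 0 with rfl | hz
    · simp
    · exact tendsto_const_nhds.div (hsq z) (norm_ne_zero_iff.2 hz)

/-- The derivative of an `H¹₀` function vanishes almost everywhere on its zero set. -/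
theorem Mem.ae_eq_zero_of_eq_zero [Finite ι] (hu : C.Mem u U) (a : ι) :
    ∀ᵐ x ∂μ, u x = 0 → U a x = 0 := by
  classical
  have ht : ∀ j : ℕ, (0 : ℝ) < 1 / ((j : ℝ) + 1) := fun j => by positivity
  have hlim : Tendsto (fun j : ℕ => 1 / ((j : ℝ) + 1)) atTop (𝓝 0) :=
    tendsto_one_div_add_atTop_nhds_zero_nat
  have hs : ∀ z : ℂ, Tendsto (fun j : ℕ => 1 / ((j : ℝ) + 1) + ‖z‖ ^ 2) atTop (𝓝 (‖z‖ ^ 2)) :=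
    fun z => by simpa using hlim.add_const (‖z‖ ^ 2)
  have hq : ∀ z : ℂ, z ≠ 0 → Tendsto (fun j : ℕ => 1 / ((j : ℝ) + 1) /
      (1 / ((j : ℝ) + 1) + ‖z‖ ^ 2)) atTop (𝓝 0) := fun z hz => by
    have := hlim.div (hs z) (by positivity)
    rwa [zero_div] at this
  -- The limit function is zero, yet its derivative comes out as `U a` on the zero set of `u` and
  -- zero elsewhere. Uniqueness of the derivative then forces `U a = 0` a.e. on that set.
  have h := hu.comp_limit (F := fun j => smoothSpike (1 / ((j : ℝ) + 1)))
    (G := fun _ => 0) (L := fun z w => if z = 0 then w else 0)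
    (fun j => contDiff_smoothSpike (ht j)) (fun j => by simp [smoothSpike])
    (fun j z => norm_fderiv_smoothSpike_le (ht j) z) (fun z => ?_) fun z w => ?_
  · filter_upwards [h.ae_eq_zero (Eventually.of_forall fun _ => rfl) a] with x hx h0
    simpa [h0] using hx
  · rcases eq_or_ne z 0 with rfl | hz
    · simp [smoothSpike]
    · have := (hq z hz).smul_const z
      rwa [zero_smul] at this
  · simp only [fderiv_smoothSpike (ht _)]
    rcases eq_or_ne z 0 with rfl | hz
    · have : ∀ j : ℕ, (1 / ((j : ℝ) + 1)) / (1 / ((j : ℝ) + 1) + ‖(0 : ℂ)‖ ^ 2) = 1 := fun j => by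
        rw [norm_zero, zero_pow two_ne_zero, add_zero, div_self (ht j).ne']
      simp only [this]
      simp
    · have h1 := (hq z hz).smul_const w
      have h2 := (((hlim.const_mul 2).mul_const (inner ℝ z w)).div ((hs z).pow 2)
        (by positivity)).smul_const z
      simpa [hz] using h1.sub h2

/-- Integration by parts of `re (conj u * U a)` in `H¹₀`. -/
theorem Mem.two_mul_re_integral (hu : C.Mem u U) (a : ι) :
    2 * (∫ x, conj (u x) * U a x ∂μ).re = -(∫ x, conj (u x) * ((C.div a x : ℂ) * u x) ∂μ).re := by
  obtain ⟨hu1, hU1, φ, hφ, t1, t2⟩ := hu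
  have l1 := tendsto_integral_conj_mul (fun k => C.memLp_test _ (hφ k))
    (fun k => C.memLp_D _ (hφ k) a) hu1 (hU1 a) t1 (t2 a)
  have hb : ∀ {f : Ω → ℂ}, MemLp f 2 μ → MemLp (fun x => (C.div a x : ℂ) * f x) 2 μ :=
    memLp_bounded_mul (C.aestronglyMeasurable_div a) (C.abs_div_le a)
  have l2 := tendsto_integral_conj_mul (fun k => C.memLp_test _ (hφ k))
    (fun k => hb (C.memLp_test _ (hφ k))) hu1 (hb hu1) t1 (tendsto_bounded_mul (C.abs_div_le a) t1)
  refine tendsto_nhds_unique (((Complex.continuous_re.tendsto _).comp l1).const_mul 2)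
    ((((Complex.continuous_re.tendsto _).comp l2).neg).congr fun k => ?_)
  have h0 := C.memLp_test _ (hφ k)
  have h1 := C.memLp_D _ (hφ k) a
  have key := C.integral_conj_mul_D _ (hφ k) _ (hφ k) a
  have e : ∫ x, conj (C.D a (φ k) x + C.div a x * φ k x) * φ k x ∂μ =
      conj (∫ x, conj (φ k x) * C.D a (φ k) x ∂μ) +
        ∫ x, conj (φ k x) * ((C.div a x : ℂ) * φ k x) ∂μ := by
    have hi : Integrable (fun x => conj (conj (φ k x) * C.D a (φ k) x)) μ := by
      simpa only [map_mul, Complex.conj_conj, mul_comm] using integrable_conj_mul h1 h0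
    rw [← integral_conj, ← integral_add hi (integrable_conj_mul h0 (hb h0))]
    refine integral_congr_ae (Eventually.of_forall fun x => ?_)
    simp only [map_add, map_mul, Complex.conj_conj, Complex.conj_ofReal]
    ring
  rw [e] at key
  have := congrArg Complex.re key
  simp only [Complex.neg_re, Complex.add_re, Complex.conj_re] at this
  simp only [Function.comp_apply]
  linarith

/-- Integration by parts of `re (conj (div a * u) * U a)` in `H¹₀`. -/
theorem Mem.two_mul_re_integral_div (hu : C.Mem u U) (a : ι) :
    2 * (∫ x, conj ((C.div a x : ℂ) * u x) * U a x ∂μ).re =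
      -(∫ x, conj (u x) * (((C.ddiv a x + C.div a x ^ 2 : ℝ) : ℂ) * u x) ∂μ).re := by
  obtain ⟨hu1, hU1, φ, hφ, t1, t2⟩ := hu
  have hb : ∀ {f : Ω → ℂ}, MemLp f 2 μ → MemLp (fun x => (C.div a x : ℂ) * f x) 2 μ :=
    memLp_bounded_mul (C.aestronglyMeasurable_div a) (C.abs_div_le a)
  have hK : ∀ᵐ x ∂μ, |C.ddiv a x + C.div a x ^ 2| ≤ C.bound + C.bound ^ 2 := by
    filter_upwards [C.abs_div_le a, C.abs_ddiv_le a] with x h1 h2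
    refine (abs_add_le _ _).trans (add_le_add h2 ?_)
    rw [abs_pow]
    gcongr
  have hc : ∀ {f : Ω → ℂ}, MemLp f 2 μ →
      MemLp (fun x => ((C.ddiv a x + C.div a x ^ 2 : ℝ) : ℂ) * f x) 2 μ :=
    memLp_bounded_mul ((C.aestronglyMeasurable_ddiv a).add
      ((C.aestronglyMeasurable_div a).pow 2)) hK
  have l1 := tendsto_integral_conj_mul (fun k => hb (C.memLp_test _ (hφ k)))
    (fun k => C.memLp_D _ (hφ k) a) (hb hu1) (hU1 a) (tendsto_bounded_mul (C.abs_div_le a) t1)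
    (t2 a)
  have l2 := tendsto_integral_conj_mul (fun k => C.memLp_test _ (hφ k))
    (fun k => hc (C.memLp_test _ (hφ k))) hu1 (hc hu1) t1 (tendsto_bounded_mul hK t1)
  refine tendsto_nhds_unique (((Complex.continuous_re.tendsto _).comp l1).const_mul 2)
    ((((Complex.continuous_re.tendsto _).comp l2).neg).congr fun k => ?_)
  exact (C.two_mul_re_integral_div _ (hφ k) a).symm

end FrameCalculus

/-! ### The variance identity. -/

theorem integral_norm_sq_add {Ω : Type*} [MeasurableSpace Ω] {μ : Measure Ω} {f g : Ω → ℂ}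
    (hf : MemLp f 2 μ) (hg : MemLp g 2 μ) :
    ∫ x, ‖f x + g x‖ ^ 2 ∂μ =
      ∫ x, ‖f x‖ ^ 2 ∂μ + 2 * (∫ x, conj (g x) * f x ∂μ).re + ∫ x, ‖g x‖ ^ 2 ∂μ := by
  have h1 := (integrable_conj_mul hg hf).re
  have e : (∫ x, conj (g x) * f x ∂μ).re = ∫ x, (conj (g x) * f x).re ∂μ :=
    (integral_re (integrable_conj_mul hg hf)).symm
  have h2 : Integrable (fun x => 2 * (conj (g x) * f x).re) μ := h1.const_mul 2
  rw [e, ← integral_const_mul, ← integral_add (integrable_norm_sq hf) h2,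
    ← integral_add (show Integrable (fun x => ‖f x‖ ^ 2 + 2 * (conj (g x) * f x).re) μ from
      (integrable_norm_sq hf).add h2) (integrable_norm_sq hg)]
  refine integral_congr_ae (Eventually.of_forall fun x => ?_)
  simp only [← Complex.normSq_eq_norm_sq, Complex.normSq_apply, Complex.add_re, Complex.add_im,
    Complex.mul_re, Complex.conj_re, Complex.conj_im]
  ring

theorem integral_conj_mul_ofReal_mul {Ω : Type*} [MeasurableSpace Ω] {μ : Measure Ω} (w : Ω → ℝ)
    (f : Ω → ℂ) :
    ∫ x, conj (f x) * ((w x : ℂ) * f x) ∂μ = ((∫ x, w x * ‖f x‖ ^ 2 ∂μ : ℝ) : ℂ) := by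
  rw [← integral_complex_ofReal]
  refine integral_congr_ae (Eventually.of_forall fun x => ?_)
  simp only [Complex.ofReal_mul, ← Complex.normSq_eq_norm_sq, Complex.normSq_eq_conj_mul_self]
  ring

theorem im_conj_mul_eq (z w : ℂ) : (conj z * w).im = (w / z).im * ‖z‖ ^ 2 := by
  rcases eq_or_ne z 0 with rfl | hz
  · simp
  · have h : conj z * w = (w / z) * ((‖z‖ ^ 2 : ℝ) : ℂ) := by
      rw [← Complex.normSq_eq_norm_sq, Complex.normSq_eq_conj_mul_self]
      field_simp
    rw [h, Complex.im_mul_ofReal]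

/-- Writing `w = (w / z) z`, the real part of `w / z` changes the modulus of `z` and the imaginary
part its argument; the two directions are orthogonal. -/
theorem norm_sq_eq_radial_add_angular {z : ℂ} (w : ℂ) (hz : z ≠ 0) :
    ‖w‖ ^ 2 = (inner ℝ z w / ‖z‖) ^ 2 + ((w / z).im * ‖z‖) ^ 2 := by
  have h : w = (w / z) * z := by field_simp
  have h1 : (inner ℝ z w : ℝ) = (w / z).re * ‖z‖ ^ 2 := by
    have h2 : conj z * w = (w / z) * ((‖z‖ ^ 2 : ℝ) : ℂ) := by
      rw [← Complex.normSq_eq_norm_sq, Complex.normSq_eq_conj_mul_self]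
      field_simp
    rw [Complex.inner, mul_comm w, h2, Complex.re_mul_ofReal]
  have h3 : ‖w‖ ^ 2 = ((w / z).re ^ 2 + (w / z).im ^ 2) * ‖z‖ ^ 2 := by
    conv_lhs => rw [h, norm_mul, mul_pow, ← Complex.normSq_eq_norm_sq (w / z),
      Complex.normSq_apply]
    ring
  have hz' : ‖z‖ ≠ 0 := norm_ne_zero_iff.2 hz
  rw [h1, h3]
  field_simp

namespace FrameCalculus

variable {Ω : Type*} [MeasurableSpace Ω] {μ : Measure Ω} {ι : Type*}
  {C : FrameCalculus μ ι} {u v : Ω → ℂ} {U W : ι → Ω → ℂ}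

theorem integrable_bounded_mul_norm_sq {w : Ω → ℝ} {K : ℝ} (hw : AEStronglyMeasurable w μ)
    (hK : ∀ᵐ x ∂μ, |w x| ≤ K) {f : Ω → ℂ} (hf : MemLp f 2 μ) :
    Integrable (fun x => w x * ‖f x‖ ^ 2) μ :=
  (integrable_norm_sq hf).bdd_mul hw hK

theorem integrable_div_sq_mul_norm_sq (a : ι) {f : Ω → ℂ} (hf : MemLp f 2 μ) :
    Integrable (fun x => C.div a x ^ 2 * ‖f x‖ ^ 2) μ := by
  refine integrable_bounded_mul_norm_sq (K := C.bound ^ 2)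
    ((C.aestronglyMeasurable_div a).pow 2) ?_ hf
  filter_upwards [C.abs_div_le a] with x h1
  rw [Pi.pow_apply, abs_pow]
  gcongr

/-- The mean is purely imaginary: integration by parts gives `Re ∫ conj u · U = -½ ∫ div |u|²`,
which the symmetrising term cancels. -/
theorem Mem.norm_integral_sq (hu : C.Mem u U) (a : ι) :
    ‖∫ x, conj (u x) * (U a x + (1 / 2) * (C.div a x : ℂ) * u x) ∂μ‖ ^ 2 =
      (∫ x, (conj (u x) * U a x).im ∂μ) ^ 2 := by
  have hb := memLp_bounded_mul (C.aestronglyMeasurable_div a) (C.abs_div_le a) hu.1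
  have e : ∫ x, conj (u x) * (U a x + (1 / 2) * (C.div a x : ℂ) * u x) ∂μ =
      ∫ x, conj (u x) * U a x ∂μ + (1 / 2) * ∫ x, conj (u x) * ((C.div a x : ℂ) * u x) ∂μ := by
    rw [← integral_const_mul, ← integral_add (integrable_conj_mul hu.1 (hu.2.1 a))
      ((integrable_conj_mul hu.1 hb).const_mul _)]
    refine integral_congr_ae (Eventually.of_forall fun x => ?_)
    ring
  have h1 := hu.two_mul_re_integral a
  have h3 : (∫ x, conj (u x) * U a x ∂μ).im = ∫ x, (conj (u x) * U a x).im ∂μ :=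
    (integral_im (integrable_conj_mul hu.1 (hu.2.1 a))).symm
  rw [integral_conj_mul_ofReal_mul] at h1 e
  rw [Complex.ofReal_re] at h1
  rw [e, ← Complex.normSq_eq_norm_sq, Complex.normSq_apply, ← h3]
  have e2 : ((1 / 2 : ℂ) * ((∫ x, C.div a x * ‖u x‖ ^ 2 ∂μ : ℝ) : ℂ)) =
      (((1 / 2) * ∫ x, C.div a x * ‖u x‖ ^ 2 ∂μ : ℝ) : ℂ) := by push_cast; ring
  rw [e2, Complex.add_re, Complex.add_im, Complex.ofReal_re, Complex.ofReal_im]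
  have : (∫ x, conj (u x) * U a x ∂μ).re + (1 / 2) * ∫ x, C.div a x * ‖u x‖ ^ 2 ∂μ = 0 := by
    linarith
  rw [this]
  ring

/-- The cross term of the square is `Re ∫ conj (div · u) U = -½ ∫ (ddiv + div²)|u|²`. Together with
the `+¼ ∫ div²|u|²` of the square, this leaves the coefficient `-¼`. -/
theorem Mem.integral_norm_sq_symmetrised (hu : C.Mem u U) (a : ι) :
    ∫ x, ‖U a x + (1 / 2) * (C.div a x : ℂ) * u x‖ ^ 2 ∂μ =
      ∫ x, ‖U a x‖ ^ 2 ∂μ - (1 / 2) * ∫ x, C.ddiv a x * ‖u x‖ ^ 2 ∂μ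
        - (1 / 4) * ∫ x, C.div a x ^ 2 * ‖u x‖ ^ 2 ∂μ := by
  have hb := memLp_bounded_mul (C.aestronglyMeasurable_div a) (C.abs_div_le a) hu.1
  have h0 := integral_norm_sq_add (hu.2.1 a) (hb.const_mul (1 / 2 : ℂ))
  have e1 : ∫ x, conj ((1 / 2 : ℂ) * ((C.div a x : ℂ) * u x)) * U a x ∂μ =
      ((1 / 2 : ℝ) : ℂ) * ∫ x, conj ((C.div a x : ℂ) * u x) * U a x ∂μ := by
    rw [← integral_const_mul]
    refine integral_congr_ae (Eventually.of_forall fun x => ?_)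
    have h2 : conj (2 : ℂ) = 2 := Complex.conj_ofNat 2
    simp only [map_mul, map_div₀, map_one, h2]
    push_cast
    ring
  have e2 : ∫ x, ‖(1 / 2 : ℂ) * ((C.div a x : ℂ) * u x)‖ ^ 2 ∂μ =
      (1 / 4) * ∫ x, C.div a x ^ 2 * ‖u x‖ ^ 2 ∂μ := by
    rw [← integral_const_mul]
    refine integral_congr_ae (Eventually.of_forall fun x => ?_)
    simp only [norm_mul, Complex.norm_real, mul_pow, Real.norm_eq_abs, sq_abs]
    norm_num
  have h1 := hu.two_mul_re_integral_div a
  rw [integral_conj_mul_ofReal_mul, Complex.ofReal_re] at h1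
  have e3 : ∫ x, (C.ddiv a x + C.div a x ^ 2) * ‖u x‖ ^ 2 ∂μ =
      ∫ x, C.ddiv a x * ‖u x‖ ^ 2 ∂μ + ∫ x, C.div a x ^ 2 * ‖u x‖ ^ 2 ∂μ := by
    rw [← integral_add (integrable_bounded_mul_norm_sq (C.aestronglyMeasurable_ddiv a)
      (C.abs_ddiv_le a) hu.1) (integrable_div_sq_mul_norm_sq a hu.1)]
    refine integral_congr_ae (Eventually.of_forall fun x => ?_)
    ring
  rw [e1, e2, Complex.re_ofReal_mul] at h0
  simp only [← mul_assoc] at h0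
  rw [h0]
  linarith

variable [Fintype ι]

/-- The potential `½ ∑ₐ X_a(f_a) + ¼ ∑ₐ f_a²`. -/
noncomputable def pot (C : FrameCalculus μ ι) (x : Ω) : ℝ :=
  (1 / 2) * ∑ a, C.ddiv a x + (1 / 4) * ∑ a, C.div a x ^ 2

/-- The variance of the symmetrised derivations plus the mean of the potential. -/
noncomputable def variance (C : FrameCalculus μ ι) (u : Ω → ℂ) (U : ι → Ω → ℂ) : ℝ :=
  ∑ a, ((∫ x, ‖U a x + (1 / 2) * (C.div a x : ℂ) * u x‖ ^ 2 ∂μ) -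
    ‖∫ x, conj (u x) * (U a x + (1 / 2) * (C.div a x : ℂ) * u x) ∂μ‖ ^ 2) +
  ∫ x, C.pot x * ‖u x‖ ^ 2 ∂μ

/-- The potential is exactly the sum of the corrections in `Mem.integral_norm_sq_symmetrised`, and
the two cancel. -/
theorem Mem.variance_eq (hu : C.Mem u U) :
    C.variance u U = ∑ a, (∫ x, ‖U a x‖ ^ 2 ∂μ - (∫ x, (conj (u x) * U a x).im ∂μ) ^ 2) := by
  have i1 := fun a => integrable_bounded_mul_norm_sq (C.aestronglyMeasurable_ddiv a)
      (C.abs_ddiv_le a) hu.1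
  have i2 := fun a => integrable_div_sq_mul_norm_sq (C := C) a hu.1
  have e : ∫ x, C.pot x * ‖u x‖ ^ 2 ∂μ = ∑ a, ((1 / 2) * ∫ x, C.ddiv a x * ‖u x‖ ^ 2 ∂μ +
      (1 / 4) * ∫ x, C.div a x ^ 2 * ‖u x‖ ^ 2 ∂μ) := by
    have : ∀ a, (1 / 2) * ∫ x, C.ddiv a x * ‖u x‖ ^ 2 ∂μ +
        (1 / 4) * ∫ x, C.div a x ^ 2 * ‖u x‖ ^ 2 ∂μ = ∫ x, ((1 / 2) * (C.ddiv a x * ‖u x‖ ^ 2) +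
          (1 / 4) * (C.div a x ^ 2 * ‖u x‖ ^ 2)) ∂μ := by
      intro a
      rw [integral_add ((i1 a).const_mul _) ((i2 a).const_mul _), integral_const_mul,
        integral_const_mul]
    simp only [this]
    have i3 : ∀ a, Integrable (fun x => (1 / 2) * (C.ddiv a x * ‖u x‖ ^ 2) +
        (1 / 4) * (C.div a x ^ 2 * ‖u x‖ ^ 2)) μ := fun a =>
      ((i1 a).const_mul _).add ((i2 a).const_mul _)
    rw [← integral_finsetSum _ fun a _ => i3 a]
    refine integral_congr_ae (Eventually.of_forall fun x => ?_)
    simp only [pot, Finset.sum_add_distrib, ← Finset.mul_sum, ← Finset.sum_mul]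
    ring
  rw [variance, e, ← Finset.sum_add_distrib]
  refine Finset.sum_congr rfl fun a _ => ?_
  rw [hu.norm_integral_sq a, hu.integral_norm_sq_symmetrised a]
  ring

/-- The radial part `X_a |u|` of the derivatives of `u`. -/
noncomputable def radial (u : Ω → ℂ) (U : ι → Ω → ℂ) (a : ι) (x : Ω) : ℂ :=
  ((inner ℝ (u x) (U a x) / ‖u x‖ : ℝ) : ℂ)

/-- The phase derivative of `u`, weighted with `|u|`. -/
noncomputable def angular (u : Ω → ℂ) (U : ι → Ω → ℂ) (a : ι) (x : Ω) : ℂ :=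
  (((U a x / u x).im * ‖u x‖ : ℝ) : ℂ)

/-- Where `u` vanishes both parts on the right are zero by the convention for division, so the
identity holds only because `U a` vanishes there almost everywhere. -/
theorem Mem.norm_sq_eq (hu : C.Mem u U) (a : ι) :
    ∀ᵐ x ∂μ, ‖U a x‖ ^ 2 = ‖radial u U a x‖ ^ 2 + ‖angular u U a x‖ ^ 2 := by
  filter_upwards [hu.ae_eq_zero_of_eq_zero a] with x hx
  rcases eq_or_ne (u x) 0 with h0 | h0
  · simp [radial, angular, h0, hx h0]
  · simp only [radial, angular, Complex.norm_real, Real.norm_eq_abs, sq_abs]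
    exact norm_sq_eq_radial_add_angular _ h0

theorem Mem.memLp_angular (hu : C.Mem u U) (a : ι) : MemLp (angular u U a) 2 μ := by
  refine (hu.2.1 a).mono ?_ ?_
  · refine Complex.continuous_ofReal.comp_aestronglyMeasurable ?_
    have h : AEMeasurable (fun x => (U a x / u x).im * ‖u x‖) μ :=
      (Complex.measurable_im.comp_aemeasurable
        ((hu.2.1 a).1.aemeasurable.div hu.1.1.aemeasurable)).mul hu.1.1.aemeasurable.norm
    exact h.aestronglyMeasurable
  · filter_upwards [hu.norm_sq_eq a] with x hx
    refine le_of_sq_le_sq ?_ (norm_nonneg _)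
    rw [hx]
    have := sq_nonneg ‖radial u U a x‖
    linarith

/-- The mean of the phase derivative. -/
noncomputable def meanPhase (μ : Measure Ω) (u : Ω → ℂ) (U : ι → Ω → ℂ) (a : ι) : ℝ :=
  ∫ x, (conj (u x) * U a x).im ∂μ

/-- The variance is the energy of `|u|` plus the variance of the phase derivatives. -/
theorem Mem.variance_eq_add (hu : C.Mem u U) (h1 : ∫ x, ‖u x‖ ^ 2 ∂μ = 1) :
    C.variance u U = ∑ a, ∫ x, ‖radial u U a x‖ ^ 2 ∂μ +
      ∑ a, ∫ x, ‖angular u U a x + ((-meanPhase μ u U a * ‖u x‖ : ℝ) : ℂ)‖ ^ 2 ∂μ := by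
  rw [hu.variance_eq, ← Finset.sum_add_distrib]
  refine Finset.sum_congr rfl fun a _ => ?_
  have hR : MemLp (radial u U a) 2 μ := hu.norm.2.1 a
  have hS := hu.memLp_angular a
  have hN : MemLp (fun x => ((-meanPhase μ u U a * ‖u x‖ : ℝ) : ℂ)) 2 μ := by
    have := hu.norm.1.const_mul ((-meanPhase μ u U a : ℝ) : ℂ)
    simpa only [Complex.ofReal_mul] using this
  have e1 : ∫ x, ‖U a x‖ ^ 2 ∂μ =
      ∫ x, ‖radial u U a x‖ ^ 2 ∂μ + ∫ x, ‖angular u U a x‖ ^ 2 ∂μ := by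
    rw [← integral_add (integrable_norm_sq hR) (integrable_norm_sq hS)]
    exact integral_congr_ae (hu.norm_sq_eq a)
  -- Cross term of the usual identity `∫ (θ - m)² dν = ∫ θ² dν - m²`, where `dν = |u|² dμ` has mass
  -- one and `m = ∫ θ dν`.
  have e2 : ∫ x, conj ((-meanPhase μ u U a * ‖u x‖ : ℝ) : ℂ) * angular u U a x ∂μ =
      ((-meanPhase μ u U a * meanPhase μ u U a : ℝ) : ℂ) := by
    conv_rhs => rw [meanPhase, ← integral_const_mul, ← integral_complex_ofReal]
    refine integral_congr_ae (Eventually.of_forall fun x => ?_)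
    simp only [im_conj_mul_eq, angular, Complex.conj_ofReal, ← Complex.ofReal_mul, meanPhase]
    congr 1
    ring
  have e3 : ∫ x, ‖((-meanPhase μ u U a * ‖u x‖ : ℝ) : ℂ)‖ ^ 2 ∂μ = meanPhase μ u U a ^ 2 := by
    simp only [Complex.norm_real, Real.norm_eq_abs, sq_abs, mul_pow, integral_const_mul, h1]
    ring
  rw [integral_norm_sq_add hS hN, e1, e2, e3, Complex.ofReal_re]
  change _ - meanPhase μ u U a ^ 2 = _
  ring

/-- A variance vanishes exactly for a constant. Since `|u|² dμ` has mass one, any such constant must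
be the mean. -/
theorem Mem.sum_integral_eq_zero_iff (hu : C.Mem u U) (h1 : ∫ x, ‖u x‖ ^ 2 ∂μ = 1) :
    (∑ a, ∫ x, ‖angular u U a x + ((-meanPhase μ u U a * ‖u x‖ : ℝ) : ℂ)‖ ^ 2 ∂μ = 0) ↔
      ∃ c : ι → ℝ, ∀ᵐ x ∂μ, u x ≠ 0 → ∀ a, (U a x / u x).im = c a := by
  have hN : ∀ a, MemLp (fun x => angular u U a x + ((-meanPhase μ u U a * ‖u x‖ : ℝ) : ℂ)) 2 μ := by
    intro a
    have := hu.norm.1.const_mul ((-meanPhase μ u U a : ℝ) : ℂ)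
    refine (hu.memLp_angular a).add ?_
    simpa only [Complex.ofReal_mul] using this
  rw [Finset.sum_eq_zero_iff_of_nonneg fun a _ => integral_nonneg fun x => sq_nonneg _]
  have key : ∀ a x, u x ≠ 0 → (‖angular u U a x + ((-meanPhase μ u U a * ‖u x‖ : ℝ) : ℂ)‖ ^ 2 = 0 ↔
      (U a x / u x).im = meanPhase μ u U a) := by
    intro a x hx
    rw [sq_eq_zero_iff, norm_eq_zero, angular, ← Complex.ofReal_add, Complex.ofReal_eq_zero,
      ← add_mul, mul_eq_zero, or_iff_left (norm_ne_zero_iff.2 hx), add_neg_eq_zero]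
  constructor
  · intro h
    refine ⟨meanPhase μ u U, ?_⟩
    have h2 : ∀ a, ∀ᵐ x ∂μ,
        ‖angular u U a x + ((-meanPhase μ u U a * ‖u x‖ : ℝ) : ℂ)‖ ^ 2 = 0 := fun a =>
      (integral_eq_zero_iff_of_nonneg (fun x => sq_nonneg _) (integrable_norm_sq (hN a))).1
        (h a (Finset.mem_univ a))
    filter_upwards [ae_all_iff.2 h2] with x hx h0 a
    exact (key a x h0).1 (hx a)
  · rintro ⟨c, hc⟩ a -
    have hm : meanPhase μ u U a = c a := by
      calc meanPhase μ u U a = ∫ x, c a * ‖u x‖ ^ 2 ∂μ := by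
            refine integral_congr_ae ?_
            filter_upwards [hc] with x hx
            rw [im_conj_mul_eq]
            rcases eq_or_ne (u x) 0 with h0 | h0
            · simp [h0]
            · rw [hx h0 a]
        _ = c a := by rw [integral_const_mul, h1, mul_one]
    refine integral_eq_zero_of_ae ?_
    filter_upwards [hc] with x hx
    rcases eq_or_ne (u x) 0 with h0 | h0
    · simp [angular, h0]
    · exact (key a x h0).2 (by rw [hx h0 a, hm])

/-! ### Rayleigh quotients, minimisers and the equality case. -/

/-- The infimum of the Rayleigh quotients. -/
noncomputable def bottom (C : FrameCalculus μ ι) : ℝ :=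
  sInf {q : ℝ | ∃ u U, C.Mem u U ∧ 0 < ∫ x, ‖u x‖ ^ 2 ∂μ ∧
    q = (∑ a, ∫ x, ‖U a x‖ ^ 2 ∂μ) / ∫ x, ‖u x‖ ^ 2 ∂μ}

theorem energy_nonneg (μ : Measure Ω) (U : ι → Ω → ℂ) : 0 ≤ ∑ a, ∫ x, ‖U a x‖ ^ 2 ∂μ :=
  Finset.sum_nonneg fun _ _ => integral_nonneg fun _ => sq_nonneg _

theorem bottom_nonneg : 0 ≤ C.bottom := by
  refine Real.sInf_nonneg ?_
  rintro q ⟨u, U, -, h, rfl⟩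
  exact div_nonneg (energy_nonneg μ U) h.le

theorem Mem.bottom_mul_le (hu : C.Mem u U) :
    C.bottom * ∫ x, ‖u x‖ ^ 2 ∂μ ≤ ∑ a, ∫ x, ‖U a x‖ ^ 2 ∂μ := by
  rcases (integral_nonneg fun x => sq_nonneg ‖u x‖ : 0 ≤ ∫ x, ‖u x‖ ^ 2 ∂μ).eq_or_lt with h | h
  · rw [← h, mul_zero]
    exact energy_nonneg μ U
  · rw [← le_div_iff₀ h]
    refine csInf_le ⟨0, ?_⟩ ⟨u, U, hu, h, rfl⟩
    rintro q ⟨u, U, -, h, rfl⟩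
    exact div_nonneg (energy_nonneg μ U) h.le

/-- The weak eigenvalue equation `-Δu = l u`. -/
def IsWeakEigen (C : FrameCalculus μ ι) (l : ℝ) (u : Ω → ℂ) (U : ι → Ω → ℂ) : Prop :=
  ∀ χ ∈ C.test, ∑ a, ∫ x, conj (C.D a χ x) * U a x ∂μ = l * ∫ x, conj (χ x) * u x ∂μ

/-- First variation: the Rayleigh inequality along `u + tχ` with real `t` is a quadratic in `t` that
attains its minimum zero at `t = 0`. -/
theorem re_eq_of_energy_eq (hu : C.Mem u U)
    (h : ∑ a, ∫ x, ‖U a x‖ ^ 2 ∂μ = C.bottom * ∫ x, ‖u x‖ ^ 2 ∂μ) {χ : Ω → ℂ}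
    (hχ : χ ∈ C.test) :
    (∑ a, ∫ x, conj (C.D a χ x) * U a x ∂μ).re =
      (C.bottom * ∫ x, conj (χ x) * u x ∂μ : ℂ).re := by
  rw [Complex.re_ofReal_mul, Complex.re_sum]
  have scale : ∀ (t : ℝ) {f g : Ω → ℂ}, MemLp f 2 μ → MemLp g 2 μ →
      ∫ x, ‖f x + (t : ℂ) * g x‖ ^ 2 ∂μ = ∫ x, ‖f x‖ ^ 2 ∂μ +
        2 * t * (∫ x, conj (g x) * f x ∂μ).re + t ^ 2 * ∫ x, ‖g x‖ ^ 2 ∂μ := by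
    intro t f g hf hg
    have e1 : ∫ x, conj ((t : ℂ) * g x) * f x ∂μ = (t : ℂ) * ∫ x, conj (g x) * f x ∂μ := by
      rw [← integral_const_mul]
      refine integral_congr_ae (Eventually.of_forall fun x => ?_)
      simp only [map_mul, Complex.conj_ofReal, mul_assoc]
    have e2 : ∫ x, ‖(t : ℂ) * g x‖ ^ 2 ∂μ = t ^ 2 * ∫ x, ‖g x‖ ^ 2 ∂μ := by
      simp only [norm_mul, Complex.norm_real, mul_pow, Real.norm_eq_abs, sq_abs,
        integral_const_mul]
    rw [integral_norm_sq_add hf (hg.const_mul _), e1, e2, Complex.re_ofReal_mul]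
    ring
  -- The constant term is zero by minimality of `u`. The discriminant is then the square of the
  -- linear coefficient, and being nonpositive it forces that coefficient to vanish.
  have hq : ∀ t : ℝ, 0 ≤ (∑ a, ∫ x, ‖C.D a χ x‖ ^ 2 ∂μ - C.bottom * ∫ x, ‖χ x‖ ^ 2 ∂μ) * (t * t) +
      (2 * (∑ a, (∫ x, conj (C.D a χ x) * U a x ∂μ).re -
        C.bottom * (∫ x, conj (χ x) * u x ∂μ).re)) * t + 0 := by
    intro t
    have h1 := (hu.add ((mem_test hχ).const_mul (t : ℂ))).bottom_mul_le
    rw [scale t hu.1 (C.memLp_test χ hχ)] at h1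
    simp only [fun a => scale t (hu.2.1 a) (C.memLp_D χ hχ a), Finset.sum_add_distrib,
      ← Finset.mul_sum] at h1
    nlinarith
  have := discrim_le_zero hq
  rw [discrim] at this
  nlinarith [sq_nonneg (∑ a, (∫ x, conj (C.D a χ x) * U a x ∂μ).re -
        C.bottom * (∫ x, conj (χ x) * u x ∂μ).re)]

/-- Real variations give only real parts; replacing `χ` by `iχ` gives the imaginary parts. -/
theorem Mem.isWeakEigen (hu : C.Mem u U)
    (h : ∑ a, ∫ x, ‖U a x‖ ^ 2 ∂μ = C.bottom * ∫ x, ‖u x‖ ^ 2 ∂μ) :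
    C.IsWeakEigen C.bottom u U := by
  intro χ hχ
  refine Complex.ext (re_eq_of_energy_eq hu h hχ) ?_
  have h1 := re_eq_of_energy_eq hu h (smul_mem Complex.I hχ)
  have e : ∀ f g : Ω → ℂ, ∫ x, conj (Complex.I * f x) * g x ∂μ =
      -Complex.I * ∫ x, conj (f x) * g x ∂μ := by
    intro f g
    rw [← integral_const_mul]
    refine integral_congr_ae (Eventually.of_forall fun x => ?_)
    simp only [map_mul, Complex.conj_I, mul_assoc]
  simp only [D_smul Complex.I hχ, e, ← Finset.mul_sum] at h1
  rw [mul_left_comm] at h1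
  simpa using h1

/-- Testing the equation with the functions that approximate `u` and passing to the limit amounts to
testing it with `u` itself. -/
theorem IsWeakEigen.energy_eq {l : ℝ} (hu : C.Mem u U) (h : C.IsWeakEigen l u U) :
    ∑ a, ∫ x, ‖U a x‖ ^ 2 ∂μ = l * ∫ x, ‖u x‖ ^ 2 ∂μ := by
  obtain ⟨hu1, hU1, φ, hφ, t1, t2⟩ := hu
  have l1 := (tendsto_integral_conj_mul (fun k => C.memLp_test _ (hφ k)) (fun _ => hu1) hu1 hu1 t1
    (tendsto_eLpNorm_sub_self u)).const_mul (l : ℂ)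
  have l2 := tendsto_finsetSum Finset.univ fun a (_ : a ∈ Finset.univ) =>
    tendsto_integral_conj_mul (fun k => C.memLp_D _ (hφ k) a) (fun _ => hU1 a) (hU1 a) (hU1 a)
      (t2 a) (tendsto_eLpNorm_sub_self (U a))
  have := tendsto_nhds_unique l2 (l1.congr fun k => (h _ (hφ k)).symm)
  simp only [integral_conj_mul_self] at this
  exact_mod_cast this

theorem Mem.energy_congr (hu : C.Mem u U) (hv : C.Mem u W) :
    ∑ a, ∫ x, ‖U a x‖ ^ 2 ∂μ = ∑ a, ∫ x, ‖W a x‖ ^ 2 ∂μ := by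
  refine Finset.sum_congr rfl fun a _ => integral_congr_ae ?_
  filter_upwards [hu.unique hv (ae_eq_refl _) a] with x hx
  rw [hx]

theorem Mem.bottom_le_variance (hu : C.Mem u U) (h1 : ∫ x, ‖u x‖ ^ 2 ∂μ = 1) :
    C.bottom ≤ C.variance u U := by
  rw [hu.variance_eq_add h1]
  have h2 := hu.norm.bottom_mul_le
  simp only [Complex.norm_real, norm_norm, h1, mul_one] at h2
  have h3 : 0 ≤ ∑ a, ∫ x, ‖angular u U a x + ((-meanPhase μ u U a * ‖u x‖ : ℝ) : ℂ)‖ ^ 2 ∂μ :=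
    energy_nonneg μ fun a x => angular u U a x + ((-meanPhase μ u U a * ‖u x‖ : ℝ) : ℂ)
  have h4 : C.bottom ≤ ∑ a, ∫ x, ‖radial u U a x‖ ^ 2 ∂μ := by
    simpa only [radial, Complex.norm_real] using h2
  linarith

/-- Equality holds exactly for a first eigenfunction `|u|` with constant phase derivatives. -/
theorem Mem.variance_eq_bottom_iff (hu : C.Mem u U) (h1 : ∫ x, ‖u x‖ ^ 2 ∂μ = 1) :
    C.variance u U = C.bottom ↔
      (∃ W, C.Mem (fun x => ((‖u x‖ : ℝ) : ℂ)) W ∧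
        C.IsWeakEigen C.bottom (fun x => ((‖u x‖ : ℝ) : ℂ)) W) ∧
      ∃ c : ι → ℝ, ∀ᵐ x ∂μ, u x ≠ 0 → ∀ a, (U a x / u x).im = c a := by
  have hn : ∫ x, ‖((‖u x‖ : ℝ) : ℂ)‖ ^ 2 ∂μ = 1 := by
    simpa only [Complex.norm_real, norm_norm] using h1
  have hR : C.Mem (fun x => ((‖u x‖ : ℝ) : ℂ)) (radial u U) := hu.norm
  have h2 : C.bottom ≤ ∑ a, ∫ x, ‖radial u U a x‖ ^ 2 ∂μ := by
    have := hR.bottom_mul_le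
    rwa [hn, mul_one] at this
  have h3 : 0 ≤ ∑ a, ∫ x, ‖angular u U a x + ((-meanPhase μ u U a * ‖u x‖ : ℝ) : ℂ)‖ ^ 2 ∂μ :=
    energy_nonneg μ fun a x => angular u U a x + ((-meanPhase μ u U a * ‖u x‖ : ℝ) : ℂ)
  rw [hu.variance_eq_add h1, ← hu.sum_integral_eq_zero_iff h1]
  constructor
  · intro h
    refine ⟨⟨radial u U, hR, hR.isWeakEigen ?_⟩, by linarith⟩
    rw [hn]
    linarith
  · rintro ⟨⟨W, hW, hE⟩, h0⟩
    have := hE.energy_eq hW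
    -- The derivatives `W` come from the eigenfunction hypothesis; by uniqueness they carry the same
    -- energy as the radial part of `U`.
    rw [hn, hW.energy_congr hR] at this
    linarith

end FrameCalculus

/-! ### Test functions on the ball satisfy the axioms of the calculus. -/

section TestFunction

variable {n : ℕ} {M : Type*} [TopologicalSpace M] [ChartedSpace (EuclideanSpace ℝ (Fin n)) M]
  {X : ∀ x : M, TangentSpace (𝓡 n) x} {B : Set M} {φ χ : M → ℂ}

theorem IsTestFunction.mdifferentiableAt (hφ : IsTestFunction n B φ) (x : M) :
    MDifferentiableAt (𝓡 n) 𝓘(ℝ, ℂ) φ x :=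
  (hφ.1 x).mdifferentiableAt (by norm_num)

theorem IsTestFunction.add (hφ : IsTestFunction n B φ) (hχ : IsTestFunction n B χ) :
    IsTestFunction n B fun x => φ x + χ x :=
  ⟨hφ.1.add hχ.1, hφ.2.1.add hχ.2.1,
    (tsupport_add φ χ).trans (Set.union_subset hφ.2.2 hχ.2.2)⟩

theorem IsTestFunction.comp {F : ℂ → ℂ} (hF : ContDiff ℝ ∞ F) (hF0 : F 0 = 0)
    (hφ : IsTestFunction n B φ) : IsTestFunction n B fun x => F (φ x) := by
  refine ⟨(contDiff_infty.1 hF 3).contMDiff.comp hφ.1, hφ.2.1.comp_left hF0, ?_⟩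
  exact (closure_mono (Function.support_comp_subset hF0 φ)).trans hφ.2.2

theorem isTestFunction_ofReal {g : M → ℝ} (hg : ContMDiff (𝓡 n) 𝓘(ℝ, ℝ) 3 g)
    (hc : HasCompactSupport g) (hs : tsupport g ⊆ B) :
    IsTestFunction n B fun x => (g x : ℂ) := by
  refine ⟨Complex.ofRealCLM.contDiff.contMDiff.comp hg, hc.comp_left Complex.ofReal_zero, ?_⟩
  exact (closure_mono (Function.support_comp_subset Complex.ofReal_zero g)).trans hs

variable [IsManifold (𝓡 n) 1 M]

theorem fieldDeriv_conj_mul (hφ : IsTestFunction n B φ) (hχ : IsTestFunction n B χ) (x : M) :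
    fieldDeriv X (fun z => conj (χ z) * φ z) x =
      conj (χ x) * fieldDeriv X φ x + conj (fieldDeriv X χ x) * φ x := by
  have hd : DifferentiableAt ℝ (fun z : ℂ => conj z) (χ x) := Complex.conjCLE.differentiableAt
  have h1 : fieldDeriv X (fun z => conj (χ z)) x = conj (fieldDeriv X χ x) := by
    have h := fieldDeriv_comp (X := X) hd (hχ.mdifferentiableAt x)
    have h2 : fderiv ℝ (fun z : ℂ => conj z) (χ x) = (Complex.conjCLE : ℂ →L[ℝ] ℂ) :=
      Complex.conjCLE.fderiv
    rw [h2] at h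
    exact h
  rw [fieldDeriv_mul (f := fun z => conj (χ z)) (hd.mdifferentiableAt.comp x
    (hχ.mdifferentiableAt x)) (hφ.mdifferentiableAt x), h1]

theorem fieldDeriv_norm_sq (hφ : IsTestFunction n B φ) (x : M) :
    fieldDeriv X (fun z => ‖φ z‖ ^ 2) x = 2 * (conj (φ x) * fieldDeriv X φ x).re := by
  have hd := (hasStrictFDerivAt_norm_sq (φ x)).hasFDerivAt
  rw [fieldDeriv_comp (L := fun z : ℂ => ‖z‖ ^ 2) hd.differentiableAt (hφ.mdifferentiableAt x),
    hd.fderiv]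
  simp only [smul_apply, innerSL_apply_apply, Complex.inner, nsmul_eq_mul]
  rw [mul_comm (conj (φ x))]
  norm_num

end TestFunction

section Calculus

variable {n : ℕ} {M : Type*} [TopologicalSpace M] [T2Space M] [SecondCountableTopology M]
  [ChartedSpace (EuclideanSpace ℝ (Fin n)) M] [IsManifold (𝓡 n) 3 M]
  [RiemannianBundle (fun x : M => TangentSpace (𝓡 n) x)]
  [IsContMDiffRiemannianBundle (𝓡 n) 2 (EuclideanSpace ℝ (Fin n))
    (fun x : M => TangentSpace (𝓡 n) x)]
  [MeasurableSpace M] [BorelSpace M]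
  {X : ∀ x : M, TangentSpace (𝓡 n) x} {U B : Set M} {φ χ : M → ℂ}

theorem IsTestFunction.memLp (hφ : IsTestFunction n B φ) :
    MemLp φ 2 ((riemVolume n M).restrict B) :=
  (hφ.1.continuous.memLp_of_hasCompactSupport hφ.2.1).restrict B

theorem IsTestFunction.memLp_fieldDeriv (hU : IsOpen U) (hBU : B ⊆ U)
    (hX : ContMDiffOn (𝓡 n) (𝓡 n).tangent 2 (fun x => (⟨x, X x⟩ : TangentBundle (𝓡 n) M)) U)
    (hφ : IsTestFunction n B φ) :
    MemLp (fieldDeriv X φ) 2 ((riemVolume n M).restrict B) :=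
  ((continuous_fieldDeriv hU hX (hφ.1.of_le (by norm_num))
    (hφ.2.2.trans hBU)).memLp_of_hasCompactSupport (hasCompactSupport_fieldDeriv hφ.2.1)).restrict B

theorem setIntegral_eq_integral_of_tsupport_subset {E : Type*} [NormedAddCommGroup E]
    [NormedSpace ℝ E] {μ : Measure M} {f : M → E} (hs : tsupport f ⊆ B) :
    ∫ x in B, f x ∂μ = ∫ x, f x ∂μ :=
  setIntegral_eq_integral_of_forall_compl_eq_zero fun _ hx =>
    image_eq_zero_of_notMem_tsupport fun h => hx (hs h)

theorem setIntegral_fieldDeriv_eq {F : Type*} [NormedAddCommGroup F] [NormedSpace ℝ F]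
    (hU : IsOpen U) (hBU : B ⊆ U)
    (hX : ContMDiffOn (𝓡 n) (𝓡 n).tangent 2 (fun x => (⟨x, X x⟩ : TangentBundle (𝓡 n) M)) U)
    {g : M → F} (hg : ContMDiff (𝓡 n) 𝓘(ℝ, F) 1 g) (hc : HasCompactSupport g)
    (hs : tsupport g ⊆ B) :
    ∫ x in B, fieldDeriv X g x ∂(riemVolume n M) =
      - ∫ x in B, divergence X x • g x ∂(riemVolume n M) := by
  rw [setIntegral_eq_integral_of_tsupport_subset ((tsupport_fieldDeriv_subset g).trans hs),
    setIntegral_eq_integral_of_tsupport_subset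
      ((tsupport_smul_subset_right (divergence X) g).trans hs),
    integral_fieldDeriv_eq hU hX hg hc (hs.trans hBU)]

/-- Both functions are continuous on `U`, which contains the compact closure of `B`. The derivative
of the divergence is where the `C²` regularity of the frame is used in full. -/
theorem exists_abs_divergence_le (hU : IsOpen U) (hBU : closure B ⊆ U)
    (hc : IsCompact (closure B))
    (hX : ContMDiffOn (𝓡 n) (𝓡 n).tangent 2 (fun x => (⟨x, X x⟩ : TangentBundle (𝓡 n) M)) U) :
    ∃ K, 0 ≤ K ∧ ∀ x ∈ B, |divergence X x| ≤ K ∧ |fieldDeriv X (divergence X) x| ≤ K := by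
  obtain ⟨K₁, h₁⟩ := hc.exists_bound_of_continuousOn
    ((contMDiffOn_divergence hU hX).continuousOn.mono hBU)
  obtain ⟨K₂, h₂⟩ := hc.exists_bound_of_continuousOn
    ((continuousOn_fieldDeriv hU hU hX (contMDiffOn_divergence hU hX) subset_rfl).mono hBU)
  refine ⟨max 0 (max K₁ K₂), le_max_left _ _, fun x hx => ⟨?_, ?_⟩⟩
  · exact (h₁ x (subset_closure hx)).trans ((le_max_left _ _).trans (le_max_right _ _))
  · exact (h₂ x (subset_closure hx)).trans ((le_max_right _ _).trans (le_max_right _ _))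

/-- The divergence theorem for `conj χ · φ` and the product rule. -/
theorem integral_conj_mul_fieldDeriv (hU : IsOpen U) (hBU : closure B ⊆ U) (hB : IsOpen B)
    (hc : IsCompact (closure B))
    (hX : ContMDiffOn (𝓡 n) (𝓡 n).tangent 2 (fun x => (⟨x, X x⟩ : TangentBundle (𝓡 n) M)) U)
    (hφ : IsTestFunction n B φ) (hχ : IsTestFunction n B χ) :
    ∫ x in B, conj (χ x) * fieldDeriv X φ x ∂(riemVolume n M) =
      -∫ x in B, conj (fieldDeriv X χ x + divergence X x * χ x) * φ x ∂(riemVolume n M) := by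
  have hBU' := subset_closure.trans hBU
  obtain ⟨K, -, hK⟩ := exists_abs_divergence_le hU hBU hc hX
  have hg : ContMDiff (𝓡 n) 𝓘(ℝ, ℂ) 1 fun x => conj (χ x) * φ x :=
    (((Complex.conjCLE.contDiff.comp contDiff_fst).mul contDiff_snd).contMDiff.comp
      (hχ.1.prodMk_space hφ.1)).of_le (by norm_num)
  have hgc : HasCompactSupport fun x => conj (χ x) * φ x := hφ.2.1.mul_left
  have hgs : tsupport (fun x => conj (χ x) * φ x) ⊆ B :=
    (tsupport_mul_subset_right (f := fun x => conj (χ x)) (g := φ)).trans hφ.2.2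
  have key := setIntegral_fieldDeriv_eq hU hBU' hX hg hgc hgs
  have hφ1 := hφ.memLp_fieldDeriv hU hBU' hX
  have hχ1 := hχ.memLp_fieldDeriv hU hBU' hX
  have hdiv : AEStronglyMeasurable (divergence X) ((riemVolume n M).restrict B) :=
    ((contMDiffOn_divergence hU hX).continuousOn.mono hBU').aestronglyMeasurable hB.measurableSet
  have hb : ∀ᵐ x ∂((riemVolume n M).restrict B), |divergence X x| ≤ K :=
    ae_restrict_of_forall_mem hB.measurableSet fun x hx => (hK x hx).1
  have i1 := integrable_conj_mul hχ.memLp hφ1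
  have i2 := integrable_conj_mul hχ1 hφ.memLp
  have i3 := integrable_conj_mul (memLp_bounded_mul hdiv hb hχ.memLp) hφ.memLp
  simp only [fieldDeriv_conj_mul hφ hχ] at key
  rw [integral_add i1 i2] at key
  have e : ∫ x in B, conj (fieldDeriv X χ x + divergence X x * χ x) * φ x ∂(riemVolume n M) =
      ∫ x in B, conj (fieldDeriv X χ x) * φ x ∂(riemVolume n M) +
        ∫ x in B, divergence X x • (conj (χ x) * φ x) ∂(riemVolume n M) := by
    have e3 : ∀ x, divergence X x • (conj (χ x) * φ x) =
        conj ((divergence X x : ℂ) * χ x) * φ x := fun x => by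
      rw [Complex.real_smul, map_mul, Complex.conj_ofReal]
      ring
    simp only [e3]
    rw [← integral_add i2 i3]
    refine integral_congr_ae (Eventually.of_forall fun x => ?_)
    simp only [map_add, add_mul]
  rw [e, neg_add, ← key]
  ring

/-- The divergence theorem for `f |φ|²` with `f = div X`: its derivative is `2 f Re (conj φ · Xφ) +
X(f) |φ|²`, and its integral is `-∫ f² |φ|²`. -/
theorem two_mul_re_integral_divergence (hU : IsOpen U) (hBU : closure B ⊆ U) (hB : IsOpen B)
    (hc : IsCompact (closure B))
    (hX : ContMDiffOn (𝓡 n) (𝓡 n).tangent 2 (fun x => (⟨x, X x⟩ : TangentBundle (𝓡 n) M)) U)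
    (hφ : IsTestFunction n B φ) :
    2 * (∫ x in B, conj ((divergence X x : ℂ) * φ x) * fieldDeriv X φ x ∂(riemVolume n M)).re =
      -(∫ x in B, conj (φ x) * (((fieldDeriv X (divergence X) x + divergence X x ^ 2 : ℝ) : ℂ)
        * φ x) ∂(riemVolume n M)).re := by
  have hBU' := subset_closure.trans hBU
  obtain ⟨K, hK0, hK⟩ := exists_abs_divergence_le hU hBU hc hX
  have hD := contMDiffOn_divergence hU hX
  have hN : ContMDiff (𝓡 n) 𝓘(ℝ, ℝ) 3 fun x => ‖φ x‖ ^ 2 :=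
    (contDiff_norm_sq ℝ).contMDiff.comp hφ.1
  have hNs : tsupport (fun x => ‖φ x‖ ^ 2) ⊆ B :=
    (closure_mono (Function.support_comp_subset (g := fun z : ℂ => ‖z‖ ^ 2) (by simp) φ)).trans
      hφ.2.2
  have hNc : HasCompactSupport fun x => ‖φ x‖ ^ 2 :=
    hφ.2.1.comp_left (g := fun z : ℂ => ‖z‖ ^ 2) (by simp)
  have hgs : tsupport (fun x => divergence X x * ‖φ x‖ ^ 2) ⊆ B :=
    (tsupport_mul_subset_right (f := divergence X) (g := fun x => ‖φ x‖ ^ 2)).trans hNs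
  have hg : ContMDiff (𝓡 n) 𝓘(ℝ, ℝ) 1 fun x => divergence X x * ‖φ x‖ ^ 2 :=
    contMDiff_of_tsupport fun x hx => (hD.contMDiffAt (hU.mem_nhds (hBU' (hgs hx)))).mul
      ((hN.of_le (by norm_num)) x)
  have hgc : HasCompactSupport fun x => divergence X x * ‖φ x‖ ^ 2 := hNc.mul_left
  have key := setIntegral_fieldDeriv_eq hU hBU' hX hg hgc hgs
  have hdm : AEStronglyMeasurable (divergence X) ((riemVolume n M).restrict B) :=
    (hD.continuousOn.mono hBU').aestronglyMeasurable hB.measurableSet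
  have hddm : AEStronglyMeasurable (fieldDeriv X (divergence X)) ((riemVolume n M).restrict B) :=
    ((continuousOn_fieldDeriv hU hU hX hD subset_rfl).mono hBU').aestronglyMeasurable
      hB.measurableSet
  have hb : ∀ᵐ x ∂((riemVolume n M).restrict B), |divergence X x| ≤ K :=
    ae_restrict_of_forall_mem hB.measurableSet fun x hx => (hK x hx).1
  have hb2 : ∀ᵐ x ∂((riemVolume n M).restrict B), |divergence X x ^ 2| ≤ K ^ 2 := by
    filter_upwards [hb] with x hx
    rw [abs_pow]
    gcongr
  have hb' : ∀ᵐ x ∂((riemVolume n M).restrict B), |fieldDeriv X (divergence X) x| ≤ K :=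
    ae_restrict_of_forall_mem hB.measurableSet fun x hx => (hK x hx).2
  have i1 := integrable_conj_mul (memLp_bounded_mul hdm hb hφ.memLp)
    (hφ.memLp_fieldDeriv hU hBU' hX)
  have i2 := (integrable_norm_sq hφ.memLp).bdd_mul hddm hb'
  have i3 : Integrable (fun x => divergence X x ^ 2 * ‖φ x‖ ^ 2) ((riemVolume n M).restrict B) :=
    (integrable_norm_sq hφ.memLp).bdd_mul (hdm.pow 2) hb2
  have e1 : ∫ x in B, fieldDeriv X (fun x => divergence X x * ‖φ x‖ ^ 2) x ∂(riemVolume n M) =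
      ∫ x in B, (2 * (conj ((divergence X x : ℂ) * φ x) * fieldDeriv X φ x).re +
        fieldDeriv X (divergence X) x * ‖φ x‖ ^ 2) ∂(riemVolume n M) := by
    refine setIntegral_congr_fun hB.measurableSet fun x hx => ?_
    have hd := (hD.contMDiffAt (hU.mem_nhds (hBU' hx))).mdifferentiableAt one_ne_zero
    have hd' : MDifferentiableAt (𝓡 n) 𝓘(ℝ, ℝ) (fun x => ‖φ x‖ ^ 2) x :=
      (hN x).mdifferentiableAt (by norm_num)
    change fieldDeriv X (fun x => divergence X x * ‖φ x‖ ^ 2) x = _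
    rw [fieldDeriv_mul hd hd', fieldDeriv_norm_sq hφ, map_mul, Complex.conj_ofReal, mul_assoc,
      Complex.re_ofReal_mul]
    ring
  have e2 : ∫ x in B, divergence X x • (divergence X x * ‖φ x‖ ^ 2) ∂(riemVolume n M) =
      ∫ x in B, divergence X x ^ 2 * ‖φ x‖ ^ 2 ∂(riemVolume n M) := by
    refine integral_congr_ae (Eventually.of_forall fun x => ?_)
    simp only [smul_eq_mul]
    ring
  have e3 : (∫ x in B, conj ((divergence X x : ℂ) * φ x) * fieldDeriv X φ x ∂(riemVolume n M)).re =
      ∫ x in B, (conj ((divergence X x : ℂ) * φ x) * fieldDeriv X φ x).re ∂(riemVolume n M) :=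
    (integral_re i1).symm
  have i1' : Integrable (fun x => 2 * (conj ((divergence X x : ℂ) * φ x) * fieldDeriv X φ x).re)
      ((riemVolume n M).restrict B) := i1.re.const_mul 2
  have e4 : ∫ x in B, (fieldDeriv X (divergence X) x + divergence X x ^ 2) * ‖φ x‖ ^ 2
      ∂(riemVolume n M) = ∫ x in B, fieldDeriv X (divergence X) x * ‖φ x‖ ^ 2 ∂(riemVolume n M) +
        ∫ x in B, divergence X x ^ 2 * ‖φ x‖ ^ 2 ∂(riemVolume n M) := by
    rw [← integral_add i2 i3]
    simp only [add_mul]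
  rw [e1, e2, integral_add i1' i2, integral_const_mul] at key
  rw [integral_conj_mul_ofReal_mul, Complex.ofReal_re, e3, e4]
  linarith

/-- The ball has finite volume, so `L²` is contained in `L¹` and the fundamental lemma applies; real
test functions suffice. -/
theorem ae_eq_zero_of_integral_test_eq_zero (hB : IsOpen B) (hc : IsCompact (closure B))
    {α : M → ℂ} (hα : MemLp α 2 ((riemVolume n M).restrict B))
    (h : ∀ χ, IsTestFunction n B χ → ∫ x in B, conj (χ x) * α x ∂(riemVolume n M) = 0) :
    ∀ᵐ x ∂((riemVolume n M).restrict B), α x = 0 := by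
  have : IsFiniteMeasure ((riemVolume n M).restrict B) := by
    refine ⟨?_⟩
    rw [Measure.restrict_apply_univ]
    exact (measure_mono subset_closure).trans_lt hc.measure_lt_top
  refine ae_eq_zero_of_integral_contMDiff_three_smul_eq_zero hB (hα.integrable one_le_two)
    fun g hg hgc hgs => ?_
  simpa only [Complex.conj_ofReal, Complex.real_smul] using h _ (isTestFunction_ofReal hg hgc hgs)

/-- The calculus of a `C²` frame field on a relatively compact open set. -/
noncomputable def frameCalculus {X : Fin n → ∀ x : M, TangentSpace (𝓡 n) x} (hU : IsOpen U)
    (hBU : closure B ⊆ U) (hB : IsOpen B) (hc : IsCompact (closure B))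
    (hX : ∀ a, ContMDiffOn (𝓡 n) (𝓡 n).tangent 2
      (fun x => (⟨x, X a x⟩ : TangentBundle (𝓡 n) M)) U) :
    FrameCalculus ((riemVolume n M).restrict B) (Fin n) where
  test := {φ | IsTestFunction n B φ}
  D a φ := fieldDeriv (X a) φ
  div a := divergence (X a)
  ddiv a := fieldDeriv (X a) (divergence (X a))
  -- The individual bounds are nonnegative, so their sum bounds all frame members at once.
  bound := ∑ a, (exists_abs_divergence_le hU hBU hc (hX a)).choose
  memLp_test _ hφ := hφ.memLp
  memLp_D _ hφ a := IsTestFunction.memLp_fieldDeriv hU (subset_closure.trans hBU) (hX a) hφ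
  add_mem _ hφ _ hχ := IsTestFunction.add hφ hχ
  D_add _ hφ _ hχ a := funext fun x => fieldDeriv_add
    (IsTestFunction.mdifferentiableAt hφ x) (IsTestFunction.mdifferentiableAt hχ x)
  comp_mem _ hF hF0 _ hφ := IsTestFunction.comp hF hF0 hφ
  D_comp _ hF _ _ hφ a := funext fun x => fieldDeriv_comp
    (hF.differentiable (by simp) _) (IsTestFunction.mdifferentiableAt hφ x)
  aestronglyMeasurable_div a := ((contMDiffOn_divergence hU (hX a)).continuousOn.mono
    (subset_closure.trans hBU)).aestronglyMeasurable hB.measurableSet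
  aestronglyMeasurable_ddiv a := ((continuousOn_fieldDeriv hU hU (hX a)
    (contMDiffOn_divergence hU (hX a)) subset_rfl).mono
      (subset_closure.trans hBU)).aestronglyMeasurable hB.measurableSet
  abs_div_le a := ae_restrict_of_forall_mem hB.measurableSet fun x hx =>
    (((exists_abs_divergence_le hU hBU hc (hX a)).choose_spec.2 x hx).1).trans
      (Finset.single_le_sum (f := fun a => (exists_abs_divergence_le hU hBU hc (hX a)).choose)
        (fun b _ => (exists_abs_divergence_le hU hBU hc (hX b)).choose_spec.1)
        (Finset.mem_univ a))
  abs_ddiv_le a := ae_restrict_of_forall_mem hB.measurableSet fun x hx =>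
    (((exists_abs_divergence_le hU hBU hc (hX a)).choose_spec.2 x hx).2).trans
      (Finset.single_le_sum (f := fun a => (exists_abs_divergence_le hU hBU hc (hX a)).choose)
        (fun b _ => (exists_abs_divergence_le hU hBU hc (hX b)).choose_spec.1)
        (Finset.mem_univ a))
  integral_conj_mul_D _ hφ _ hχ a := integral_conj_mul_fieldDeriv hU hBU hB hc (hX a) hφ hχ
  two_mul_re_integral_div _ hφ a := two_mul_re_integral_divergence hU hBU hB hc (hX a) hφ
  separating _ hα h := ae_eq_zero_of_integral_test_eq_zero hB hc hα h

end Calculus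

/-! ### Translation between covector fields and frame components. -/

theorem FrameCalculus.Mem.congr_deriv {Ω : Type*} [MeasurableSpace Ω] {μ : Measure Ω} {ι : Type*}
    {C : FrameCalculus μ ι} {u : Ω → ℂ} {U W : ι → Ω → ℂ} (hu : C.Mem u U)
    (h : ∀ a, U a =ᵐ[μ] W a) : C.Mem u W := by
  obtain ⟨hu1, hU1, φ, hφ, t1, t2⟩ := hu
  refine ⟨hu1, fun a => (hU1 a).ae_eq (h a), φ, hφ, t1, fun a => ?_⟩
  convert t2 a using 2 with k
  refine eLpNorm_congr_ae ?_
  filter_upwards [h a] with x hx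
  rw [hx]

section Covector

variable {n : ℕ} {M : Type*} [TopologicalSpace M] [ChartedSpace (EuclideanSpace ℝ (Fin n)) M]
  [RiemannianBundle (fun x : M => TangentSpace (𝓡 n) x)] {x : M}

theorem covNorm_nonneg (α : TangentSpace (𝓡 n) x →L[ℝ] ℂ) : 0 ≤ covNorm α := Real.sqrt_nonneg _

theorem norm_apply_le_covNorm {v : Fin n → TangentSpace (𝓡 n) x} (hv : Orthonormal ℝ v)
    (α : TangentSpace (𝓡 n) x →L[ℝ] ℂ) (a : Fin n) : ‖α (v a)‖ ≤ covNorm α := by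
  refine le_of_sq_le_sq ?_ (covNorm_nonneg α)
  rw [covNorm_sq_eq_sum hv]
  exact Finset.single_le_sum (f := fun a => ‖α (v a)‖ ^ 2) (fun _ _ => sq_nonneg _)
    (Finset.mem_univ a)

theorem covNorm_le_sum {v : Fin n → TangentSpace (𝓡 n) x} (hv : Orthonormal ℝ v)
    (α : TangentSpace (𝓡 n) x →L[ℝ] ℂ) : covNorm α ≤ ∑ a, ‖α (v a)‖ := by
  refine le_of_sq_le_sq ?_ (Finset.sum_nonneg fun _ _ => norm_nonneg _)
  rw [covNorm_sq_eq_sum hv]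
  exact Finset.sum_sq_le_sq_sum_of_nonneg fun _ _ => norm_nonneg _

end Covector

section Sobolev

variable {n : ℕ} {M : Type*} [TopologicalSpace M] [T2Space M] [SecondCountableTopology M]
  [ChartedSpace (EuclideanSpace ℝ (Fin n)) M] [IsManifold (𝓡 n) 3 M]
  [RiemannianBundle (fun x : M => TangentSpace (𝓡 n) x)]
  [IsContMDiffRiemannianBundle (𝓡 n) 2 (EuclideanSpace ℝ (Fin n))
    (fun x : M => TangentSpace (𝓡 n) x)]
  [MeasurableSpace M] [BorelSpace M]
  {X : Fin n → ∀ x : M, TangentSpace (𝓡 n) x} {U B : Set M} {u : M → ℂ} {du : ∀ x : M, TangentSpace (𝓡 n) x →L[ℝ] ℂ}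

theorem ae_restrict_orthonormal (hBU : closure B ⊆ U) (hB : IsOpen B)
    (hX : IsOrthonormalFrameOn X U) :
    ∀ᵐ x ∂((riemVolume n M).restrict B), Orthonormal ℝ fun a => X a x :=
  ae_restrict_of_forall_mem hB.measurableSet fun x hx => hX.2 x (hBU (subset_closure hx))

/-- Each frame component of a covector is bounded by its norm, so convergence of the covector norms
gives convergence of the components. -/
theorem mem_frameCalculus_of_memH10 (hU : IsOpen U) (hBU : closure B ⊆ U) (hB : IsOpen B)
    (hc : IsCompact (closure B)) (hX : IsOrthonormalFrameOn X U)
    (hu : MemH10 B u du) :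
    (frameCalculus hU hBU hB hc hX.1).Mem u fun a x => du x (X a x) := by
  obtain ⟨φ, hφ, h1, h2, t1, t2⟩ := hu
  have hort := ae_restrict_orthonormal hBU hB hX
  have hD := fun k a => (hφ k).memLp_fieldDeriv hU (subset_closure.trans hBU) (hX.1 a)
  have hle : ∀ k a, ∀ᵐ x ∂((riemVolume n M).restrict B),
      ‖fieldDeriv (X a) (φ k) x - du x (X a x)‖ ≤ ‖covNorm (diff n (φ k) x - du x)‖ := by
    intro k a
    filter_upwards [hort] with x hx
    rw [Real.norm_of_nonneg (covNorm_nonneg _)]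
    exact norm_apply_le_covNorm hx (diff n (φ k) x - du x) a
  -- Measurability of the components of `du` is not part of `MemH10`. It is recovered by exhibiting
  -- them as a.e. limits of derivatives of test functions.
  obtain ⟨ns, -, hns⟩ := exists_subseq_tendsto_ae (f₀ := fun _ => (0 : ℝ)) h2 MemLp.zero'
    (by simpa only [sub_zero] using t2)
  have hm : ∀ a, AEStronglyMeasurable (fun x => du x (X a x)) ((riemVolume n M).restrict B) := by
    intro a
    refine aestronglyMeasurable_of_tendsto_ae atTop (fun k => (hD (ns k) a).1) ?_
    filter_upwards [hns, ae_all_iff.2 fun k => hle k a] with x hx hlex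
    rw [tendsto_iff_norm_sub_tendsto_zero]
    exact squeeze_zero (fun _ => norm_nonneg _) (fun k => hlex (ns k)) (by simpa using hx.norm)
  refine ⟨?_, fun a => ?_, φ, hφ, t1, fun a => ?_⟩
  · have := (hφ 0).memLp.sub (h1 0)
    convert this using 1
    ext x
    simp
  · have := (hD 0 a).sub ((h2 0).mono ((hD 0 a).1.sub (hm a)) (hle 0 a))
    convert this using 1
    ext x
    simp
  · exact tendsto_of_tendsto_of_tendsto_of_le_of_le tendsto_const_nhds t2 (fun _ => zero_le)
      fun k => eLpNorm_mono_ae (hle k a)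

/-- The covector norm is at most the sum of the moduli of the finitely many components. -/
theorem memH10_of_mem_frameCalculus (hU : IsOpen U) (hBU : closure B ⊆ U) (hB : IsOpen B)
    (hc : IsCompact (closure B)) (hX : IsOrthonormalFrameOn X U)
    (hu : (frameCalculus hU hBU hB hc hX.1).Mem u fun a x => du x (X a x)) : MemH10 B u du := by
  obtain ⟨hu1, hU1, φ, hφ, t1, t2⟩ := hu
  have hort := ae_restrict_orthonormal hBU hB hX
  have hd : ∀ k a, MemLp (fun x => fieldDeriv (X a) (φ k) x - du x (X a x)) 2
      ((riemVolume n M).restrict B) := fun k a =>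
    (IsTestFunction.memLp_fieldDeriv hU (subset_closure.trans hBU) (hX.1 a) (hφ k)).sub (hU1 a)
  have hle : ∀ k, ∀ᵐ x ∂((riemVolume n M).restrict B), ‖covNorm (diff n (φ k) x - du x)‖ ≤
      ‖∑ a, ‖fieldDeriv (X a) (φ k) x - du x (X a x)‖‖ := by
    intro k
    filter_upwards [hort] with x hx
    rw [Real.norm_of_nonneg (covNorm_nonneg _)]
    exact (covNorm_le_sum hx (diff n (φ k) x - du x)).trans (le_abs_self _)
  have hsum : ∀ k, MemLp (fun x => ∑ a, ‖fieldDeriv (X a) (φ k) x - du x (X a x)‖) 2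
      ((riemVolume n M).restrict B) := fun k => memLp_finsetSum _ fun a _ => (hd k a).norm
  have hm : ∀ k, AEStronglyMeasurable (fun x => covNorm (diff n (φ k) x - du x))
      ((riemVolume n M).restrict B) := by
    intro k
    have h1 : AEMeasurable (fun x => ∑ a, ‖fieldDeriv (X a) (φ k) x - du x (X a x)‖ ^ 2)
        ((riemVolume n M).restrict B) :=
      Finset.aemeasurable_fun_sum _ fun a _ => (hd k a).1.aemeasurable.norm.pow_const 2
    refine (Real.continuous_sqrt.comp_aestronglyMeasurable h1.aestronglyMeasurable).congr ?_
    filter_upwards [hort] with x hx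
    rw [← Real.sqrt_sq (covNorm_nonneg (diff n (φ k) x - du x)), covNorm_sq_eq_sum hx]
    rfl
  refine ⟨φ, hφ, fun k => (IsTestFunction.memLp (hφ k)).sub hu1,
    fun k => (hsum k).mono (hm k) (hle k), t1, ?_⟩
  have t3 := tendsto_finsetSum Finset.univ fun a (_ : a ∈ Finset.univ) => t2 a
  rw [Finset.sum_const_zero] at t3
  refine tendsto_of_tendsto_of_tendsto_of_le_of_le tendsto_const_nhds t3 (fun _ => zero_le)
    fun k => (eLpNorm_mono_ae (hle k)).trans ?_
  have h := eLpNorm_sum_le (μ := (riemVolume n M).restrict B) (p := 2) (s := Finset.univ)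
    (f := fun a x => ‖fieldDeriv (X a) (φ k) x - du x (X a x)‖)
    (fun a _ => (hd k a).1.norm) one_le_two
  simp only [eLpNorm_norm, Finset.sum_fn] at h
  exact h

/-- Any family of components on an orthonormal frame comes from a covector field. Hence the abstract
infimum and eigenvalue equation involve no more functions than the geometric ones. -/
theorem exists_memH10_of_mem (hU : IsOpen U) (hBU : closure B ⊆ U) (hB : IsOpen B)
    (hc : IsCompact (closure B)) (hX : IsOrthonormalFrameOn X U)
    {W : Fin n → M → ℂ}
    (hu : (frameCalculus hU hBU hB hc hX.1).Mem u W) :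
    ∃ du : ∀ x : M, TangentSpace (𝓡 n) x →L[ℝ] ℂ, MemH10 B u du ∧
      ∀ᵐ x ∂((riemVolume n M).restrict B), ∀ a, du x (X a x) = W a x := by
  have h : ∀ᵐ x ∂((riemVolume n M).restrict B), ∀ a, frameCovector X W x (X a x) = W a x := by
    filter_upwards [ae_restrict_orthonormal hBU hB hX] with x hx a
    exact frameCovector_apply hx W a
  refine ⟨frameCovector X W,
    memH10_of_mem_frameCalculus hU hBU hB hc hX (hu.congr_deriv fun a => ?_), h⟩
  filter_upwards [h] with x hx
  exact (hx a).symm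

theorem integral_covNorm_sq (hU : IsOpen U) (hBU : closure B ⊆ U) (hB : IsOpen B)
    (hc : IsCompact (closure B)) (hX : IsOrthonormalFrameOn X U)
    (hu : MemH10 B u du) :
    ∫ x in B, covNorm (du x) ^ 2 ∂(riemVolume n M) =
      ∑ a, ∫ x in B, ‖du x (X a x)‖ ^ 2 ∂(riemVolume n M) := by
  have hm := mem_frameCalculus_of_memH10 hU hBU hB hc hX hu
  rw [← integral_finsetSum _ fun a _ => integrable_norm_sq (hm.2.1 a)]
  refine integral_congr_ae ?_
  filter_upwards [ae_restrict_orthonormal hBU hB hX] with x hx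
  exact covNorm_sq_eq_sum hx _

theorem lambda1_eq_bottom (hU : IsOpen U) (hBU : closure B ⊆ U) (hB : IsOpen B)
    (hc : IsCompact (closure B)) (hX : IsOrthonormalFrameOn X U) :
    lambda1 n B = (frameCalculus hU hBU hB hc hX.1).bottom := by
  refine congrArg sInf (Set.ext fun q => ⟨?_, ?_⟩)
  · rintro ⟨u, du, hu, h0, rfl⟩
    refine ⟨u, _, mem_frameCalculus_of_memH10 hU hBU hB hc hX hu, h0, ?_⟩
    rw [integral_covNorm_sq hU hBU hB hc hX hu]
  · rintro ⟨u, W, hu, h0, rfl⟩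
    obtain ⟨du, hdu, h⟩ := exists_memH10_of_mem hU hBU hB hc hX hu
    refine ⟨u, du, hdu, h0, ?_⟩
    rw [integral_covNorm_sq hU hBU hB hc hX hdu]
    congr 1
    refine Finset.sum_congr rfl fun a _ => integral_congr_ae ?_
    filter_upwards [h] with x hx
    rw [hx a]

theorem integral_covInner (hU : IsOpen U) (hBU : closure B ⊆ U) (hB : IsOpen B)
    (hc : IsCompact (closure B)) (hX : IsOrthonormalFrameOn X U)
    (hu : MemH10 B u du) {φ : M → ℂ} (hφ : IsTestFunction n B φ) :
    ∫ x in B, covInner (diff n φ x) (du x) ∂(riemVolume n M) =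
      ∑ a, ∫ x in B, conj (fieldDeriv (X a) φ x) * du x (X a x) ∂(riemVolume n M) := by
  have hm := mem_frameCalculus_of_memH10 hU hBU hB hc hX hu
  rw [← integral_finsetSum _ fun a _ => integrable_conj_mul
    (hφ.memLp_fieldDeriv hU (subset_closure.trans hBU) (hX.1 a)) (hm.2.1 a)]
  refine integral_congr_ae ?_
  filter_upwards [ae_restrict_orthonormal hBU hB hX] with x hx
  exact covInner_eq_sum hx _ _

theorem isDirichletEigenfunction_iff (hU : IsOpen U) (hBU : closure B ⊆ U) (hB : IsOpen B)
    (hc : IsCompact (closure B)) (hX : IsOrthonormalFrameOn X U)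
    {l : ℝ} (h0 : 0 < ∫ x in B, ‖u x‖ ^ 2 ∂(riemVolume n M)) :
    IsDirichletEigenfunction n B l u ↔ ∃ W, (frameCalculus hU hBU hB hc hX.1).Mem u W ∧
      (frameCalculus hU hBU hB hc hX.1).IsWeakEigen l u W := by
  constructor
  · rintro ⟨du, hu, -, h⟩
    refine ⟨_, mem_frameCalculus_of_memH10 hU hBU hB hc hX hu, fun χ hχ => ?_⟩
    rw [← h χ hχ, integral_covInner hU hBU hB hc hX hu hχ]
    rfl
  · rintro ⟨W, hW, h⟩
    obtain ⟨du, hdu, hae⟩ := exists_memH10_of_mem hU hBU hB hc hX hW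
    refine ⟨du, hdu, h0, fun χ hχ => ?_⟩
    rw [← h χ hχ, integral_covInner hU hBU hB hc hX hdu hχ]
    refine Finset.sum_congr rfl fun a _ => integral_congr_ae ?_
    filter_upwards [hae] with x hx
    rw [hx a]
    rfl

/-- The prefactor `-iħ` leaves the integrals and contributes its squared modulus `ħ²`. -/
theorem geomVariance_eq (hU : IsOpen U) (hBU : closure B ⊆ U) (hB : IsOpen B)
    (hc : IsCompact (closure B)) (hX : IsOrthonormalFrameOn X U)
    (hbar : ℝ) :
    geomVariance hbar B X u du =
      hbar ^ 2 * (frameCalculus hU hBU hB hc hX.1).variance u fun a x => du x (X a x) := by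
  have e1 : ∀ a, ∫ x in B, ‖momentum hbar (X a) u du x‖ ^ 2 ∂(riemVolume n M) = hbar ^ 2 *
      ∫ x in B, ‖du x (X a x) + (1 / 2) * (divergence (X a) x : ℂ) * u x‖ ^ 2
        ∂(riemVolume n M) := by
    intro a
    rw [← integral_const_mul]
    refine integral_congr_ae (Eventually.of_forall fun x => ?_)
    simp [momentum, mul_pow]
  have e2 : ∀ a, ‖meanMomentum hbar B (X a) u du‖ ^ 2 = hbar ^ 2 *
      ‖∫ x in B, conj (u x) * (du x (X a x) + (1 / 2) * (divergence (X a) x : ℂ) * u x)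
        ∂(riemVolume n M)‖ ^ 2 := by
    intro a
    have : meanMomentum hbar B (X a) u du = -Complex.I * hbar *
        ∫ x in B, conj (u x) * (du x (X a x) + (1 / 2) * (divergence (X a) x : ℂ) * u x)
          ∂(riemVolume n M) := by
      rw [meanMomentum, ← integral_const_mul]
      refine integral_congr_ae (Eventually.of_forall fun x => ?_)
      simp only [momentum]
      ring
    rw [this, norm_mul, mul_pow]
    simp
  rw [geomVariance, naiveVariance, FrameCalculus.variance, mul_add, Finset.mul_sum]
  simp only [e1, e2, ← mul_sub]
  rfl

/-- The density `|u|²` vanishes exactly where `u` does. -/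
theorem ae_stateMeasure_iff (hu : AEStronglyMeasurable u ((riemVolume n M).restrict B))
    {P : M → Prop} : (∀ᵐ x ∂(stateMeasure n B u), P x) ↔
      ∀ᵐ x ∂((riemVolume n M).restrict B), u x ≠ 0 → P x := by
  rw [stateMeasure, ae_withDensity_iff' (hu.norm.aemeasurable.pow_const 2).ennreal_ofReal]
  refine eventually_congr (Eventually.of_forall fun x => ?_)
  rw [ne_eq, ENNReal.ofReal_eq_zero, not_le, sq_pos_iff, norm_ne_zero_iff]

end Sobolev

end SliceUncertainty

theorem theorem1 {n : ℕ} {M : Type*} [TopologicalSpace M] [T2Space M] [SecondCountableTopology M]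
    [ChartedSpace (EuclideanSpace ℝ (Fin n)) M] [IsManifold (𝓡 n) 3 M]
    [RiemannianBundle (fun x : M => TangentSpace (𝓡 n) x)]
    [IsContMDiffRiemannianBundle (𝓡 n) 2 (EuclideanSpace ℝ (Fin n))
      (fun x : M => TangentSpace (𝓡 n) x)]
    [MeasurableSpace M] [BorelSpace M]
    (hbar : ℝ) (hbar_pos : 0 < hbar)
    (p : M) (r : ℝ) (hr : 0 < r)
    (hinj : ENNReal.ofReal r < SliceUncertainty.injRadius n p)
    (X : Fin n → ∀ x : M, TangentSpace (𝓡 n) x) (U : Set M) (hU : IsOpen U)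
    (hBU : closure (SliceUncertainty.geodesicBall n p r) ⊆ U)
    (hX : SliceUncertainty.IsOrthonormalFrameOn X U)
    (ψ : M → ℂ) (dψ : ∀ x : M, TangentSpace (𝓡 n) x →L[ℝ] ℂ)
    (hψ : SliceUncertainty.MemH10 (SliceUncertainty.geodesicBall n p r) ψ dψ)
    (hnorm : ∫ x in SliceUncertainty.geodesicBall n p r, ‖ψ x‖ ^ 2
      ∂(SliceUncertainty.riemVolume n M) = 1) :
    0 ≤ SliceUncertainty.geomVariance hbar (SliceUncertainty.geodesicBall n p r) X ψ dψ ∧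
    hbar * Real.sqrt (SliceUncertainty.lambda1 n (SliceUncertainty.geodesicBall n p r)) ≤
      SliceUncertainty.sigmaP hbar (SliceUncertainty.geodesicBall n p r) X ψ dψ ∧
    (SliceUncertainty.sigmaP hbar (SliceUncertainty.geodesicBall n p r) X ψ dψ =
        hbar * Real.sqrt (SliceUncertainty.lambda1 n (SliceUncertainty.geodesicBall n p r)) ↔
      SliceUncertainty.IsDirichletEigenfunction n (SliceUncertainty.geodesicBall n p r)
          (SliceUncertainty.lambda1 n (SliceUncertainty.geodesicBall n p r))
          (fun x => ((‖ψ x‖ : ℝ) : ℂ)) ∧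
        ∃ c : Fin n → ℝ,
          ∀ᵐ x ∂(SliceUncertainty.stateMeasure n (SliceUncertainty.geodesicBall n p r) ψ),
            ∀ a, SliceUncertainty.phaseDeriv ψ dψ x (X a x) = c a) := by

  obtain ⟨hB, hc⟩ := SliceUncertainty.isOpen_geodesicBall_and_isCompact_closure hinj
  have hm := SliceUncertainty.mem_frameCalculus_of_memH10 hU hBU hB hc hX hψ
  have hV := SliceUncertainty.geomVariance_eq hU hBU hB hc hX (u := ψ) (du := dψ) hbar
  have hle := hm.bottom_le_variance hnorm
  have h0 := SliceUncertainty.FrameCalculus.bottom_nonneg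
    (C := SliceUncertainty.frameCalculus hU hBU hB hc hX.1)
  have hn : 0 < ∫ x in SliceUncertainty.geodesicBall n p r, ‖((‖ψ x‖ : ℝ) : ℂ)‖ ^ 2
      ∂(SliceUncertainty.riemVolume n M) := by
    simp only [Complex.norm_real, norm_norm, hnorm, zero_lt_one]
  -- Cancelling `ħ > 0` and the roots of nonnegative numbers turns equality of standard deviations
  -- into equality of the abstract variance with the bottom of the Rayleigh quotients.
  rw [SliceUncertainty.sigmaP, hV, Real.sqrt_mul (sq_nonneg hbar), Real.sqrt_sq hbar_pos.le,
    SliceUncertainty.isDirichletEigenfunction_iff hU hBU hB hc hX hn,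
    SliceUncertainty.lambda1_eq_bottom hU hBU hB hc hX, mul_right_inj' hbar_pos.ne',
    Real.sqrt_inj (h0.trans hle) h0, hm.variance_eq_bottom_iff hnorm]
  simp only [SliceUncertainty.ae_stateMeasure_iff hm.1.1]
  exact ⟨mul_nonneg (sq_nonneg _) (h0.trans hle),
    mul_le_mul_of_nonneg_left (Real.sqrt_le_sqrt hle) hbar_pos.le, Iff.rfl⟩
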